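/- **Setting.** Let $\{P_{\theta,\eta}:\theta\in\Theta,\ \eta\in\mathcal H\}$, $\Theta\subset\mathbb R^d$, be a semiparametric model with densities $\mathrm{lik}(\theta,\eta)(x)$ with respect to a measure $\mu$ on a sample space $\mathcal X$, where $\mathcal H$ is an arbitrary subset of a space with a (semi)norm $\|\cdot\|$. Let $X_1,X_2,\dots$ be i.i.d. from $P=P_{\theta_0,\eta_0}$, with $\theta_0\in\Theta$, $\eta_0\in\mathcal H$. Write $\mathbb P_n$ for the empirical measure, $\mathbb G_n=\sqrt n(\mathbb P_n-P)$, $\mathrm{lik}_n(\theta,\eta)=\prod_{i\le n}\mathrm{lik}(\theta,\eta)(X_i)$ and $pl_n(\theta)=\sup_{\eta\in\mathcal H}\mathrm{lik}_n(\theta,\eta)$. Assume that almost surely $\hat\eta_\theta\in\mathcal H$ maximizes $\eta\mapsto \mathrm{lik}_n(\theta,\eta)$ for every $\theta\in\Theta$, that $\hat\theta_n\in\Theta$ maximizes $pl_n$ over $\Theta$, and that $pl_n$ is measurable in $\theta$. Symbols $O_P,o_P$ refer to (outer) probability; random sequences $\tilde\theta_n$ are arbitrary $\Theta$-valued maps on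 the underlying probability space. Fix $r>1/4$ and put $M_n(r)=n^{-1/2}+n^{-2r+1/2}$. *Efficient score.* Let $\dot\ell_{\theta_0,\eta_0}\in L_2(P)$ be the gradient in $\theta$ of $\log \mathrm{lik}(\theta,\eta_0)$ at $\theta_0$. Fix any collection of paths $s\mapsto\eta_s$ in $\mathcal H$ that pass through the true value $\eta_0$ at $s=0$; the nuisance scores are the derivatives $\partial_s|_{s=0}\log\mathrm{lik}(\theta_0,\eta_s)$ along them that exist and lie in $L_2^0(P)$. The efficient score $\tilde\ell_0$ is $\dot\ell_{\theta_0,\eta_0}$ minus its componentwise $L_2(P)$-projection onto the closed linear span of the nuisance scores, and $\tilde I_0$ is the covariance matrix of $\tilde\ell_0$ under $P$. *Submodel.* Let $(t,\theta,\eta)\mapsto\eta_t(\theta,\eta)$ be a map with values in $\mathcal H$ for $(t,\theta,\eta)$ in a neighborhood of $(\theta_0,\theta_0,\eta_0)$ in $\Theta\times\Theta\times\mathcal H$, and put $\ell(t,\theta,\eta)=\log\mathrm{lik}(t,\eta_t(\theta,\eta))$, with $\dot\ell,\ddot\ell,\ell^{(3)}$ its derivatives in $t$ and $\ell_{t,\theta}$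 the derivative of $\dot\ell$ in $\theta$. Outside one $\mu$-null set of $x$: near $(\theta_0,\theta_0,\eta_0)$, $\mathrm{lik}(t,\eta_t(\theta,\eta))(x)>0$, and $\ell(t,\theta,\eta)(x)$ is three times continuously differentiable in $(t,\theta)$. The second-order derivatives $\partial_t^2$ and $\partial_t\partial_\theta$ of $\mathrm{lik}(t,\eta_t(\theta,\eta_0))(x)$ are dominated by a $\mu$-integrable function of $x$ for $(t,\theta)$ near $(\theta_0,\theta_0)$. The submodel is least favorable at the truth: $\dot\ell(\theta_0,\theta_0,\eta_0)=\tilde\ell_0$ $P$-a.s. **Assumptions.** (A) $\Theta$ is compact, $\theta_0$ is interior to $\Theta$; $\eta_\theta(\theta,\eta)=\eta$ on $\Theta\times\mathcal H$; $\tilde I_0$ is positive definite. (B1) For $(l,m)\in\{(0,0),(1,0),(2,0),(3,0),(1,1),(1,2),(2,1)\}$ the derivatives $\partial_t^l\partial_\theta^m\ell(t,\theta,\eta)$ have a $P$-integrable envelope over some neighborhood of $(\theta_0,\theta_0,\eta_0)$. (B2) For every $\tilde\theta_n\to\theta_0$ in probability, $\mathbb G_n(\dot\ell(\theta_0,\theta_0,\hat\eta_{\tilde\theta_n})-\dot\ell(\theta_0,\theta_0,\eta_0))=O_P(M_n(r)+(n^{1/2-r}\vee1)\|\tilde\theta_n-\theta_0\|)$;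 and for $\eta\in\mathcal H$ near $\eta_0$, $P\ddot\ell(\theta_0,\theta_0,\eta)-P\ddot\ell(\theta_0,\theta_0,\eta_0)=O(\|\eta-\eta_0\|)$, $P\ell_{t,\theta}(\theta_0,\theta_0,\eta)-P\ell_{t,\theta}(\theta_0,\theta_0,\eta_0)=O(\|\eta-\eta_0\|)$ and $P\dot\ell(\theta_0,\theta_0,\eta)=O(\|\eta-\eta_0\|^2)$. (C1) Over some neighborhood of $(\theta_0,\theta_0,\eta_0)$, the classes of all components of $\ddot\ell(t,\theta,\eta)$ and of $\ell_{t,\theta}(t,\theta,\eta)$ are $P$-Donsker and the classes of components of $\ell^{(3)}(t,\theta,\eta)$ are $P$-Glivenko–Cantelli. (Rate) $\|\hat\eta_{\tilde\theta_n}-\eta_0\|=O_P(\|\tilde\theta_n-\theta_0\|+n^{-r})$ for every $\tilde\theta_n\to\theta_0$ in probability. (Separation) With $\Delta_n(\theta)=n^{-1}\{\log pl_n(\theta)-\log pl_n(\hat\theta_n)\}$ (and $\log 0=-\infty$), $\Delta_n(\tilde\theta_n)=o_P(1)$ implies $\tilde\theta_n\to\theta_0$ in probability, for any random sequence $\tilde\theta_n\in\Theta$.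 (Prior) $\rho$ is a proper (probability) prior density on $\Theta$ with $\rho(\theta_0)>0$ that is continuously differentiable in a neighborhood of $\theta_0$, and $\int_\Theta\|\theta\|^2\rho(\theta)\,d\theta<\infty$. **Conclusion.** Let $\tilde E_{\theta|\tilde X}(\theta)$ and $\widetilde{\mathrm{Var}}_{\theta|\tilde X}(\theta)$ be the mean and the covariance matrix of the posterior profile distribution, whose density on $\Theta$ is proportional to $\rho(\theta)\,pl_n(\theta)$. With probability tending to one this distribution is well defined with finite second moment and invertible covariance matrix, and $$\hat\theta_n=\tilde E_{\theta|\tilde X}(\theta)+O_P\bigl(n^{-1/2}M_n(r)\bigr),\qquad \tilde I_0=n^{-1}\bigl(\widetilde{\mathrm{Var}}_{\theta|\tilde X}(\theta)\bigr)^{-1}+O_P\bigl(M_n(r)\bigr),$$ the second one for every matrix entry. -/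

import Mathlib

open MeasureTheory ProbabilityTheory Filter Topology Metric
open scoped ENNReal

noncomputable section

namespace ProfileSampler

/-! ### Stochastic orders (with outer probabilities) -/

/-- `T n = O_P (a n)` with respect to `Q`, where the rate `a n` may itself be random.  No
measurability is needed: `Q` of an arbitrary set is its outer measure. -/
def IsBigOP {Ω : Type*} [MeasurableSpace Ω] (Q : Measure Ω) (T a : ℕ → Ω → ℝ) : Prop :=
  ∀ ε : ℝ≥0∞, 0 < ε → ∃ K : ℝ, ∀ᶠ n in atTop, Q {ω | K * a n ω < |T n ω|} ≤ ε

/-- `M_n(r) = n^{-1/2} + n^{-2r+1/2}`. -/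
def rateM (r : ℝ) (n : ℕ) : ℝ := (n : ℝ) ^ (-(1 / 2) : ℝ) + (n : ℝ) ^ (-2 * r + 1 / 2)

/-! ### Empirical processes, Glivenko-Cantelli and Donsker classes -/

section Empirical

variable {S : Type*} [MeasurableSpace S]

/-- The empirical mean `ℙ_n f`. -/
def empMean (n : ℕ) (x : Fin n → S) (f : S → ℝ) : ℝ := (n : ℝ)⁻¹ * ∑ i, f (x i)

/-- The empirical process `𝔾_n f = √n (ℙ_n f - P f)`. -/
def empProc (P : Measure S) (n : ℕ) (x : Fin n → S) (f : S → ℝ) : ℝ :=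
  Real.sqrt n * (empMean n x f - ∫ y, f y ∂P)

/-- The outer expectation `E^* T` (used for bounded maps `T`, not necessarily measurable). -/
def outerExp {Ω : Type*} [MeasurableSpace Ω] (Q : Measure Ω) (T : Ω → ℝ) : ℝ :=
  sInf {a : ℝ | ∃ U : Ω → ℝ, Integrable U Q ∧ (∀ ω, T ω ≤ U ω) ∧ a = ∫ ω, U ω ∂Q}

/-- The space `ℓ^∞(F)` of bounded real functions on the class `F`, with the supremum norm. -/
abbrev EllInf (F : Set (S → ℝ)) : Type _ := lp (fun _ : F => ℝ) ∞

open Classical in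
/-- A bounded function on `F` as an element of `ℓ^∞(F)`. -/
def toEllInf (F : Set (S → ℝ)) (z : F → ℝ) : EllInf F :=
  if h : Memℓp z ∞ then ⟨z, h⟩ else 0

/-- `F` is `P`-Glivenko-Cantelli: `sup_{f ∈ F} |ℙ_n f - P f| → 0` in outer probability. -/
def IsGlivenkoCantelli (P : Measure S) (F : Set (S → ℝ)) : Prop :=
  (∀ f ∈ F, Integrable f P) ∧
  ∀ ε : ℝ, 0 < ε →
    Tendsto (fun n : ℕ => Measure.pi (fun _ : Fin n => P)
      {x | ∃ f ∈ F, ε < |empMean n x f - ∫ y, f y ∂P|}) atTop (𝓝 0)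

/-- `F` is `P`-Donsker: the empirical process, a map into `ℓ^∞(F)`, converges weakly in the sense of
Hoffmann-Jorgensen (`E^* h(𝔾_n) → ∫ h dL` for all bounded continuous `h`) to a tight Borel
probability measure `L` on `ℓ^∞(F)`. -/
def IsDonsker (P : Measure S) (F : Set (S → ℝ)) : Prop :=
  (∀ f ∈ F, MemLp f 2 P) ∧
  (∀ᵐ x ∂P, ∃ C : ℝ, ∀ f ∈ F, |f x - ∫ y, f y ∂P| ≤ C) ∧
  letI : MeasurableSpace (EllInf F) := borel (EllInf F)
  ∃ L : Measure (EllInf F), IsProbabilityMeasure L ∧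
    (∀ ε : ℝ≥0∞, 0 < ε → ∃ K : Set (EllInf F), IsCompact K ∧ L Kᶜ ≤ ε) ∧
    ∀ h : BoundedContinuousFunction (EllInf F) ℝ,
      Tendsto (fun n : ℕ => outerExp (Measure.pi (fun _ : Fin n => P))
        (fun x => h (toEllInf F (fun f => empProc P n x f)))) atTop (𝓝 (∫ z, h z ∂L))

end Empirical

/-! ### Partial derivatives in the two Euclidean arguments `(t, θ)` -/

/-- The partial derivative in the `i`-th coordinate of the first argument `t`. -/
def dT {d : ℕ} (i : Fin d)
    (f : EuclideanSpace ℝ (Fin d) → EuclideanSpace ℝ (Fin d) → ℝ) :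
    EuclideanSpace ℝ (Fin d) → EuclideanSpace ℝ (Fin d) → ℝ :=
  fun t θ => fderiv ℝ (fun s => f s θ) t (EuclideanSpace.single i 1)

/-- The partial derivative in the `i`-th coordinate of the second argument `θ`. -/
def dTheta {d : ℕ} (i : Fin d)
    (f : EuclideanSpace ℝ (Fin d) → EuclideanSpace ℝ (Fin d) → ℝ) :
    EuclideanSpace ℝ (Fin d) → EuclideanSpace ℝ (Fin d) → ℝ :=
  fun t θ => fderiv ℝ (fun s => f t s) θ (EuclideanSpace.single i 1)

/-- The iterated partial derivative: first in the `t`-coordinates listed in `I`, then in the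
`θ`-coordinates listed in `J`. -/
def pder {d : ℕ} (f : EuclideanSpace ℝ (Fin d) → EuclideanSpace ℝ (Fin d) → ℝ)
    (I J : List (Fin d)) : EuclideanSpace ℝ (Fin d) → EuclideanSpace ℝ (Fin d) → ℝ :=
  J.foldr dTheta (I.foldr dT f)

/-! ### Semiparametric models -/

/-- A semiparametric model `{P_{θ,η} : θ ∈ Θ ⊆ ℝ^d, η ∈ H}` on the sample space `S`, given by
densities `lik θ η` with respect to a dominating measure `μ`, together with the true parameter
value `(θ₀, η₀)`.  The nuisance parameter set `H` is an arbitrary subset of a (semi)normed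
group `B`. -/
structure SemiModel (d : ℕ) (S : Type*) [MeasurableSpace S] (B : Type*)
    [SeminormedAddCommGroup B] where
  μ : Measure S
  Θ : Set (EuclideanSpace ℝ (Fin d))
  H : Set B
  lik : EuclideanSpace ℝ (Fin d) → B → S → ℝ
  measurable_lik : ∀ θ ∈ Θ, ∀ η ∈ H, Measurable (lik θ η)
  lik_nonneg : ∀ θ ∈ Θ, ∀ η ∈ H, ∀ x, 0 ≤ lik θ η x
  lintegral_lik : ∀ θ ∈ Θ, ∀ η ∈ H, ∫⁻ x, ENNReal.ofReal (lik θ η x) ∂μ = 1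
  θ₀ : EuclideanSpace ℝ (Fin d)
  η₀ : B
  θ₀_mem : θ₀ ∈ Θ
  η₀_mem : η₀ ∈ H

namespace SemiModel

variable {d : ℕ} {S : Type*} [MeasurableSpace S] {B : Type*} [SeminormedAddCommGroup B]
  (M : SemiModel d S B)

/-- The true distribution `P = P_{θ₀,η₀}` of one observation. -/
def P : Measure S := M.μ.withDensity (fun x => ENNReal.ofReal (M.lik M.θ₀ M.η₀ x))

/-! #### Efficient score and efficient information at the true parameter -/

/-- The `i`-th component of the ordinary score for `θ` at the truth: the partial derivative of
`θ ↦ log lik(θ, η₀)(x)` at `θ₀`. -/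
def score (i : Fin d) (x : S) : ℝ :=
  fderiv ℝ (fun θ => Real.log (M.lik θ M.η₀ x)) M.θ₀ (EuclideanSpace.single i 1)

/-- The scores for the nuisance parameter at the truth along the submodels `s ↦ η_s` in the
collection `N`: the functions `∂/∂s|_{s=0} log lik(θ₀, η_s)` in `L_2^0(P)`, for paths in `H` that
pass through `η₀` at `s = 0`. -/
def nuisanceScores (N : Set (ℝ → B)) : Set (Lp ℝ 2 M.P) :=
  {g | ∃ γ ∈ N, γ 0 = M.η₀ ∧ (∀ᶠ s in 𝓝 (0 : ℝ), γ s ∈ M.H) ∧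
    (∀ᵐ x ∂M.P, (∀ᶠ s in 𝓝 (0 : ℝ), 0 < M.lik M.θ₀ (γ s) x) ∧
      HasDerivAt (fun s => Real.log (M.lik M.θ₀ (γ s) x)) (g x) 0) ∧
    ∫ x, g x ∂M.P = 0}

/-- The closed linear span of the nuisance scores in `L_2(P)`. -/
def nuisanceSpace (N : Set (ℝ → B)) : Submodule ℝ (Lp ℝ 2 M.P) :=
  (Submodule.span ℝ (M.nuisanceScores N)).topologicalClosure

/-- The efficient score: the score for `θ` minus its orthogonal projection (componentwise) onto the
closed linear span of the nuisance scores. -/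
def effScore (N : Set (ℝ → B)) (hS : ∀ i, MemLp (M.score i) 2 M.P) (i : Fin d) : Lp ℝ 2 M.P :=
  haveI : CompleteSpace (M.nuisanceSpace N) :=
    (Submodule.isClosed_topologicalClosure _).completeSpace_coe
  (hS i).toLp (M.score i) - (M.nuisanceSpace N).starProjection ((hS i).toLp (M.score i))

/-- The efficient information matrix: the covariance matrix of the efficient score. -/
def effInfo (N : Set (ℝ → B)) (hS : ∀ i, MemLp (M.score i) 2 M.P) : Matrix (Fin d) (Fin d) ℝ :=
  Matrix.of fun i j => cov[fun x => M.effScore N hS i x, fun x => M.effScore N hS j x; M.P]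

/-! #### The least favorable submodel -/

/-- `sub path η x t θ = lik(t, η_t(θ, η))(x)`, where `path t θ η` stands for `η_t(θ, η)`. -/
def sub (path : EuclideanSpace ℝ (Fin d) → EuclideanSpace ℝ (Fin d) → B → B) (η : B) (x : S)
    (t θ : EuclideanSpace ℝ (Fin d)) : ℝ :=
  M.lik t (path t θ η) x

/-- `logSub path η x t θ = ℓ(t, θ, η)(x) = log lik(t, η_t(θ, η))(x)`. -/
def logSub (path : EuclideanSpace ℝ (Fin d) → EuclideanSpace ℝ (Fin d) → B → B) (η : B) (x : S)
    (t θ : EuclideanSpace ℝ (Fin d)) : ℝ :=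
  Real.log (M.sub path η x t θ)

/-- The derivative `∂_t^I ∂_θ^J ℓ(t, θ, η)(x)`. -/
def dl (path : EuclideanSpace ℝ (Fin d) → EuclideanSpace ℝ (Fin d) → B → B)
    (I J : List (Fin d)) (t θ : EuclideanSpace ℝ (Fin d)) (η : B) (x : S) : ℝ :=
  pder (M.logSub path η x) I J t θ

/-- The basic neighborhoods of `(θ₀, θ₀, η₀)`, with `η` restricted to `H`. -/
def nbhd (δ : ℝ) :
    Set (EuclideanSpace ℝ (Fin d) × EuclideanSpace ℝ (Fin d) × B) :=
  {p | p.1 ∈ ball M.θ₀ δ ∧ p.2.1 ∈ ball M.θ₀ δ ∧ p.2.2 ∈ M.H ∧ p.2.2 ∈ ball M.η₀ δ}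

/-- The class of functions `{∂_t^I ∂_θ^J ℓ(t, θ, η) : (t, θ, η) ∈ nbhd δ}`. -/
def dlClass (path : EuclideanSpace ℝ (Fin d) → EuclideanSpace ℝ (Fin d) → B → B)
    (I J : List (Fin d)) (δ : ℝ) : Set (S → ℝ) :=
  (fun p => M.dl path I J p.1 p.2.1 p.2.2) '' M.nbhd δ

/-! #### Likelihood, profile likelihood, and the posterior profile distribution -/

section Data

variable {Ω : Type*} [MeasurableSpace Ω] (X : ℕ → Ω → S)

/-- The likelihood `lik_n(θ, η)` of the first `n` observations. -/
def likN (n : ℕ) (ω : Ω) (θ : EuclideanSpace ℝ (Fin d)) (η : B) : ℝ :=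
  ∏ i : Fin n, M.lik θ η (X i ω)

/-- The profile likelihood `pl_n(θ) = sup_{η ∈ H} lik_n(θ, η)`. -/
def profLik (n : ℕ) (ω : Ω) (θ : EuclideanSpace ℝ (Fin d)) : ℝ :=
  ⨆ η : M.H, M.likN X n ω θ η

/-- `Δ_n(θ) = n⁻¹ (log pl_n(θ) - log pl_n(θ̂_n))`. -/
def Delta (θhat : ℕ → Ω → EuclideanSpace ℝ (Fin d)) (n : ℕ) (ω : Ω)
    (θ : EuclideanSpace ℝ (Fin d)) : ℝ :=
  (n : ℝ)⁻¹ * (Real.log (M.profLik X n ω θ) - Real.log (M.profLik X n ω (θhat n ω)))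

/-- The prior distribution on `Θ` with Lebesgue density `ρ`. -/
def prior (ρ : EuclideanSpace ℝ (Fin d) → ℝ) : Measure (EuclideanSpace ℝ (Fin d)) :=
  (volume.restrict M.Θ).withDensity (fun θ => ENNReal.ofReal (ρ θ))

/-- The unnormalized posterior profile distribution `pl_n(θ) ρ(θ) dθ` on `Θ`. -/
def posteriorU (ρ : EuclideanSpace ℝ (Fin d) → ℝ) (n : ℕ) (ω : Ω) :
    Measure (EuclideanSpace ℝ (Fin d)) :=
  (M.prior ρ).withDensity (fun θ => ENNReal.ofReal (M.profLik X n ω θ))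

/-- The posterior profile distribution of `θ`. -/
def posterior (ρ : EuclideanSpace ℝ (Fin d) → ℝ) (n : ℕ) (ω : Ω) :
    Measure (EuclideanSpace ℝ (Fin d)) :=
  (M.posteriorU X ρ n ω Set.univ)⁻¹ • M.posteriorU X ρ n ω

/-- The posterior profile mean. -/
def postMean (ρ : EuclideanSpace ℝ (Fin d) → ℝ) (n : ℕ) (ω : Ω) : EuclideanSpace ℝ (Fin d) :=
  ∫ θ, θ ∂(M.posterior X ρ n ω)

/-- The posterior profile covariance matrix. -/
def postCov (ρ : EuclideanSpace ℝ (Fin d) → ℝ) (n : ℕ) (ω : Ω) : Matrix (Fin d) (Fin d) ℝ :=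
  Matrix.of fun i j => cov[fun θ => θ i, fun θ => θ j; M.posterior X ρ n ω]

/-- `ηhat n ω θ` and `θhat n ω` are the maximizers: almost surely, `η̂_θ` maximizes
`η ↦ lik_n(θ, η)` over `H` for every `θ ∈ Θ`, and `θ̂_n` maximizes `pl_n` over `Θ`. -/
structure IsMLE (Q : Measure Ω) (θhat : ℕ → Ω → EuclideanSpace ℝ (Fin d))
    (ηhat : ℕ → Ω → EuclideanSpace ℝ (Fin d) → B) : Prop where
  ηhat_mem : ∀ n, ∀ᵐ ω ∂Q, ∀ θ ∈ M.Θ, ηhat n ω θ ∈ M.H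
  ηhat_max : ∀ n, ∀ᵐ ω ∂Q, ∀ θ ∈ M.Θ, ∀ η ∈ M.H,
    M.likN X n ω θ η ≤ M.likN X n ω θ (ηhat n ω θ)
  θhat_mem : ∀ n, ∀ᵐ ω ∂Q, θhat n ω ∈ M.Θ
  θhat_max : ∀ n, ∀ᵐ ω ∂Q, ∀ θ ∈ M.Θ, M.profLik X n ω θ ≤ M.profLik X n ω (θhat n ω)

/-- A (random) sequence in `Θ` that converges to `θ₀` in (outer) probability. -/
def IsConsistent (Q : Measure Ω) (θt : ℕ → Ω → EuclideanSpace ℝ (Fin d)) : Prop :=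
  (∀ n ω, θt n ω ∈ M.Θ) ∧ TendstoInMeasure Q θt atTop (fun _ => M.θ₀)

/-- The nuisance parameter converges at the rate `r`:
`‖η̂_{θ̃_n} - η₀‖ = O_P(‖θ̃_n - θ₀‖ + n^{-r})` whenever `θ̃_n → θ₀` in probability. -/
def NuisanceRate (Q : Measure Ω) (ηhat : ℕ → Ω → EuclideanSpace ℝ (Fin d) → B) (r : ℝ) : Prop :=
  ∀ θt : ℕ → Ω → EuclideanSpace ℝ (Fin d), M.IsConsistent Q θt →
    IsBigOP Q (fun n ω => ‖ηhat n ω (θt n ω) - M.η₀‖)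
      (fun n ω => ‖θt n ω - M.θ₀‖ + (n : ℝ) ^ (-r))

/-- The standing assumptions on the model, on the least favorable submodel `path`, on the data and
on the maximizers. -/
structure Assumptions (path : EuclideanSpace ℝ (Fin d) → EuclideanSpace ℝ (Fin d) → B → B)
    (N : Set (ℝ → B)) (hS : ∀ i, MemLp (M.score i) 2 M.P) (Q : Measure Ω)
    (ηhat : ℕ → Ω → EuclideanSpace ℝ (Fin d) → B) (r : ℝ) : Prop where
  /-- `Θ` is compact. -/
  compact : IsCompact M.Θ
  /-- `θ₀` is an interior point of `Θ`. -/
  interior : M.θ₀ ∈ interior M.Θ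
  /-- The submodel takes values in the parameter set for `η`. -/
  path_mem : ∃ δ > 0, ∀ p ∈ M.nbhd δ, path p.1 p.2.1 p.2.2 ∈ M.H
  /-- The submodel passes through `(θ, η)`. -/
  path_self : ∀ θ ∈ M.Θ, ∀ η ∈ M.H, path θ θ η = η
  /-- The log-likelihood along the submodel is finite near the truth. -/
  sub_pos : ∃ δ > 0, ∀ᵐ x ∂M.μ, ∀ p ∈ M.nbhd δ, 0 < M.sub path p.2.2 x p.1 p.2.1
  /-- The log-likelihood along the submodel is smooth in `(t, θ)` near the truth. -/
  smooth : ∃ δ > 0, ∀ᵐ x ∂M.μ, ∀ η ∈ M.H, η ∈ ball M.η₀ δ →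
    ContDiffOn ℝ 3 (fun p : EuclideanSpace ℝ (Fin d) × EuclideanSpace ℝ (Fin d) =>
      M.logSub path η x p.1 p.2) (ball M.θ₀ δ ×ˢ ball M.θ₀ δ)
  /-- The identity `∫ lik(t, η_t(θ, η₀)) dμ = 1` may be differentiated twice under the integral
  sign (twice in `t`, or once in `t` and once in `θ`) near the truth. -/
  dominated : ∃ δ > 0, ∃ G : S → ℝ, Integrable G M.μ ∧
    ∀ᵐ x ∂M.μ, ∀ t ∈ ball M.θ₀ δ, ∀ θ ∈ ball M.θ₀ δ, ∀ i j,
      |pder (M.sub path M.η₀ x) [i, j] [] t θ| ≤ G x ∧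
      |pder (M.sub path M.η₀ x) [i] [j] t θ| ≤ G x
  /-- The submodel is least favorable at the truth. -/
  leastFavorable : ∀ i, M.dl path [i] [] M.θ₀ M.θ₀ M.η₀ =ᵐ[M.P] M.effScore N hS i
  /-- The efficient information matrix is positive definite. -/
  posDef : (M.effInfo N hS).PosDef
  /-- Integrable envelopes of the derivatives of `ℓ(t, θ, η)`. -/
  envelope : ∀ I J : List (Fin d),
    (I.length, J.length) ∈
      ({(0, 0), (1, 0), (2, 0), (3, 0), (1, 1), (1, 2), (2, 1)} : Set (ℕ × ℕ)) →
    ∃ δ > 0, ∃ F : S → ℝ, Integrable F M.P ∧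
      ∀ᵐ x ∂M.P, ∀ p ∈ M.nbhd δ, |M.dl path I J p.1 p.2.1 p.2.2 x| ≤ F x
  /-- The modulus of continuity of the empirical process. -/
  modulus : ∀ θt : ℕ → Ω → EuclideanSpace ℝ (Fin d), M.IsConsistent Q θt → ∀ i,
    IsBigOP Q
      (fun n ω => empProc M.P n (fun k => X k ω)
        (fun x => M.dl path [i] [] M.θ₀ M.θ₀ (ηhat n ω (θt n ω)) x
          - M.dl path [i] [] M.θ₀ M.θ₀ M.η₀ x))
      (fun n ω => rateM r n + max ((n : ℝ) ^ (1 / 2 - r)) 1 * ‖θt n ω - M.θ₀‖)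
  /-- `P ℓ̈(θ₀, θ₀, η) - P ℓ̈(θ₀, θ₀, η₀) = O(‖η - η₀‖)`. -/
  smooth_tt : ∃ δ > 0, ∃ C : ℝ, ∀ η ∈ M.H, η ∈ ball M.η₀ δ → ∀ i j,
    |∫ x, M.dl path [i, j] [] M.θ₀ M.θ₀ η x ∂M.P
      - ∫ x, M.dl path [i, j] [] M.θ₀ M.θ₀ M.η₀ x ∂M.P| ≤ C * ‖η - M.η₀‖
  /-- `P ℓ_{t,θ}(θ₀, θ₀, η) - P ℓ_{t,θ}(θ₀, θ₀, η₀) = O(‖η - η₀‖)`. -/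
  smooth_tθ : ∃ δ > 0, ∃ C : ℝ, ∀ η ∈ M.H, η ∈ ball M.η₀ δ → ∀ i j,
    |∫ x, M.dl path [i] [j] M.θ₀ M.θ₀ η x ∂M.P
      - ∫ x, M.dl path [i] [j] M.θ₀ M.θ₀ M.η₀ x ∂M.P| ≤ C * ‖η - M.η₀‖
  /-- `P ℓ̇(θ₀, θ₀, η) = O(‖η - η₀‖²)`. -/
  noBias : ∃ δ > 0, ∃ C : ℝ, ∀ η ∈ M.H, η ∈ ball M.η₀ δ → ∀ i,
    |∫ x, M.dl path [i] [] M.θ₀ M.θ₀ η x ∂M.P| ≤ C * ‖η - M.η₀‖ ^ 2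
  /-- The Donsker and Glivenko-Cantelli classes. -/
  donsker_tt : ∃ δ > 0, ∀ i j, IsDonsker M.P (M.dlClass path [i, j] [] δ)
  donsker_tθ : ∃ δ > 0, ∀ i j, IsDonsker M.P (M.dlClass path [i] [j] δ)
  glivenkoCantelli : ∃ δ > 0, ∀ i j k, IsGlivenkoCantelli M.P (M.dlClass path [i, j, k] [] δ)

end Data

end SemiModel

end ProfileSampler

end

open ProfileSampler

/-! Write `A` for the efficient information, `w` for the empirical mean of the efficient score, `a =
n^{-1/2} + n^{-r}` and `M_n` for `rateM r n`. The rates come from `a² ≤ 2 n^{-1/2} M_n`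
(`rateA_sq_le`).

The profile likelihood is a supremum over an infinite-dimensional set, and a sandwich reduces it to
finite dimension. The submodel based at `(b, η̂_b)` takes values in `H` and passes through `η̂_b` at
`b`. Its likelihood at `s` is therefore at most `pl_n(s)`, with equality at `s = b`. So `log pl_n(t)
- log pl_n(t')` lies between the increments of the log likelihood along the submodels based at `t'`
and at `t` (`profLik_expansion`).

Each increment is the integral of an empirical score `ℙ_n ℓ̇(s, b, η̂_b)`, which equals `w - A(s -
θ₀)` up to a multiple of `(a + ‖s - θ₀‖ + ‖b - θ₀‖)²` (`empMean_score_expansion`). This is a Taylor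
expansion at `(θ₀, θ₀, η̂_b)` in `(t, θ)`, combined with three facts: `P ℓ̈ = -A` and `P ℓ_{t,θ} =
0` at the truth, from differentiating `∫ lik dμ = 1` twice and from orthogonality of the efficient
score to the nuisance scores; the quadratic bias `P ℓ̇(θ₀, θ₀, η) = O(‖η - η₀‖²)`; and the bounds on
the empirical processes. Integration leaves a factor `‖t - t'‖` in the remainder of the profile
likelihood, and this factor yields the sharp rates.

Let `θs = θ₀ + A⁻¹ w`. Completing the square turns the expansion around `θs` into `-(t - θs)ᵀA(t -
θs)/2` with remainder `O(‖t - θs‖ (a + ‖t - θs‖)²)`. At the maximizer the quadratic term is at most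
the remainder; dividing by the norm gives `‖θ̂_n - θs‖ = O(a²) = O(n^{-1/2} M_n)`
(`norm_maximizer_sub_le`). In the coordinate `u = √n(θ - θs)` the remainder times `n` is `O(M_n (1 +
‖u‖)³)`, so the posterior density is a Gaussian density with precision `A` up to a relative error of
order `M_n`. The prior varies by `O(n^{-1/2})` on this scale, and away from `θ₀` separation makes
the likelihood ratio exponentially small. Hence the first two moments of `u` are those of the
Gaussian up to `O(M_n)` (`posterior_moments`). The first moment locates the posterior mean within
`O(n^{-1/2} M_n)` of `θs`; the second gives `n Var = A⁻¹ + O(M_n)`, and matrix inversion is locally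
Lipschitz.

The hypotheses speak of random sequences, whereas this argument needs bounds that hold for all `θ`
near `θ₀` at once. A diagonal choice of bad points (`exists_eventually_measure_le_of_seq`) bridges
the gap; no measurable selection is required because all probabilities are outer ones. -/

namespace ProfileSampler

/-! ### From random sequences to uniform statements -/

section Uniform

variable {Ω : Type*} [MeasurableSpace Ω] {Q : Measure Ω}

/-- A diagonal argument: a property that holds along every random sequence holds uniformly. -/
theorem exists_eventually_measure_le_of_seq {E : Type*} {bad : ℕ → ℕ → Ω → E → Prop}
    (default : ℕ → Ω → E) {ε : ℝ≥0∞}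
    (h : ∀ φ : ℕ → ℕ, StrictMono φ → ∀ θt : ℕ → Ω → E,
      (∀ n ω, θt n ω = default n ω ∨ ∃ k, n = φ k ∧ bad n k ω (θt n ω)) →
      ∃ k, Q {ω | bad (φ k) k ω (θt (φ k) ω)} ≤ ε) :
    ∃ k, ∀ᶠ n in atTop, Q {ω | ∃ θ, bad n k ω θ} ≤ ε := by
  classical
  -- If every level fails, the level-`k` bad event has measure above `ε` for infinitely many `n`;
  -- let `φ k` be such an `n`, increasing in `k`. One sequence then collects bad points of all
  -- levels.
  by_contra hcon
  push Not at hcon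
  obtain ⟨φ, hφ, hφk⟩ := extraction_forall_of_frequently hcon
  set θt : ℕ → Ω → E := fun n ω =>
    if H : ∃ θ, ∃ k, n = φ k ∧ bad n k ω θ then H.choose else default n ω with hθt
  obtain ⟨k, hk⟩ := h φ hφ θt (by
    intro n ω
    by_cases H : ∃ θ, ∃ k, n = φ k ∧ bad n k ω θ
    · right
      have := H.choose_spec
      simp only [hθt, dif_pos H]
      exact this
    · left
      simp only [hθt, dif_neg H])
  refine absurd hk (not_le.mpr ((hφk k).trans_le (measure_mono ?_)))
  rintro ω ⟨θ, hθ⟩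
  have H : ∃ θ, ∃ k', φ k = φ k' ∧ bad (φ k) k' ω θ := ⟨θ, k, rfl, hθ⟩
  -- Injectivity of `φ` recovers the level from the index, so the point chosen at time `φ k` is bad
  -- at level `k` itself.
  obtain ⟨k', hk', hb⟩ := H.choose_spec
  have hkk : k' = k := (hφ.injective hk').symm
  subst hkk
  simp only [Set.mem_ofPred_eq, hθt, dif_pos H]
  exact hb

/-- A bad point of level `k` lies within `1/(k+1)` of `θ₀` and violates the bound with constant
`k+1`. A sequence of bad points of growing level converges to `θ₀`, so it obeys the bound with some
fixed `K`, which contradicts badness once `k+1` exceeds `K`. -/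
theorem exists_uniform_bound_of_consistent {E : Type*} [PseudoMetricSpace E] {Θ : Set E} {θ₀ : E}
    (hθ₀ : θ₀ ∈ Θ) {T a : ℕ → Ω → E → ℝ} (ha : ∀ n ω θ, 0 ≤ a n ω θ)
    (h : ∀ θt : ℕ → Ω → E, (∀ n ω, θt n ω ∈ Θ) → TendstoInMeasure Q θt atTop (fun _ => θ₀) →
      IsBigOP Q (fun n ω => T n ω (θt n ω)) (fun n ω => a n ω (θt n ω)))
    {ε : ℝ≥0∞} (hε : 0 < ε) :
    ∃ K : ℝ, 0 < K ∧ ∃ δ : ℝ, 0 < δ ∧ ∀ᶠ n in atTop,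
      Q {ω | ∃ θ ∈ Θ, dist θ θ₀ < δ ∧ K * a n ω θ < |T n ω θ|} ≤ ε := by
  obtain ⟨k, hk⟩ := exists_eventually_measure_le_of_seq (Q := Q) (ε := ε)
    (bad := fun n k ω θ => θ ∈ Θ ∧ dist θ θ₀ < 1 / ((k : ℝ) + 1) ∧
      ((k : ℝ) + 1) * a n ω θ < |T n ω θ|) (fun _ _ => θ₀) (by
    intro φ hφ θt hθt
    have hmem : ∀ n ω, θt n ω ∈ Θ := fun n ω => by
      rcases hθt n ω with h1 | ⟨k, -, h1, -⟩
      · rw [h1]; exact hθ₀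
      · exact h1
    have hcons : TendstoInMeasure Q θt atTop (fun _ => θ₀) := by
      rw [tendstoInMeasure_iff_dist]
      intro η hη
      obtain ⟨k₀, hk₀⟩ := exists_nat_one_div_lt hη
      refine tendsto_const_nhds.congr' ?_
      filter_upwards [eventually_ge_atTop (φ k₀)] with n hn
      symm
      rw [show {ω | η ≤ dist (θt n ω) θ₀} = ∅ from ?_, measure_empty]
      refine Set.eq_empty_of_forall_notMem fun ω hω => ?_
      simp only [Set.mem_ofPred_eq] at hω
      rcases hθt n ω with h1 | ⟨k, hnk, -, h1, -⟩
      · rw [h1, dist_self] at hω; linarith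
      · have hkk : k₀ ≤ k := hφ.le_iff_le.mp (hnk ▸ hn)
        have : 1 / ((k : ℝ) + 1) ≤ 1 / ((k₀ : ℝ) + 1) := by gcongr
        linarith
    obtain ⟨K, hK⟩ := h θt hmem hcons ε hε
    obtain ⟨k₁, hk₁⟩ := exists_nat_ge K
    obtain ⟨N, hN⟩ := eventually_atTop.mp hK
    -- The level must exceed `K`, and its time `φ (max k₁ N)` must be past `N`; the maximum serves
    -- both.
    refine ⟨max k₁ N, (measure_mono ?_).trans (hN (φ (max k₁ N))
      ((le_max_right _ _).trans hφ.le_apply))⟩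
    rintro ω ⟨-, -, hω⟩
    refine lt_of_le_of_lt ?_ hω
    refine mul_le_mul_of_nonneg_right ?_ (ha _ _ _)
    have : (k₁ : ℝ) ≤ ((max k₁ N : ℕ) : ℝ) := by exact_mod_cast le_max_left _ _
    linarith)
  refine ⟨(k : ℝ) + 1, by positivity, 1 / ((k : ℝ) + 1), by positivity, ?_⟩
  filter_upwards [hk] with n hn
  refine (measure_mono ?_).trans hn
  rintro ω ⟨θ, h1, h2, h3⟩
  exact ⟨θ, h1, h2, h3⟩

end Uniform

/-! ### Empirical means and processes -/

section EmpMean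

variable {S : Type*}

theorem empMean_sub (n : ℕ) (x : Fin n → S) (f g : S → ℝ) :
    empMean n x (fun y => f y - g y) = empMean n x f - empMean n x g := by
  simp [empMean, Finset.sum_sub_distrib, mul_sub]

theorem empMean_const_mul (n : ℕ) (x : Fin n → S) (c : ℝ) (f : S → ℝ) :
    empMean n x (fun y => c * f y) = c * empMean n x f := by
  simp only [empMean, ← Finset.mul_sum]; ring

theorem empMean_sum {ι : Type*} (s : Finset ι) (n : ℕ) (x : Fin n → S) (f : ι → S → ℝ) :
    empMean n x (fun y => ∑ i ∈ s, f i y) = ∑ i ∈ s, empMean n x (f i) := by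
  simp only [empMean]
  rw [Finset.sum_comm, Finset.mul_sum]

theorem empMean_congr {n : ℕ} {x : Fin n → S} {f g : S → ℝ} (h : ∀ i, f (x i) = g (x i)) :
    empMean n x f = empMean n x g := by
  simp [empMean, h]

theorem empMean_mono {n : ℕ} {x : Fin n → S} {f g : S → ℝ} (h : ∀ i, f (x i) ≤ g (x i)) :
    empMean n x f ≤ empMean n x g :=
  mul_le_mul_of_nonneg_left (Finset.sum_le_sum fun i _ => h i) (by positivity)

theorem abs_empMean_le {n : ℕ} {x : Fin n → S} {f g : S → ℝ} (h : ∀ i, |f (x i)| ≤ g (x i)) :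
    |empMean n x f| ≤ empMean n x g := by
  rw [empMean, abs_mul, abs_of_nonneg (by positivity : (0 : ℝ) ≤ (n : ℝ)⁻¹)]
  exact mul_le_mul_of_nonneg_left
    ((Finset.abs_sum_le_sum_abs _ _).trans (Finset.sum_le_sum fun i _ => h i)) (by positivity)

end EmpMean

section Empirical

variable {S : Type*} [MeasurableSpace S]

theorem empProc_eq_sum (P : Measure S) (n : ℕ) (x : Fin n → S) (f : S → ℝ) :
    empProc P n x f = Real.sqrt n * ((n : ℝ)⁻¹ * ∑ i, (f (x i) - ∫ y, f y ∂P)) := by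
  rcases Nat.eq_zero_or_pos n with rfl | hn
  · simp [empProc]
  · have : (n : ℝ) ≠ 0 := by positivity
    simp only [empProc, empMean, Finset.sum_sub_distrib, Finset.sum_const, Finset.card_univ,
      Fintype.card_fin, nsmul_eq_mul]
    field_simp

/-- Markov's inequality for an integrable majorant whose integral is still below `ε`. Such a
majorant exists because the infimum runs over a nonempty set, by `hne`; over the empty set `sInf`
would be `0` and carry no information. -/
theorem outer_markov {Ω : Type*} [MeasurableSpace Ω] {Q : Measure Ω} {T : Ω → ℝ}
    (hT : ∀ ω, 0 ≤ T ω) (hne : ∃ U : Ω → ℝ, Integrable U Q ∧ ∀ ω, T ω ≤ U ω)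
    {ε : ℝ} (h : outerExp Q T < ε) : Q {ω | 1 ≤ T ω} ≤ ENNReal.ofReal ε := by
  obtain ⟨U₀, hU₀, hTU₀⟩ := hne
  obtain ⟨-, ⟨U, hU, hTU, rfl⟩, hlt⟩ := exists_lt_of_csInf_lt (s := {a : ℝ | ∃ U : Ω → ℝ, Integrable U Q ∧
    (∀ ω, T ω ≤ U ω) ∧ a = ∫ ω, U ω ∂Q}) ⟨_, U₀, hU₀, hTU₀, rfl⟩ h
  have hU0 : 0 ≤ U := fun ω => (hT ω).trans (hTU ω)
  calc Q {ω | 1 ≤ T ω} ≤ Q {ω | (1 : ℝ≥0∞) ≤ ENNReal.ofReal (U ω)} := by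
        refine measure_mono fun ω hω => ?_
        simp only [Set.mem_ofPred_eq] at hω ⊢
        simpa using hω.trans (hTU ω)
    _ ≤ (∫⁻ ω, ENNReal.ofReal (U ω) ∂Q) / 1 :=
        meas_ge_le_lintegral_div hU.1.aemeasurable.ennreal_ofReal one_ne_zero ENNReal.one_ne_top
    _ = ENNReal.ofReal (∫ ω, U ω ∂Q) := by
        rw [div_one, ofReal_integral_eq_lintegral_ofReal hU (ae_of_all _ hU0)]
    _ ≤ ENNReal.ofReal ε := ENNReal.ofReal_le_ofReal hlt.le

/-- `toEllInf` sends unbounded functions to `0`; almost surely this default is not used. -/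
theorem memℓp_empProc {P : Measure S} [IsProbabilityMeasure P] {F : Set (S → ℝ)}
    (hF : ∀ᵐ x ∂P, ∃ C : ℝ, ∀ f ∈ F, |f x - ∫ y, f y ∂P| ≤ C) (n : ℕ) :
    ∀ᵐ x ∂(Measure.pi (fun _ : Fin n => P)), Memℓp (fun f : F => empProc P n x f) ∞ := by
  have : ∀ᵐ x ∂(Measure.pi (fun _ : Fin n => P)), ∀ i : Fin n,
      ∃ C : ℝ, ∀ f ∈ F, |f (x i) - ∫ y, f y ∂P| ≤ C := by
    rw [ae_all_iff]
    intro i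
    exact (Measure.quasiMeasurePreserving_eval (fun _ : Fin n => P) i).ae hF
  filter_upwards [this] with x hx
  choose C hC using hx
  rw [memℓp_infty_iff]
  refine ⟨Real.sqrt n * ((n : ℝ)⁻¹ * ∑ i, C i), ?_⟩
  rintro - ⟨f, rfl⟩
  simp only [empProc_eq_sum, Real.norm_eq_abs]
  rw [abs_mul, abs_mul, abs_of_nonneg (Real.sqrt_nonneg _),
    abs_of_nonneg (by positivity : (0 : ℝ) ≤ (n : ℝ)⁻¹)]
  gcongr
  exact (Finset.abs_sum_le_sum_abs _ _).trans (Finset.sum_le_sum fun i _ => hC i f f.2)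

/-- The empirical process indexed by a Donsker class is asymptotically bounded. -/
theorem IsDonsker.exists_bound {P : Measure S} [IsProbabilityMeasure P] {F : Set (S → ℝ)}
    (hF : IsDonsker P F) {ε : ℝ≥0∞} (hε : 0 < ε) :
    ∃ K : ℝ, 0 < K ∧ ∀ᶠ n : ℕ in atTop,
      Measure.pi (fun _ : Fin n => P) {x | ∃ f ∈ F, K < |empProc P n x f|} ≤ ε := by
  obtain ⟨-, hbd, L, hL, htight, hconv⟩ := hF
  let _ : MeasurableSpace (EllInf F) := borel (EllInf F)
  have : BorelSpace (EllInf F) := ⟨rfl⟩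
  obtain ⟨c, hc, hcε⟩ : ∃ c : ℝ, 0 < c ∧ ENNReal.ofReal c ≤ ε := by
    rcases eq_or_ne ε ∞ with rfl | hne
    · exact ⟨1, one_pos, le_top⟩
    · exact ⟨ε.toReal, ENNReal.toReal_pos hε.ne' hne, ENNReal.ofReal_toReal_le⟩
  obtain ⟨K, hK, hLK⟩ := htight (ENNReal.ofReal (c / 2)) (by simpa using hc)
  obtain ⟨R, hR⟩ := hK.isBounded.exists_norm_le
  -- A continuous test function that vanishes on the compact set `K`, where the norm is at most `R`,
  -- and equals `1` where the norm is at least `R + 1`. Tightness makes its limit integral at most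
  -- `c / 2`, so its outer expectation is eventually below `c`.
  set h : BoundedContinuousFunction (EllInf F) ℝ := BoundedContinuousFunction.ofNormedAddCommGroup
    (fun z => min 1 (max 0 (‖z‖ - R))) (by fun_prop) 1 (by
      intro z
      rw [Real.norm_eq_abs, abs_le]
      exact ⟨by linarith [le_min (zero_le_one' ℝ) (le_max_left 0 (‖z‖ - R))], min_le_left _ _⟩)
    with hh
  have hval : ∀ z, h z = min 1 (max 0 (‖z‖ - R)) := fun z => rfl
  have h0 : ∀ z, 0 ≤ h z := fun z => le_min zero_le_one (le_max_left _ _)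
  have h1 : ∀ z, h z ≤ 1 := fun z => min_le_left _ _
  have hint : ∫ z, h z ∂L ≤ c / 2 := by
    have hle : ∀ z, h z ≤ Kᶜ.indicator (fun _ => (1 : ℝ)) z := by
      intro z
      by_cases hz : z ∈ K
      · have := hR z hz
        simp only [Set.indicator, Set.mem_compl_iff, hz, not_true_eq_false, if_false, hval]
        exact (min_le_right _ _).trans (max_le le_rfl (by linarith))
      · simpa [Set.indicator, hz] using h1 z
    have hKm : MeasurableSet Kᶜ := hK.isClosed.measurableSet.compl
    calc ∫ z, h z ∂L ≤ ∫ z, Kᶜ.indicator (fun _ => (1 : ℝ)) z ∂L :=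
          integral_mono (h.integrable L) ((integrable_const 1).indicator hKm) hle
      _ = (L Kᶜ).toReal := by
          rw [integral_indicator hKm]; simp [Measure.real]
      _ ≤ c / 2 := ENNReal.toReal_le_of_le_ofReal (by positivity) hLK
  have hev := (hconv h).eventually_lt_const (lt_of_le_of_lt hint (by linarith : c / 2 < c))
  refine ⟨max R 0 + 1, by positivity, ?_⟩
  filter_upwards [hev] with n hn
  have hm := memℓp_empProc (P := P) hbd n
  refine le_trans ?_ ((outer_markov (fun x => h0 _)
    ⟨fun _ => 1, integrable_const 1, fun x => h1 _⟩ hn).trans hcε)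
  refine measure_mono_ae ?_
  filter_upwards [hm] with x hx
  rintro ⟨f, hf, hlt⟩
  change 1 ≤ h _
  rw [hval, toEllInf, dif_pos hx]
  refine le_min le_rfl (le_max_of_le_right ?_)
  have : ‖(fun f : F => empProc P n x f) ⟨f, hf⟩‖ ≤ ‖(⟨_, hx⟩ : EllInf F)‖ :=
    lp.norm_apply_le_norm ENNReal.top_ne_zero (⟨_, hx⟩ : EllInf F) ⟨f, hf⟩
  rw [Real.norm_eq_abs] at this
  have := le_max_left R 0
  simp only at *
  linarith

variable {Ω : Type*} [MeasurableSpace Ω] {Q : Measure Ω} {X : ℕ → Ω → S} {P : Measure S}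

/-- Carries bounds from the product space to `Ω`. For a nonmeasurable `A` the two outer measures may
differ, but the inequality needed here always holds. -/
theorem measure_preimage_sample_le [IsProbabilityMeasure Q] (hX : ∀ i, Measurable (X i))
    (hindep : iIndepFun X Q) (hlaw : ∀ i, Q.map (X i) = P) (n : ℕ) (A : Set (Fin n → S)) :
    Q {ω | (fun k : Fin n => X k ω) ∈ A} ≤ Measure.pi (fun _ : Fin n => P) A := by
  have hi : iIndepFun (fun k : Fin n => X k) Q := hindep.precomp Fin.val_injective
  have := (iIndepFun_iff_map_fun_eq_pi_map (f := fun k : Fin n => X k)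
    (fun k : Fin n => (hX k).aemeasurable)).mp hi
  simp only [hlaw] at this
  rw [← this]
  exact Measure.le_map_apply (f := fun ω (k : Fin n) => X k ω)
    (measurable_pi_lambda (fun ω (k : Fin n) => X k ω) fun k => hX k).aemeasurable A

theorem ae_forall_sample (hX : ∀ i, Measurable (X i)) (hlaw : ∀ i, Q.map (X i) = P)
    {p : S → Prop} (hp : ∀ᵐ x ∂P, p x) : ∀ᵐ ω ∂Q, ∀ k, p (X k ω) := by
  rw [ae_all_iff]
  intro k
  rw [← hlaw k] at hp
  exact ae_of_ae_map (hX k).aemeasurable hp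

/-- Markov's inequality for the empirical mean of `|F|`, whose expectation is `I` for every positive
`n`. The `+ 1` in the constant keeps it positive when `I = 0`. -/
theorem empMean_bounded [IsProbabilityMeasure Q] (hX : ∀ i, Measurable (X i))
    (hlaw : ∀ i, Q.map (X i) = P) {F : S → ℝ} (hF : Integrable F P) {ε : ℝ≥0∞} (hε : 0 < ε) :
    ∃ K : ℝ, 0 < K ∧ ∀ n : ℕ, Q {ω | K < empMean n (fun k => X k ω) F} ≤ ε := by
  obtain ⟨c, hc, hcε⟩ : ∃ c : ℝ, 0 < c ∧ ENNReal.ofReal c ≤ ε := by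
    rcases eq_or_ne ε ∞ with rfl | hne
    · exact ⟨1, one_pos, le_top⟩
    · exact ⟨ε.toReal, ENNReal.toReal_pos hε.ne' hne, ENNReal.ofReal_toReal_le⟩
  set I := ∫ y, |F y| ∂P with hI
  have hI0 : 0 ≤ I := integral_nonneg fun y => abs_nonneg _
  have hint : ∀ k, Integrable (fun ω => |F (X k ω)|) Q := fun k => by
    have h1 : Integrable (fun y => |F y|) (Q.map (X k)) := by rw [hlaw]; exact hF.abs
    exact h1.comp_measurable (hX k)
  have hval : ∀ k, ∫ ω, |F (X k ω)| ∂Q = I := fun k => by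
    rw [hI, ← hlaw k, integral_map (hX k).aemeasurable]
    rw [hlaw]; exact hF.abs.1
  have hK : 0 < (I + 1) / c := by positivity
  refine ⟨(I + 1) / c, hK, fun n => ?_⟩
  set U : Ω → ℝ := fun ω => c / (I + 1) * empMean n (fun k => X k ω) (fun y => |F y|) with hU
  have hUint : Integrable U Q := by
    refine Integrable.const_mul ?_ _
    exact (integrable_finsetSum (Finset.univ : Finset (Fin n))
      (f := fun (k : Fin n) ω => |F (X k ω)|) fun k _ => hint k).const_mul _
  have hUval : ∫ ω, U ω ∂Q ≤ c := by
    simp only [hU, empMean]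
    rw [integral_const_mul, integral_const_mul,
      integral_finsetSum _ fun (k : Fin n) _ => hint k]
    simp only [hval, Finset.sum_const, Finset.card_univ, Fintype.card_fin, nsmul_eq_mul]
    rcases Nat.eq_zero_or_pos n with rfl | hn
    · simp [hc.le]
    · have : (n : ℝ) ≠ 0 := by positivity
      rw [inv_mul_cancel_left₀ this, div_mul_eq_mul_div, div_le_iff₀ (by positivity)]
      nlinarith
  have hU0 : ∀ ω, 0 ≤ U ω := fun ω => by
    simp only [hU, empMean]; positivity
  calc Q {ω | (I + 1) / c < empMean n (fun k => X k ω) F}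
      ≤ Q {ω | (1 : ℝ≥0∞) ≤ ENNReal.ofReal (U ω)} := by
        refine measure_mono fun ω hω => ?_
        simp only [Set.mem_ofPred_eq] at hω ⊢
        have h1 := hω.trans_le (empMean_mono (g := fun y => |F y|) (fun i => le_abs_self _))
        simp only [ENNReal.one_le_ofReal, hU]
        rw [div_mul_eq_mul_div, le_div_iff₀ (by positivity)]
        rw [div_lt_iff₀ hc] at h1
        linarith
    _ ≤ (∫⁻ ω, ENNReal.ofReal (U ω) ∂Q) / 1 :=
        meas_ge_le_lintegral_div hUint.1.aemeasurable.ennreal_ofReal one_ne_zero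
          ENNReal.one_ne_top
    _ = ENNReal.ofReal (∫ ω, U ω ∂Q) := by
        rw [div_one, ofReal_integral_eq_lintegral_ofReal hUint (ae_of_all _ hU0)]
    _ ≤ ε := (ENNReal.ofReal_le_ofReal hUval).trans hcε

/-- Chebyshev's inequality: by independence the sum of `n` centered terms has variance `n v`. -/
theorem empMean_centered_bounded [IsProbabilityMeasure Q] (hX : ∀ i, Measurable (X i))
    (hindep : iIndepFun X Q) (hlaw : ∀ i, Q.map (X i) = P) {g : S → ℝ} (hgm : Measurable g)
    (hg : MemLp g 2 P) (hg0 : ∫ y, g y ∂P = 0) {ε : ℝ≥0∞} (hε : 0 < ε) :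
    ∃ K : ℝ, 0 < K ∧ ∀ n : ℕ, 0 < n →
      Q {ω | K * (Real.sqrt n)⁻¹ < |empMean n (fun k => X k ω) g|} ≤ ε := by
  obtain ⟨c, hc, hcε⟩ : ∃ c : ℝ, 0 < c ∧ ENNReal.ofReal c ≤ ε := by
    rcases eq_or_ne ε ∞ with rfl | hne
    · exact ⟨1, one_pos, le_top⟩
    · exact ⟨ε.toReal, ENNReal.toReal_pos hε.ne' hne, ENNReal.ofReal_toReal_le⟩
  have hYL : ∀ k, MemLp (fun ω => g (X k ω)) 2 Q := fun k => by
    have h1 : MemLp g 2 (Q.map (X k)) := by rw [hlaw]; exact hg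
    exact h1.comp_of_map (hX k).aemeasurable
  have hmean : ∀ k, ∫ ω, g (X k ω) ∂Q = 0 := fun k => by
    rw [← hg0, ← hlaw k, integral_map (hX k).aemeasurable hgm.aestronglyMeasurable]
  have hvar : ∀ k, Var[fun ω => g (X k ω); Q] = ∫ y, g y ^ 2 ∂P := fun k => by
    rw [variance_of_integral_eq_zero (hYL k).1.aemeasurable (hmean k), ← hlaw k,
      integral_map (hX k).aemeasurable (by fun_prop)]
  set v := ∫ y, g y ^ 2 ∂P with hv
  have hv0 : 0 ≤ v := integral_nonneg fun y => sq_nonneg _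
  have hKpos : 0 < (v + 1) / c := by positivity
  refine ⟨Real.sqrt ((v + 1) / c), Real.sqrt_pos.mpr hKpos, fun n hn => ?_⟩
  have hn' : (0 : ℝ) < n := by exact_mod_cast hn
  have hsn := Real.sqrt_pos.mpr hn'
  set T : Ω → ℝ := ∑ k : Fin n, fun ω => g (X k ω) with hT
  have hTL : MemLp T 2 Q := memLp_finsetSum' _ fun k _ => hYL k
  have hTmean : ∫ ω, T ω ∂Q = 0 := by
    simp only [hT, Finset.sum_apply]
    rw [integral_finsetSum _ fun k _ => (hYL _).integrable one_le_two]
    simp [hmean]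
  have hTvar : Var[T; Q] = n * v := by
    rw [hT, IndepFun.variance_sum (X := fun (k : Fin n) ω => g (X k ω)) (fun k _ => hYL k)]
    · simp [hvar]
    · intro i _ j _ hij
      exact (hindep.indepFun (fun h => hij (Fin.ext h))).comp hgm hgm
  have hcc : 0 < Real.sqrt ((v + 1) / c) * Real.sqrt n := by positivity
  have hch := meas_ge_le_variance_div_sq hTL hcc
  rw [hTmean, hTvar, mul_pow, Real.sq_sqrt hKpos.le, Real.sq_sqrt hn'.le] at hch
  refine (measure_mono ?_).trans (hch.trans ((ENNReal.ofReal_le_ofReal ?_).trans hcε))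
  · intro ω hω
    simp only [Set.mem_ofPred_eq, empMean, sub_zero, hT, Finset.sum_apply] at hω ⊢
    rw [abs_mul, abs_of_pos (inv_pos.mpr hn')] at hω
    have h2 : Real.sqrt n * Real.sqrt n = n := Real.mul_self_sqrt hn'.le
    have h3 : (Real.sqrt n)⁻¹ = Real.sqrt n * (n : ℝ)⁻¹ := by
      nth_rewrite 3 [← h2]; field_simp
    rw [h3, ← mul_assoc, mul_comm (n : ℝ)⁻¹] at hω
    exact (lt_of_mul_lt_mul_right hω (by positivity)).le
  · rw [div_le_iff₀ (by positivity)]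
    field_simp
    linarith

end Empirical

/-! ### Partial derivatives and Taylor expansions -/

section Calculus

variable {d : ℕ} {f : EuclideanSpace ℝ (Fin d) → EuclideanSpace ℝ (Fin d) → ℝ}

local notation "E" => EuclideanSpace ℝ (Fin d)

theorem dT_eq_fderiv {p : E × E} (hf : DifferentiableAt ℝ (Function.uncurry f) p) (i : Fin d) :
    dT i f p.1 p.2 = fderiv ℝ (Function.uncurry f) p (EuclideanSpace.single i 1, 0) := by
  have h1 : HasFDerivAt (fun s : E => (s, p.2)) (ContinuousLinearMap.inl ℝ E E) p.1 :=
    hasFDerivAt_prodMk_left p.1 p.2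
  have h2 : HasFDerivAt (fun s => f s p.2) _ p.1 :=
    HasFDerivAt.comp (g := Function.uncurry f) p.1 hf.hasFDerivAt h1
  rw [dT, h2.fderiv]
  simp

theorem dTheta_eq_fderiv {p : E × E} (hf : DifferentiableAt ℝ (Function.uncurry f) p) (i : Fin d) :
    dTheta i f p.1 p.2 = fderiv ℝ (Function.uncurry f) p (0, EuclideanSpace.single i 1) := by
  have h1 : HasFDerivAt (fun s : E => (p.1, s)) (ContinuousLinearMap.inr ℝ E E) p.2 :=
    hasFDerivAt_prodMk_right p.1 p.2
  have h2 : HasFDerivAt (fun s => f p.1 s) _ p.2 :=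
    HasFDerivAt.comp (g := Function.uncurry f) p.2 hf.hasFDerivAt h1
  rw [dTheta, h2.fderiv]
  simp

theorem fderiv_uncurry_apply {p : E × E} (hf : DifferentiableAt ℝ (Function.uncurry f) p)
    (a : E × E) :
    fderiv ℝ (Function.uncurry f) p a
      = ∑ i, a.1 i * dT i f p.1 p.2 + ∑ i, a.2 i * dTheta i f p.1 p.2 := by
  have hsum : ∀ v : E, v = ∑ i, v i • EuclideanSpace.single i (1 : ℝ) := fun v => by
    ext j
    simp [Finset.sum_apply, Pi.single_apply]
  have ha : a = ∑ i, a.1 i • ((EuclideanSpace.single i (1 : ℝ) : E), (0 : E))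
      + ∑ i, a.2 i • ((0 : E), (EuclideanSpace.single i (1 : ℝ) : E)) := by
    refine Prod.ext ?_ ?_
    · rw [Prod.fst_add, Prod.fst_sum, Prod.fst_sum]
      simpa using hsum a.1
    · rw [Prod.snd_add, Prod.snd_sum, Prod.snd_sum]
      simpa using hsum a.2
  conv_lhs => rw [ha]
  simp only [map_add, map_sum, map_smul, smul_eq_mul, dT_eq_fderiv hf, dTheta_eq_fderiv hf]

theorem contDiffOn_uncurry_dT {U : Set (E × E)} (hU : IsOpen U) {m n : WithTop ℕ∞}
    (hf : ContDiffOn ℝ n (Function.uncurry f) U) (hmn : m + 1 ≤ n) (i : Fin d) :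
    ContDiffOn ℝ m (Function.uncurry (dT i f)) U := by
  have h1 := (hf.fderiv_of_isOpen hU hmn).clm_apply
    (contDiffOn_const (c := ((EuclideanSpace.single i (1 : ℝ) : E), (0 : E))))
  refine h1.congr fun p hp => ?_
  exact dT_eq_fderiv ((hf.differentiableOn (by
    rintro rfl; simp at hmn)).differentiableAt (hU.mem_nhds hp)) i

theorem contDiffOn_uncurry_dTheta {U : Set (E × E)} (hU : IsOpen U) {m n : WithTop ℕ∞}
    (hf : ContDiffOn ℝ n (Function.uncurry f) U) (hmn : m + 1 ≤ n) (i : Fin d) :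
    ContDiffOn ℝ m (Function.uncurry (dTheta i f)) U := by
  have h1 := (hf.fderiv_of_isOpen hU hmn).clm_apply
    (contDiffOn_const (c := ((0 : E), (EuclideanSpace.single i (1 : ℝ) : E))))
  refine h1.congr fun p hp => ?_
  exact dTheta_eq_fderiv ((hf.differentiableOn (by
    rintro rfl; simp at hmn)).differentiableAt (hU.mem_nhds hp)) i

/-- The mixed partial derivatives `∂_t ∂_θ` and `∂_θ ∂_t` agree. -/
theorem dT_dTheta_comm {U : Set (E × E)} (hU : IsOpen U)
    (hf : ContDiffOn ℝ 2 (Function.uncurry f) U) {p : E × E} (hp : p ∈ U) (i j : Fin d) :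
    dT i (dTheta j f) p.1 p.2 = dTheta j (dT i f) p.1 p.2 := by
  have h12 : (1 : WithTop ℕ∞) + 1 ≤ 2 := by norm_num
  have hd1 : DifferentiableAt ℝ (Function.uncurry (dTheta j f)) p :=
    ((contDiffOn_uncurry_dTheta hU hf h12 j).differentiableOn one_ne_zero).differentiableAt (hU.mem_nhds hp)
  have hd2 : DifferentiableAt ℝ (Function.uncurry (dT i f)) p :=
    ((contDiffOn_uncurry_dT hU hf h12 i).differentiableOn one_ne_zero).differentiableAt (hU.mem_nhds hp)
  have hdf : ∀ q ∈ U, DifferentiableAt ℝ (Function.uncurry f) q := fun q hq =>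
    (hf.differentiableOn two_ne_zero).differentiableAt (hU.mem_nhds hq)
  have hdd : DifferentiableAt ℝ (fderiv ℝ (Function.uncurry f)) p :=
    ((hf.fderiv_of_isOpen hU h12).differentiableOn one_ne_zero).differentiableAt (hU.mem_nhds hp)
  have e1 : Function.uncurry (dTheta j f) =ᶠ[𝓝 p]
      fun q => fderiv ℝ (Function.uncurry f) q (0, EuclideanSpace.single j 1) := by
    filter_upwards [hU.mem_nhds hp] with q hq using dTheta_eq_fderiv (hdf q hq) j
  have e2 : Function.uncurry (dT i f) =ᶠ[𝓝 p]
      fun q => fderiv ℝ (Function.uncurry f) q (EuclideanSpace.single i 1, 0) := by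
    filter_upwards [hU.mem_nhds hp] with q hq using dT_eq_fderiv (hdf q hq) i
  rw [dT_eq_fderiv hd1, dTheta_eq_fderiv hd2, e1.fderiv_eq, e2.fderiv_eq,
    fderiv_clm_apply hdd (differentiableAt_const _), fderiv_clm_apply hdd (differentiableAt_const _)]
  have hsymm := ((hf.contDiffAt (hU.mem_nhds hp)).isSymmSndFDerivAt (by simp)).eq
    (EuclideanSpace.single i 1, 0) (0, EuclideanSpace.single j 1)
  simpa using hsymm

/-- The derivative of `f` along a line. -/
theorem hasDerivAt_line {t θ a b : E} {τ : ℝ}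
    (hf : DifferentiableAt ℝ (Function.uncurry f) (t + τ • a, θ + τ • b)) :
    HasDerivAt (fun τ : ℝ => f (t + τ • a) (θ + τ • b))
      (∑ i, a i * dT i f (t + τ • a) (θ + τ • b)
        + ∑ i, b i * dTheta i f (t + τ • a) (θ + τ • b)) τ := by
  have h1 : HasDerivAt (fun τ : ℝ => ((t + τ • a, θ + τ • b) : E × E)) (a, b) τ := by
    have ha : HasDerivAt (fun τ : ℝ => t + τ • a) a τ := by
      simpa using ((hasDerivAt_id τ).smul_const a).const_add t
    have hb : HasDerivAt (fun τ : ℝ => θ + τ • b) b τ := by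
      simpa using ((hasDerivAt_id τ).smul_const b).const_add θ
    exact ha.prodMk hb
  have h2 := HasFDerivAt.comp_hasDerivAt (l := Function.uncurry f) τ hf.hasFDerivAt h1
  rw [fderiv_uncurry_apply hf] at h2
  exact h2

theorem sum_abs_coord_le (v : E) : ∑ i, |v i| ≤ d * ‖v‖ := by
  calc ∑ i, |v i| ≤ ∑ _i : Fin d, ‖v‖ := Finset.sum_le_sum fun i _ => by
        simpa using PiLp.norm_apply_le v i
    _ = d * ‖v‖ := by simp

theorem line_mem_ball {c t a : E} {δ : ℝ} (h0 : t ∈ ball c δ) (h1 : t + a ∈ ball c δ) {τ : ℝ}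
    (hτ : τ ∈ Set.Icc (0 : ℝ) 1) : t + τ • a ∈ ball c δ := by
  have := (convex_ball c δ).add_smul_sub_mem h0 h1 hτ
  simpa using this

/-- Mean value inequality along a segment, with a bound on the partial derivatives. -/
theorem abs_sub_le_of_partials {c : E} {δ : ℝ}
    (hf : DifferentiableOn ℝ (Function.uncurry f) (ball c δ ×ˢ ball c δ)) {K : ℝ}
    (hT : ∀ i, ∀ t ∈ ball c δ, ∀ θ ∈ ball c δ, |dT i f t θ| ≤ K)
    (hθ : ∀ i, ∀ t ∈ ball c δ, ∀ θ ∈ ball c δ, |dTheta i f t θ| ≤ K)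
    {t θ a b : E} (ht : t ∈ ball c δ) (hta : t + a ∈ ball c δ) (hb : θ ∈ ball c δ)
    (hθb : θ + b ∈ ball c δ) :
    |f (t + a) (θ + b) - f t θ| ≤ K * (d * (‖a‖ + ‖b‖)) := by
  have hK : ∀ i : Fin d, 0 ≤ K := fun i => (abs_nonneg _).trans (hT i t ht θ hb)
  have hopen : IsOpen (ball c δ ×ˢ ball c δ) := isOpen_ball.prod isOpen_ball
  have key := norm_image_sub_le_of_norm_deriv_le_segment_01' (f := fun τ : ℝ =>
      f (t + τ • a) (θ + τ • b)) (C := K * (d * (‖a‖ + ‖b‖)))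
    (fun τ hτ => (hasDerivAt_line (hf.differentiableAt (hopen.mem_nhds
      ⟨line_mem_ball ht hta hτ, line_mem_ball hb hθb hτ⟩))).hasDerivWithinAt)
    (by
      intro τ hτ
      have hτ' := Set.Ico_subset_Icc_self hτ
      have h1 := line_mem_ball ht hta hτ'
      have h2 := line_mem_ball hb hθb hτ'
      rw [Real.norm_eq_abs]
      have e1 : |∑ i, a i * dT i f (t + τ • a) (θ + τ • b)| ≤ ∑ i, |a i| * K :=
        (Finset.abs_sum_le_sum_abs _ _).trans (Finset.sum_le_sum fun i _ => by
          rw [abs_mul]; exact mul_le_mul_of_nonneg_left (hT i _ h1 _ h2) (abs_nonneg _))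
      have e2 : |∑ i, b i * dTheta i f (t + τ • a) (θ + τ • b)| ≤ ∑ i, |b i| * K :=
        (Finset.abs_sum_le_sum_abs _ _).trans (Finset.sum_le_sum fun i _ => by
          rw [abs_mul]; exact mul_le_mul_of_nonneg_left (hθ i _ h1 _ h2) (abs_nonneg _))
      rw [← Finset.sum_mul] at e1 e2
      rcases Nat.eq_zero_or_pos d with rfl | hd
      · simp
      · have hK0 := hK ⟨0, hd⟩
        have e3 := mul_le_mul_of_nonneg_right (sum_abs_coord_le a) hK0
        have e4 := mul_le_mul_of_nonneg_right (sum_abs_coord_le b) hK0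
        refine (abs_add_le _ _).trans ?_
        linarith)
  simpa using key

/-- First order Taylor expansion with a bound on the second partial derivatives. -/
theorem abs_taylor_le {c : E} {δ : ℝ}
    (hf : ContDiffOn ℝ 2 (Function.uncurry f) (ball c δ ×ˢ ball c δ)) {K : ℝ}
    (hTT : ∀ i j, ∀ t ∈ ball c δ, ∀ θ ∈ ball c δ, |dT i (dT j f) t θ| ≤ K)
    (hθT : ∀ i j, ∀ t ∈ ball c δ, ∀ θ ∈ ball c δ, |dTheta i (dT j f) t θ| ≤ K)
    (hθθ : ∀ i j, ∀ t ∈ ball c δ, ∀ θ ∈ ball c δ, |dTheta i (dTheta j f) t θ| ≤ K)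
    {t θ a b : E} (ht : t ∈ ball c δ) (hta : t + a ∈ ball c δ) (hb : θ ∈ ball c δ)
    (hθb : θ + b ∈ ball c δ) :
    |f (t + a) (θ + b) - f t θ - ∑ i, a i * dT i f t θ - ∑ i, b i * dTheta i f t θ|
      ≤ K * (d * (‖a‖ + ‖b‖)) ^ 2 := by
  have hopen : IsOpen (ball c δ ×ˢ ball c δ) := isOpen_ball.prod isOpen_ball
  have h12 : (1 : WithTop ℕ∞) + 1 ≤ 2 := by norm_num
  have hTd : ∀ i, DifferentiableOn ℝ (Function.uncurry (dT i f)) (ball c δ ×ˢ ball c δ) := fun i =>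
    (contDiffOn_uncurry_dT hopen hf h12 i).differentiableOn one_ne_zero
  have hθd : ∀ i, DifferentiableOn ℝ (Function.uncurry (dTheta i f)) (ball c δ ×ˢ ball c δ) :=
    fun i => (contDiffOn_uncurry_dTheta hopen hf h12 i).differentiableOn one_ne_zero
  have hfd := hf.differentiableOn two_ne_zero
  have bT : ∀ i, ∀ τ ∈ Set.Icc (0 : ℝ) 1,
      |dT i f (t + τ • a) (θ + τ • b) - dT i f t θ| ≤ K * (d * (‖a‖ + ‖b‖)) := by
    intro i τ hτ
    have hK0 : 0 ≤ K := (abs_nonneg _).trans (hTT i i t ht θ hb)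
    refine (abs_sub_le_of_partials (hTd i) (fun j => hTT j i) (fun j => hθT j i) ht
      (line_mem_ball ht hta hτ) hb (line_mem_ball hb hθb hτ)).trans ?_
    rw [norm_smul, norm_smul, Real.norm_eq_abs, abs_of_nonneg hτ.1]
    gcongr
    · exact mul_le_of_le_one_left (norm_nonneg _) hτ.2
    · exact mul_le_of_le_one_left (norm_nonneg _) hτ.2
  have bθ : ∀ i, ∀ τ ∈ Set.Icc (0 : ℝ) 1,
      |dTheta i f (t + τ • a) (θ + τ • b) - dTheta i f t θ| ≤ K * (d * (‖a‖ + ‖b‖)) := by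
    intro i τ hτ
    have hK0 : 0 ≤ K := (abs_nonneg _).trans (hTT i i t ht θ hb)
    refine (abs_sub_le_of_partials (hθd i) (fun j t' ht' θ' hθ' => ?_) (fun j => hθθ j i) ht
      (line_mem_ball ht hta hτ) hb (line_mem_ball hb hθb hτ)).trans ?_
    -- The hypotheses bound only the order `∂_θ ∂_t`; symmetry of second derivatives supplies the
    -- other order.
    · rw [dT_dTheta_comm hopen hf (p := (t', θ')) ⟨ht', hθ'⟩]
      exact hθT i j t' ht' θ' hθ'
    rw [norm_smul, norm_smul, Real.norm_eq_abs, abs_of_nonneg hτ.1]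
    gcongr
    · exact mul_le_of_le_one_left (norm_nonneg _) hτ.2
    · exact mul_le_of_le_one_left (norm_nonneg _) hτ.2
  set A := ∑ i, a i * dT i f t θ with hA
  set B := ∑ i, b i * dTheta i f t θ with hB
  -- Mean value inequality for `f` along the segment minus its linear part: the derivative is the
  -- increment of the first partials, already bounded by `bT` and `bθ`.
  have key := norm_image_sub_le_of_norm_deriv_le_segment_01' (f := fun τ : ℝ =>
      f (t + τ • a) (θ + τ • b) - τ * (A + B)) (C := K * (d * (‖a‖ + ‖b‖)) ^ 2)
    (fun τ hτ => ((hasDerivAt_line (hfd.differentiableAt (hopen.mem_nhds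
      ⟨line_mem_ball ht hta hτ, line_mem_ball hb hθb hτ⟩))).sub
        ((hasDerivAt_id τ).mul_const (A + B))).hasDerivWithinAt)
    (by
      intro τ hτ
      have hτ' := Set.Ico_subset_Icc_self hτ
      rw [Real.norm_eq_abs]
      set R := K * (d * (‖a‖ + ‖b‖)) with hR
      have e1 : |∑ i, a i * dT i f (t + τ • a) (θ + τ • b) - A| ≤ (∑ i, |a i|) * R := by
        rw [hA, ← Finset.sum_sub_distrib, Finset.sum_mul]
        refine (Finset.abs_sum_le_sum_abs _ _).trans (Finset.sum_le_sum fun i _ => ?_)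
        rw [← mul_sub, abs_mul]
        exact mul_le_mul_of_nonneg_left (bT i τ hτ') (abs_nonneg _)
      have e2 : |∑ i, b i * dTheta i f (t + τ • a) (θ + τ • b) - B| ≤ (∑ i, |b i|) * R := by
        rw [hB, ← Finset.sum_sub_distrib, Finset.sum_mul]
        refine (Finset.abs_sum_le_sum_abs _ _).trans (Finset.sum_le_sum fun i _ => ?_)
        rw [← mul_sub, abs_mul]
        exact mul_le_mul_of_nonneg_left (bθ i τ hτ') (abs_nonneg _)
      rcases Nat.eq_zero_or_pos d with rfl | hd
      · simp [hA, hB]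
      · have hK0 : 0 ≤ K := (abs_nonneg _).trans (hTT ⟨0, hd⟩ ⟨0, hd⟩ t ht θ hb)
        have hR0 : 0 ≤ R := by positivity
        have e3 := mul_le_mul_of_nonneg_right (sum_abs_coord_le a) hR0
        have e4 := mul_le_mul_of_nonneg_right (sum_abs_coord_le b) hR0
        have e5 : K * (d * (‖a‖ + ‖b‖)) ^ 2 = d * ‖a‖ * R + d * ‖b‖ * R := by rw [hR]; ring
        rw [e5, one_mul]
        refine le_trans (le_of_eq ?_) ((abs_add_le _ _).trans
          (add_le_add (e1.trans e3) (e2.trans e4)))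
        congr 1
        ring)
  simp only [one_smul, zero_smul, add_zero, one_mul, zero_mul, sub_zero, Real.norm_eq_abs] at key
  convert key using 2
  ring

/-- Mean value theorem for second differences. -/
theorem exists_second_difference {V : Type*} [NormedAddCommGroup V] [NormedSpace ℝ V]
    {F : V → ℝ} {U : Set V} (hU : IsOpen U) (hF : ContDiffOn ℝ 2 F U) {p v w : V} {s : ℝ}
    (hs : 0 < s)
    (hmem : ∀ σ ∈ Set.Icc (0 : ℝ) s, ∀ τ ∈ Set.Icc (0 : ℝ) s, p + σ • v + τ • w ∈ U) :
    ∃ σ ∈ Set.Ioo (0 : ℝ) s, ∃ τ ∈ Set.Ioo (0 : ℝ) s,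
      F (p + s • v + s • w) - F (p + s • w) - F (p + s • v) + F p
        = s ^ 2 * fderiv ℝ (fun q => fderiv ℝ F q v) (p + σ • v + τ • w) w := by
  have h12 : (1 : WithTop ℕ∞) + 1 ≤ 2 := by norm_num
  have hFd : ∀ q ∈ U, DifferentiableAt ℝ F q := fun q hq =>
    (hF.differentiableOn two_ne_zero).differentiableAt (hU.mem_nhds hq)
  have hGd : ∀ q ∈ U, DifferentiableAt ℝ (fun q => fderiv ℝ F q v) q := fun q hq =>
    (((hF.fderiv_of_isOpen hU h12).clm_apply contDiffOn_const).differentiableOn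
      one_ne_zero).differentiableAt (hU.mem_nhds hq)
  have hline : ∀ (q u : V) (σ : ℝ), HasDerivAt (fun σ : ℝ => q + σ • u) u σ := fun q u σ => by
    simpa using ((hasDerivAt_id σ).smul_const u).const_add q
  have hs0 : (0 : ℝ) ∈ Set.Icc (0 : ℝ) s := ⟨le_rfl, hs.le⟩
  have hss : s ∈ Set.Icc (0 : ℝ) s := ⟨hs.le, le_rfl⟩
  have hg : ∀ τ₀ ∈ Set.Icc (0 : ℝ) s, ∀ σ ∈ Set.Icc (0 : ℝ) s,
      HasDerivAt (fun σ : ℝ => F (p + τ₀ • w + σ • v)) (fderiv ℝ F (p + τ₀ • w + σ • v) v) σ := by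
    intro τ₀ hτ₀ σ hσ
    have hm := hmem σ hσ τ₀ hτ₀
    rw [add_right_comm] at hm
    exact (hFd _ hm).hasFDerivAt.comp_hasDerivAt σ (hline (p + τ₀ • w) v σ)
  have hh : ∀ σ ∈ Set.Icc (0 : ℝ) s, HasDerivAt
      (fun σ : ℝ => F (p + s • w + σ • v) - F (p + (0 : ℝ) • w + σ • v))
      (fderiv ℝ F (p + s • w + σ • v) v - fderiv ℝ F (p + (0 : ℝ) • w + σ • v) v) σ :=
    fun σ hσ => (hg s hss σ hσ).sub (hg 0 hs0 σ hσ)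
  -- The second difference is the increment in `σ` of a first difference in the direction `w`. The
  -- mean value theorem in `σ` leaves an increment in `τ` of the derivative along `v`, to which it
  -- is applied again.
  obtain ⟨σ, hσ, hσe⟩ := exists_hasDerivAt_eq_slope _ _ hs
    (fun σ hσ => (hh σ hσ).continuousAt.continuousWithinAt)
    (fun σ hσ => hh σ (Set.Ioo_subset_Icc_self hσ))
  have hσ' := Set.Ioo_subset_Icc_self hσ
  have hk : ∀ τ ∈ Set.Icc (0 : ℝ) s, HasDerivAt (fun τ : ℝ => fderiv ℝ F (p + σ • v + τ • w) v)
      (fderiv ℝ (fun q => fderiv ℝ F q v) (p + σ • v + τ • w) w) τ := fun τ hτ =>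
    HasFDerivAt.comp_hasDerivAt (l := fun q => fderiv ℝ F q v) τ
      (hGd _ (hmem σ hσ' τ hτ)).hasFDerivAt (hline (p + σ • v) w τ)
  obtain ⟨τ, hτ, hτe⟩ := exists_hasDerivAt_eq_slope _ _ hs
    (fun τ hτ => (hk τ hτ).continuousAt.continuousWithinAt)
    (fun τ hτ => hk τ (Set.Ioo_subset_Icc_self hτ))
  refine ⟨σ, hσ, τ, hτ, ?_⟩
  rw [hτe]
  simp only [zero_smul, add_zero, sub_zero] at hσe ⊢
  rw [eq_div_iff hs.ne'] at hσe
  rw [add_right_comm p (s • w) (σ • v)] at hσe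
  rw [pow_two, mul_assoc, mul_div_cancel₀ _ hs.ne', mul_comm, hσe,
    add_right_comm p (s • v) (s • w)]
  ring

end Calculus

/-! ### Differentiation of `∫ lik dμ = 1` under the integral sign -/

section UnderIntegral

variable {S : Type*} [MeasurableSpace S] {μ : Measure S}
  {V : Type*} [NormedAddCommGroup V] [NormedSpace ℝ V]

theorem exists_parallelogram_subset {U : Set V} (hU : IsOpen U) {p : V} (hp : p ∈ U) (v w : V) :
    ∃ c : ℝ, 0 < c ∧ ∀ σ ∈ Set.Icc (0 : ℝ) c, ∀ τ ∈ Set.Icc (0 : ℝ) c, p + σ • v + τ • w ∈ U := by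
  have hcont : Continuous (fun q : ℝ × ℝ => p + q.1 • v + q.2 • w) := by fun_prop
  have h0 : (fun q : ℝ × ℝ => p + q.1 • v + q.2 • w) (0, 0) ∈ U := by simpa using hp
  obtain ⟨ε, hε, hball⟩ := Metric.isOpen_iff.mp (hU.preimage hcont) (0, 0) h0
  refine ⟨ε / 2, by positivity, fun σ hσ τ hτ => ?_⟩
  have : (σ, τ) ∈ ball ((0, 0) : ℝ × ℝ) ε := by
    rw [mem_ball, Prod.dist_eq, max_lt_iff]
    simp only [Real.dist_eq, sub_zero, abs_of_nonneg hσ.1, abs_of_nonneg hτ.1]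
    exact ⟨by linarith [hσ.2], by linarith [hτ.2]⟩
  exact hball this

theorem tendsto_div_nat_add_one (c : ℝ) :
    Tendsto (fun n : ℕ => c / ((n : ℝ) + 1)) atTop (𝓝 0) := by
  have h := (tendsto_one_div_add_atTop_nhds_zero_nat (𝕜 := ℝ)).const_mul c
  simpa only [mul_one_div, mul_zero] using h

theorem tendsto_of_mem_Ioo {s σ : ℕ → ℝ} (hs : Tendsto s atTop (𝓝 0))
    (hσ : ∀ n, σ n ∈ Set.Ioo (0 : ℝ) (s n)) : Tendsto σ atTop (𝓝 0) :=
  tendsto_of_tendsto_of_tendsto_of_le_of_le tendsto_const_nhds hs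
    (fun n => (hσ n).1.le) (fun n => (hσ n).2.le)

variable {h : S → V → ℝ} {U : Set V} {p v w : V} {G : S → ℝ}

/-- Second difference quotients of `h x` integrate to `(1 - 1 - 1 + 1)/s² = 0`. Each equals the
second derivative at a nearby point, so `G` dominates it, and dominated convergence passes to the
limit. Working with second differences avoids any domination of first derivatives. -/
theorem integral_second_derivative_eq_zero (hU : IsOpen U) (hp : p ∈ U)
    (hsm : ∀ᵐ x ∂μ, ContDiffOn ℝ 2 (h x) U)
    (hint : ∀ q ∈ U, Integrable (fun x => h x q) μ) (hone : ∀ q ∈ U, ∫ x, h x q ∂μ = 1)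
    (hG : Integrable G μ)
    (hbd : ∀ᵐ x ∂μ, ∀ q ∈ U, |fderiv ℝ (fun q => fderiv ℝ (h x) q v) q w| ≤ G x) :
    ∫ x, fderiv ℝ (fun q => fderiv ℝ (h x) q v) p w ∂μ = 0 := by
  obtain ⟨c, hc, hmem⟩ := exists_parallelogram_subset hU hp v w
  set s : ℕ → ℝ := fun n => c / ((n : ℝ) + 1) with hs
  have hs0 : ∀ n, 0 < s n := fun n => by positivity
  have hsc : ∀ n, s n ≤ c := fun n => div_le_self hc.le (by linarith [n.cast_nonneg (α := ℝ)])
  have hslim : Tendsto s atTop (𝓝 0) := tendsto_div_nat_add_one c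
  have hmem' : ∀ n, ∀ σ ∈ Set.Icc (0 : ℝ) (s n), ∀ τ ∈ Set.Icc (0 : ℝ) (s n),
      p + σ • v + τ • w ∈ U := fun n σ hσ τ hτ =>
    hmem σ ⟨hσ.1, hσ.2.trans (hsc n)⟩ τ ⟨hτ.1, hτ.2.trans (hsc n)⟩
  have hcs : ∀ n, s n ∈ Set.Icc (0 : ℝ) (s n) := fun n => ⟨(hs0 n).le, le_rfl⟩
  have hc0 : ∀ n, (0 : ℝ) ∈ Set.Icc (0 : ℝ) (s n) := fun n => ⟨le_rfl, (hs0 n).le⟩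
  have m1 : ∀ n, p + s n • v + s n • w ∈ U := fun n => hmem' n _ (hcs n) _ (hcs n)
  have m2 : ∀ n, p + s n • w ∈ U := fun n => by simpa using hmem' n _ (hc0 n) _ (hcs n)
  have m3 : ∀ n, p + s n • v ∈ U := fun n => by simpa using hmem' n _ (hcs n) _ (hc0 n)
  set Δ : ℕ → S → ℝ := fun n x => (s n ^ 2)⁻¹ *
    (h x (p + s n • v + s n • w) - h x (p + s n • w) - h x (p + s n • v) + h x p) with hΔ
  have hΔint : ∀ n, Integrable (Δ n) μ := fun n =>
    ((((hint _ (m1 n)).sub (hint _ (m2 n))).sub (hint _ (m3 n))).add (hint _ hp)).const_mul _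
  have hΔ0 : ∀ n, ∫ x, Δ n x ∂μ = 0 := fun n => by
    simp only [hΔ]
    have i1 : Integrable (fun x => h x (p + s n • v + s n • w) - h x (p + s n • w)) μ :=
      (hint _ (m1 n)).sub (hint _ (m2 n))
    have i2 : Integrable (fun x => h x (p + s n • v + s n • w) - h x (p + s n • w)
        - h x (p + s n • v)) μ := i1.sub (hint _ (m3 n))
    rw [integral_const_mul, integral_add i2 (hint _ hp), integral_sub i1 (hint _ (m3 n)),
      integral_sub (hint _ (m1 n)) (hint _ (m2 n)), hone _ (m1 n), hone _ (m2 n), hone _ (m3 n),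
      hone _ hp]
    ring
  have key : ∀ᵐ x ∂μ, ∀ n, ∃ σ ∈ Set.Ioo (0 : ℝ) (s n), ∃ τ ∈ Set.Ioo (0 : ℝ) (s n),
      Δ n x = fderiv ℝ (fun q => fderiv ℝ (h x) q v) (p + σ • v + τ • w) w := by
    filter_upwards [hsm] with x hx n
    obtain ⟨σ, hσ, τ, hτ, he⟩ := exists_second_difference hU hx (hs0 n) (hmem' n)
    refine ⟨σ, hσ, τ, hτ, ?_⟩
    have := (hs0 n).ne'
    simp only [hΔ, he]
    field_simp
  have hlim : Tendsto (fun n => ∫ x, Δ n x ∂μ) atTop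
      (𝓝 (∫ x, fderiv ℝ (fun q => fderiv ℝ (h x) q v) p w ∂μ)) := by
    refine tendsto_integral_of_dominated_convergence G (fun n => (hΔint n).1) hG ?_ ?_
    · intro n
      filter_upwards [key, hbd] with x hx hb
      obtain ⟨σ, hσ, τ, hτ, he⟩ := hx n
      rw [he, Real.norm_eq_abs]
      exact hb _ (hmem' n _ (Set.Ioo_subset_Icc_self hσ) _ (Set.Ioo_subset_Icc_self hτ))
    · filter_upwards [key, hsm] with x hx hsmx
      choose σ hσ τ hτ he using hx
      simp only [he]
      have hcd : ContDiffOn ℝ 1 (fun q => fderiv ℝ (h x) q v) U :=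
        (hsmx.fderiv_of_isOpen hU (by norm_num)).clm_apply contDiffOn_const
      have hcc : ContinuousAt (fun q => fderiv ℝ (fun q => fderiv ℝ (h x) q v) q w) p :=
        ((hcd.continuousOn_fderiv_of_isOpen hU le_rfl).clm_apply
          continuousOn_const).continuousAt (hU.mem_nhds hp)
      refine hcc.tendsto.comp ?_
      have h1 := (tendsto_of_mem_Ioo hslim hσ).smul_const v
      have h2 := (tendsto_of_mem_Ioo hslim hτ).smul_const w
      simpa using (h1.const_add p).add h2
  simp only [hΔ0] at hlim
  exact tendsto_nhds_unique hlim tendsto_const_nhds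

/-- The same argument with first differences. A dominating function for first derivatives is not
assumed but built from their integrability at the single point `p` and the bound `G` on second
derivatives. -/
theorem integral_derivative_eq_zero (hU : IsOpen U) (hp : p ∈ U)
    (hsm : ∀ᵐ x ∂μ, ContDiffOn ℝ 2 (h x) U)
    (hint : ∀ q ∈ U, Integrable (fun x => h x q) μ) (hone : ∀ q ∈ U, ∫ x, h x q ∂μ = 1)
    (hG : Integrable G μ)
    (hbd : ∀ᵐ x ∂μ, ∀ q ∈ U, |fderiv ℝ (fun q => fderiv ℝ (h x) q v) q v| ≤ G x)
    (hD : Integrable (fun x => fderiv ℝ (h x) p v) μ) :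
    ∫ x, fderiv ℝ (h x) p v ∂μ = 0 := by
  obtain ⟨c, hc, hmem⟩ := exists_parallelogram_subset hU hp v v
  set s : ℕ → ℝ := fun n => c / ((n : ℝ) + 1) with hs
  have hs0 : ∀ n, 0 < s n := fun n => by positivity
  have hsc : ∀ n, s n ≤ c := fun n => div_le_self hc.le (by linarith [n.cast_nonneg (α := ℝ)])
  have hslim : Tendsto s atTop (𝓝 0) := tendsto_div_nat_add_one c
  have hmem' : ∀ σ ∈ Set.Icc (0 : ℝ) c, p + σ • v ∈ U := fun σ hσ => by
    simpa using hmem σ hσ 0 ⟨le_rfl, hc.le⟩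
  have m3 : ∀ n, p + s n • v ∈ U := fun n => hmem' _ ⟨(hs0 n).le, hsc n⟩
  set Δ : ℕ → S → ℝ := fun n x => (s n)⁻¹ * (h x (p + s n • v) - h x p) with hΔ
  have hΔint : ∀ n, Integrable (Δ n) μ := fun n =>
    ((hint _ (m3 n)).sub (hint _ hp)).const_mul _
  have hΔ0 : ∀ n, ∫ x, Δ n x ∂μ = 0 := fun n => by
    simp only [hΔ]
    rw [integral_const_mul, integral_sub (hint _ (m3 n)) (hint _ hp), hone _ (m3 n), hone _ hp]
    ring
  have hline : ∀ σ : ℝ, HasDerivAt (fun σ : ℝ => p + σ • v) v σ := fun σ => by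
    simpa using ((hasDerivAt_id σ).smul_const v).const_add p
  have key : ∀ᵐ x ∂μ, ∀ n, ∃ σ ∈ Set.Ioo (0 : ℝ) (s n),
      Δ n x = fderiv ℝ (h x) (p + σ • v) v := by
    filter_upwards [hsm] with x hx n
    have hd : ∀ σ ∈ Set.Icc (0 : ℝ) (s n), HasDerivAt (fun σ : ℝ => h x (p + σ • v))
        (fderiv ℝ (h x) (p + σ • v) v) σ := fun σ hσ =>
      ((hx.differentiableOn two_ne_zero).differentiableAt (hU.mem_nhds
        (hmem' σ ⟨hσ.1, hσ.2.trans (hsc n)⟩))).hasFDerivAt.comp_hasDerivAt σ (hline σ)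
    obtain ⟨σ, hσ, he⟩ := exists_hasDerivAt_eq_slope _ _ (hs0 n)
      (fun σ hσ => (hd σ hσ).continuousAt.continuousWithinAt)
      (fun σ hσ => hd σ (Set.Ioo_subset_Icc_self hσ))
    refine ⟨σ, hσ, ?_⟩
    rw [he]
    simp only [hΔ, zero_smul, add_zero, sub_zero]
    rw [div_eq_inv_mul]
  have hlim : Tendsto (fun n => ∫ x, Δ n x ∂μ) atTop (𝓝 (∫ x, fderiv ℝ (h x) p v ∂μ)) := by
    -- Moving from `p` by at most `c` along `v` changes the first derivative by at most `G x * c`.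
    refine tendsto_integral_of_dominated_convergence
      (fun x => |fderiv ℝ (h x) p v| + G x * c) (fun n => (hΔint n).1)
      (hD.abs.add (hG.mul_const c)) ?_ ?_
    · intro n
      filter_upwards [key, hbd, hsm] with x hx hb hsmx
      obtain ⟨σ, hσ, he⟩ := hx n
      have hσc : σ ≤ c := hσ.2.le.trans (hsc n)
      have hcd : ContDiffOn ℝ 1 (fun q => fderiv ℝ (h x) q v) U :=
        (hsmx.fderiv_of_isOpen hU (by norm_num)).clm_apply contDiffOn_const
      have hd : ∀ τ ∈ Set.Icc (0 : ℝ) σ, HasDerivAt (fun τ : ℝ => fderiv ℝ (h x) (p + τ • v) v)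
          (fderiv ℝ (fun q => fderiv ℝ (h x) q v) (p + τ • v) v) τ := fun τ hτ =>
        HasFDerivAt.comp_hasDerivAt (l := fun q => fderiv ℝ (h x) q v) τ
          ((hcd.differentiableOn one_ne_zero).differentiableAt (hU.mem_nhds
            (hmem' τ ⟨hτ.1, hτ.2.trans hσc⟩))).hasFDerivAt (hline τ)
      have hmv := norm_image_sub_le_of_norm_deriv_le_segment'
        (fun τ hτ => (hd τ hτ).hasDerivWithinAt) (C := G x)
        (fun τ hτ => hb _ (hmem' τ ⟨hτ.1, hτ.2.le.trans hσc⟩)) σ ⟨hσ.1.le, le_rfl⟩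
      simp only [zero_smul, add_zero, sub_zero, Real.norm_eq_abs] at hmv
      have hG0 : 0 ≤ G x := (abs_nonneg _).trans (hb p hp)
      rw [he, Real.norm_eq_abs]
      have := mul_le_mul_of_nonneg_left hσc hG0
      have h3 := abs_sub_abs_le_abs_sub (fderiv ℝ (h x) (p + σ • v) v) (fderiv ℝ (h x) p v)
      linarith
    · filter_upwards [key, hsm] with x hx hsmx
      choose σ hσ he using hx
      simp only [he]
      have hcc : ContinuousAt (fun q => fderiv ℝ (h x) q v) p :=
        ((hsmx.continuousOn_fderiv_of_isOpen hU one_le_two).clm_apply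
          continuousOn_const).continuousAt (hU.mem_nhds hp)
      refine hcc.tendsto.comp ?_
      have h1 := (tendsto_of_mem_Ioo hslim hσ).smul_const v
      simpa using h1.const_add p
  simp only [hΔ0] at hlim
  exact tendsto_nhds_unique hlim tendsto_const_nhds

/-- Derivatives of the exponential of a function. -/
theorem fderiv_fderiv_of_eqOn_exp {F H : V → ℝ} (hU : IsOpen U) (hF : ContDiffOn ℝ 2 F U)
    (hH : ∀ q ∈ U, H q = Real.exp (F q)) (hp : p ∈ U) :
    fderiv ℝ H p v = H p * fderiv ℝ F p v ∧
    fderiv ℝ (fun q => fderiv ℝ H q v) p w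
      = H p * (fderiv ℝ (fun q => fderiv ℝ F q v) p w + fderiv ℝ F p v * fderiv ℝ F p w) := by
  have hFd : ∀ q ∈ U, DifferentiableAt ℝ F q := fun q hq =>
    (hF.differentiableOn two_ne_zero).differentiableAt (hU.mem_nhds hq)
  have h1 : ∀ q ∈ U, HasFDerivAt H (H q • fderiv ℝ F q) q := fun q hq => by
    rw [hH q hq]
    refine (hFd q hq).hasFDerivAt.exp.congr_of_eventuallyEq ?_
    filter_upwards [hU.mem_nhds hq] with q' hq' using hH q' hq'
  have h2 : (fun q => fderiv ℝ H q v) =ᶠ[𝓝 p] fun q => H q * fderiv ℝ F q v := by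
    filter_upwards [hU.mem_nhds hp] with q hq
    rw [(h1 q hq).fderiv]; simp
  have h3 : DifferentiableAt ℝ (fun q => fderiv ℝ F q v) p :=
    (((hF.fderiv_of_isOpen hU (by norm_num : (1 : WithTop ℕ∞) + 1 ≤ 2)).clm_apply
      contDiffOn_const).differentiableOn one_ne_zero).differentiableAt (hU.mem_nhds hp)
  refine ⟨h2.eq_of_nhds, ?_⟩
  rw [h2.fderiv_eq, fderiv_fun_mul (h1 p hp).differentiableAt h3, (h1 p hp).fderiv]
  simp
  ring

end UnderIntegral

/-! ### Coordinate partial derivatives as iterated directional derivatives -/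

section Bridge

variable {d : ℕ} {f : EuclideanSpace ℝ (Fin d) → EuclideanSpace ℝ (Fin d) → ℝ}
  {U : Set (EuclideanSpace ℝ (Fin d) × EuclideanSpace ℝ (Fin d))}
  {p : EuclideanSpace ℝ (Fin d) × EuclideanSpace ℝ (Fin d)}

theorem dT_dT_eq_fderiv (hU : IsOpen U) (hf : ContDiffOn ℝ 2 (Function.uncurry f) U) (hp : p ∈ U)
    (i j : Fin d) : dT i (dT j f) p.1 p.2 =
      fderiv ℝ (fun q => fderiv ℝ (Function.uncurry f) q (EuclideanSpace.single j 1, 0)) p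
        (EuclideanSpace.single i 1, 0) := by
  have h1 := contDiffOn_uncurry_dT hU hf (by norm_num : (1 : WithTop ℕ∞) + 1 ≤ 2) j
  rw [dT_eq_fderiv ((h1.differentiableOn one_ne_zero).differentiableAt (hU.mem_nhds hp))]
  congr 1
  refine EventuallyEq.fderiv_eq ?_
  filter_upwards [hU.mem_nhds hp] with q hq
  exact dT_eq_fderiv ((hf.differentiableOn two_ne_zero).differentiableAt (hU.mem_nhds hq)) j

theorem dTheta_dT_eq_fderiv (hU : IsOpen U) (hf : ContDiffOn ℝ 2 (Function.uncurry f) U)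
    (hp : p ∈ U) (i j : Fin d) : dTheta i (dT j f) p.1 p.2 =
      fderiv ℝ (fun q => fderiv ℝ (Function.uncurry f) q (EuclideanSpace.single j 1, 0)) p
        (0, EuclideanSpace.single i 1) := by
  have h1 := contDiffOn_uncurry_dT hU hf (by norm_num : (1 : WithTop ℕ∞) + 1 ≤ 2) j
  rw [dTheta_eq_fderiv ((h1.differentiableOn one_ne_zero).differentiableAt (hU.mem_nhds hp))]
  congr 1
  refine EventuallyEq.fderiv_eq ?_
  filter_upwards [hU.mem_nhds hp] with q hq
  exact dT_eq_fderiv ((hf.differentiableOn two_ne_zero).differentiableAt (hU.mem_nhds hq)) j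

end Bridge

/-! ### Information identities -/

namespace SemiModel

variable {d : ℕ} {S : Type*} [MeasurableSpace S] {B : Type*} [SeminormedAddCommGroup B]
  {M : SemiModel d S B} {path : EuclideanSpace ℝ (Fin d) → EuclideanSpace ℝ (Fin d) → B → B}

theorem nbhd_mono (M : SemiModel d S B) {δ δ' : ℝ} (h : δ ≤ δ') : M.nbhd δ ⊆ M.nbhd δ' :=
  fun _ hp => ⟨ball_subset_ball h hp.1, ball_subset_ball h hp.2.1, hp.2.2.1,
    ball_subset_ball h hp.2.2.2⟩

/-- The regularity of the submodel on the neighborhood of size `δ` of the truth. -/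
structure LocallyRegular (M : SemiModel d S B)
    (path : EuclideanSpace ℝ (Fin d) → EuclideanSpace ℝ (Fin d) → B → B) (δ : ℝ) : Prop where
  pos : 0 < δ
  ball_subset : ball M.θ₀ δ ⊆ M.Θ
  path_mem : ∀ p ∈ M.nbhd δ, path p.1 p.2.1 p.2.2 ∈ M.H
  path_self : ∀ θ ∈ M.Θ, ∀ η ∈ M.H, path θ θ η = η
  sub_pos : ∀ᵐ x ∂M.μ, ∀ p ∈ M.nbhd δ, 0 < M.sub path p.2.2 x p.1 p.2.1
  smooth : ∀ᵐ x ∂M.μ, ∀ η ∈ M.H, η ∈ ball M.η₀ δ →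
    ContDiffOn ℝ 3 (Function.uncurry (M.logSub path η x)) (ball M.θ₀ δ ×ˢ ball M.θ₀ δ)

theorem LocallyRegular.mono {δ δ' : ℝ} (h : M.LocallyRegular path δ') (hδ : 0 < δ) (hle : δ ≤ δ') :
    M.LocallyRegular path δ where
  pos := hδ
  ball_subset := (ball_subset_ball hle).trans h.ball_subset
  path_mem p hp := h.path_mem p (M.nbhd_mono hle hp)
  path_self := h.path_self
  sub_pos := by
    filter_upwards [h.sub_pos] with x hx p hp using hx p (M.nbhd_mono hle hp)
  smooth := by
    filter_upwards [h.smooth] with x hx η hη hb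
    exact (hx η hη (ball_subset_ball hle hb)).mono
      (Set.prod_mono (ball_subset_ball hle) (ball_subset_ball hle))

variable {N : Set (ℝ → B)} {hS : ∀ i, MemLp (M.score i) 2 M.P}
  {Ω : Type*} [MeasurableSpace Ω] {X : ℕ → Ω → S} {Q : Measure Ω}
  {ηhat : ℕ → Ω → EuclideanSpace ℝ (Fin d) → B} {r : ℝ}

theorem Assumptions.exists_locallyRegular (hass : M.Assumptions X path N hS Q ηhat r) :
    ∃ δ, M.LocallyRegular path δ := by
  obtain ⟨δ₁, h₁, hp⟩ := hass.path_mem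
  obtain ⟨δ₂, h₂, hs⟩ := hass.sub_pos
  obtain ⟨δ₃, h₃, hd⟩ := hass.smooth
  obtain ⟨δ₄, h₄, hb⟩ := Metric.isOpen_iff.mp isOpen_interior _ hass.interior
  have l1 : min (min δ₁ δ₂) (min δ₃ δ₄) ≤ δ₁ := (min_le_left _ _).trans (min_le_left _ _)
  have l2 : min (min δ₁ δ₂) (min δ₃ δ₄) ≤ δ₂ := (min_le_left _ _).trans (min_le_right _ _)
  have l3 : min (min δ₁ δ₂) (min δ₃ δ₄) ≤ δ₃ := (min_le_right _ _).trans (min_le_left _ _)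
  have l4 : min (min δ₁ δ₂) (min δ₃ δ₄) ≤ δ₄ := (min_le_right _ _).trans (min_le_right _ _)
  refine ⟨min (min δ₁ δ₂) (min δ₃ δ₄), by positivity,
    ((ball_subset_ball l4).trans hb).trans interior_subset,
    fun p hp' => hp p (M.nbhd_mono l1 hp'), hass.path_self, ?_, ?_⟩
  · filter_upwards [hs] with x hx p hp using hx p (M.nbhd_mono l2 hp)
  · filter_upwards [hd] with x hx η hη hb
    exact (hx η hη (ball_subset_ball l3 hb)).mono
      (Set.prod_mono (ball_subset_ball l3) (ball_subset_ball l3))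

theorem P_absolutelyContinuous (M : SemiModel d S B) : M.P ≪ M.μ := withDensity_absolutelyContinuous _ _

theorem isProbabilityMeasure_P (M : SemiModel d S B) : IsProbabilityMeasure M.P := by
  constructor
  rw [P, withDensity_apply _ MeasurableSet.univ, Measure.restrict_univ]
  exact M.lintegral_lik _ M.θ₀_mem _ M.η₀_mem

theorem integral_P (M : SemiModel d S B) (f : S → ℝ) :
    ∫ x, f x ∂M.P = ∫ x, M.lik M.θ₀ M.η₀ x * f x ∂M.μ := by
  rw [P, integral_withDensity_eq_integral_toReal_smul
    (M.measurable_lik _ M.θ₀_mem _ M.η₀_mem).ennreal_ofReal (ae_of_all _ fun x => by simp)]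
  refine integral_congr_ae (ae_of_all _ fun x => ?_)
  simp [ENNReal.toReal_ofReal (M.lik_nonneg _ M.θ₀_mem _ M.η₀_mem x)]

theorem integrable_P_iff (M : SemiModel d S B) (f : S → ℝ) :
    Integrable f M.P ↔ Integrable (fun x => M.lik M.θ₀ M.η₀ x * f x) M.μ := by
  rw [P, integrable_withDensity_iff_integrable_smul'
    (M.measurable_lik _ M.θ₀_mem _ M.η₀_mem).ennreal_ofReal (ae_of_all _ fun x => by simp)]
  refine integrable_congr (ae_of_all _ fun x => ?_)
  simp [ENNReal.toReal_ofReal (M.lik_nonneg _ M.θ₀_mem _ M.η₀_mem x)]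

theorem integrable_lik (M : SemiModel d S B) {θ : EuclideanSpace ℝ (Fin d)} {η : B} (hθ : θ ∈ M.Θ)
    (hη : η ∈ M.H) : Integrable (M.lik θ η) M.μ := by
  refine ⟨(M.measurable_lik θ hθ η hη).aestronglyMeasurable, ?_⟩
  rw [hasFiniteIntegral_iff_ofReal (ae_of_all _ (M.lik_nonneg θ hθ η hη)), M.lintegral_lik θ hθ η hη]
  exact ENNReal.one_lt_top

theorem integral_lik (M : SemiModel d S B) {θ : EuclideanSpace ℝ (Fin d)} {η : B} (hθ : θ ∈ M.Θ)
    (hη : η ∈ M.H) : ∫ x, M.lik θ η x ∂M.μ = 1 := by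
  rw [integral_eq_lintegral_of_nonneg_ae (ae_of_all _ (M.lik_nonneg θ hθ η hη))
    (M.measurable_lik θ hθ η hη).aestronglyMeasurable, M.lintegral_lik θ hθ η hη]
  simp

section Truth

variable {δ : ℝ}

local notation "W" => EuclideanSpace ℝ (Fin d)

theorem mem_nbhd_truth (M : SemiModel d S B) (hδ : 0 < δ) : (M.θ₀, M.θ₀, M.η₀) ∈ M.nbhd δ :=
  ⟨mem_ball_self hδ, mem_ball_self hδ, M.η₀_mem, mem_ball_self hδ⟩

theorem LocallyRegular.sub_eq_exp (h : M.LocallyRegular path δ) :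
    ∀ᵐ x ∂M.μ, ∀ q ∈ ball M.θ₀ δ ×ˢ ball M.θ₀ δ,
      Function.uncurry (M.sub path M.η₀ x) q
        = Real.exp (Function.uncurry (M.logSub path M.η₀ x) q) := by
  filter_upwards [h.sub_pos] with x hx q hq
  exact (Real.exp_log (hx (q.1, q.2, M.η₀) ⟨hq.1, hq.2, M.η₀_mem, mem_ball_self h.pos⟩)).symm

theorem LocallyRegular.smooth_logSub (h : M.LocallyRegular path δ) :
    ∀ᵐ x ∂M.μ, ContDiffOn ℝ 2 (Function.uncurry (M.logSub path M.η₀ x))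
      (ball M.θ₀ δ ×ˢ ball M.θ₀ δ) := by
  filter_upwards [h.smooth] with x hx
  exact (hx M.η₀ M.η₀_mem (mem_ball_self h.pos)).of_le (by norm_num)

theorem LocallyRegular.smooth_sub (h : M.LocallyRegular path δ) :
    ∀ᵐ x ∂M.μ, ContDiffOn ℝ 2 (Function.uncurry (M.sub path M.η₀ x))
      (ball M.θ₀ δ ×ˢ ball M.θ₀ δ) := by
  filter_upwards [h.smooth_logSub, h.sub_eq_exp] with x hx he
  exact hx.exp.congr he

theorem LocallyRegular.lik_eq_sub (h : M.LocallyRegular path δ) (x : S) :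
    M.lik M.θ₀ M.η₀ x = Function.uncurry (M.sub path M.η₀ x) (M.θ₀, M.θ₀) := by
  simp [sub, h.path_self _ M.θ₀_mem _ M.η₀_mem]

/-- The score in `t` along the submodel is the efficient score at the truth. -/
theorem Assumptions.memLp_dl (hass : M.Assumptions X path N hS Q ηhat r) (i : Fin d) :
    MemLp (M.dl path [i] [] M.θ₀ M.θ₀ M.η₀) 2 M.P :=
  (memLp_congr_ae (hass.leastFavorable i)).mpr (Lp.memLp _)

theorem Assumptions.exists_dominated (hass : M.Assumptions X path N hS Q ηhat r) :
    ∃ δ, M.LocallyRegular path δ ∧ ∃ G : S → ℝ, Integrable G M.μ ∧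
    ∀ᵐ x ∂M.μ, ∀ t ∈ ball M.θ₀ δ, ∀ θ ∈ ball M.θ₀ δ, ∀ i j,
      |pder (M.sub path M.η₀ x) [i, j] [] t θ| ≤ G x ∧
      |pder (M.sub path M.η₀ x) [i] [j] t θ| ≤ G x := by
  obtain ⟨δ₁, h₁⟩ := hass.exists_locallyRegular
  obtain ⟨δ₂, h₂, G, hG, hb⟩ := hass.dominated
  refine ⟨min δ₁ δ₂, h₁.mono (lt_min h₁.pos h₂) (min_le_left _ _), G, hG, ?_⟩
  filter_upwards [hb] with x hx t ht θ hθ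
  exact hx t (ball_subset_ball (min_le_right _ _) ht) θ (ball_subset_ball (min_le_right _ _) hθ)

theorem LocallyRegular.integrable_sub (h : M.LocallyRegular path δ) (q : W × W)
    (hq : q ∈ ball M.θ₀ δ ×ˢ ball M.θ₀ δ) :
    Integrable (fun x => Function.uncurry (M.sub path M.η₀ x) q) M.μ :=
  M.integrable_lik (h.ball_subset hq.1)
    (h.path_mem (q.1, q.2, M.η₀) ⟨hq.1, hq.2, M.η₀_mem, mem_ball_self h.pos⟩)

theorem LocallyRegular.integral_sub (h : M.LocallyRegular path δ) (q : W × W)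
    (hq : q ∈ ball M.θ₀ δ ×ˢ ball M.θ₀ δ) :
    ∫ x, Function.uncurry (M.sub path M.η₀ x) q ∂M.μ = 1 :=
  M.integral_lik (h.ball_subset hq.1)
    (h.path_mem (q.1, q.2, M.η₀) ⟨hq.1, hq.2, M.η₀_mem, mem_ball_self h.pos⟩)

/-- The efficient score has mean zero. -/
theorem Assumptions.integral_dl_eq_zero (hass : M.Assumptions X path N hS Q ηhat r) (i : Fin d) :
    ∫ x, M.dl path [i] [] M.θ₀ M.θ₀ M.η₀ x ∂M.P = 0 := by
  obtain ⟨δ, h, G, hG, hb⟩ := hass.exists_dominated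
  have := M.isProbabilityMeasure_P
  have hopen : IsOpen (ball M.θ₀ δ ×ˢ ball M.θ₀ δ) := isOpen_ball.prod isOpen_ball
  have hp : (M.θ₀, M.θ₀) ∈ ball M.θ₀ δ ×ˢ ball M.θ₀ δ := ⟨mem_ball_self h.pos, mem_ball_self h.pos⟩
  -- The derivative of a density is the density times its score, so the `P`-mean of the score is the
  -- `μ`-integral of the derivative of `lik`.
  have key : ∀ᵐ x ∂M.μ, fderiv ℝ (Function.uncurry (M.sub path M.η₀ x)) (M.θ₀, M.θ₀)
      (EuclideanSpace.single i 1, 0)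
      = M.lik M.θ₀ M.η₀ x * M.dl path [i] [] M.θ₀ M.θ₀ M.η₀ x := by
    filter_upwards [h.smooth_logSub, h.sub_eq_exp] with x hx he
    rw [(fderiv_fderiv_of_eqOn_exp hopen hx he hp (w := 0)).1, ← h.lik_eq_sub]
    congr 1
    exact (dT_eq_fderiv ((hx.differentiableOn two_ne_zero).differentiableAt
      (hopen.mem_nhds hp)) i).symm
  rw [integral_P, ← integral_congr_ae key]
  refine integral_derivative_eq_zero hopen hp h.smooth_sub h.integrable_sub h.integral_sub hG ?_ ?_
  · filter_upwards [hb, h.smooth_sub] with x hx hsm q hq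
    have := (hx q.1 hq.1 q.2 hq.2 i i).1
    rw [← dT_dT_eq_fderiv hopen hsm hq]
    exact this
  · rw [integrable_congr key, ← integrable_P_iff]
    exact (hass.memLp_dl i).integrable one_le_two

theorem Assumptions.memLp_dl_tt (hass : M.Assumptions X path N hS Q ηhat r) (i j : Fin d) :
    MemLp (M.dl path [i, j] [] M.θ₀ M.θ₀ M.η₀) 2 M.P := by
  obtain ⟨δ, hδ, h⟩ := hass.donsker_tt
  exact (h i j).1 _ ⟨_, M.mem_nbhd_truth hδ, rfl⟩

theorem Assumptions.memLp_dl_tθ (hass : M.Assumptions X path N hS Q ηhat r) (i j : Fin d) :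
    MemLp (M.dl path [i] [j] M.θ₀ M.θ₀ M.η₀) 2 M.P := by
  obtain ⟨δ, hδ, h⟩ := hass.donsker_tθ
  exact (h i j).1 _ ⟨_, M.mem_nbhd_truth hδ, rfl⟩

/-- The information identity `P ℓ̈ = - Ĩ₀`. -/
theorem Assumptions.integral_dl_tt (hass : M.Assumptions X path N hS Q ηhat r) (i j : Fin d) :
    ∫ x, M.dl path [i, j] [] M.θ₀ M.θ₀ M.η₀ x ∂M.P = - M.effInfo N hS i j := by
  obtain ⟨δ, h, G, hG, hb⟩ := hass.exists_dominated
  have := M.isProbabilityMeasure_P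
  have hopen : IsOpen (ball M.θ₀ δ ×ˢ ball M.θ₀ δ) := isOpen_ball.prod isOpen_ball
  have hp : (M.θ₀, M.θ₀) ∈ ball M.θ₀ δ ×ˢ ball M.θ₀ δ := ⟨mem_ball_self h.pos, mem_ball_self h.pos⟩
  -- With `lik = exp ℓ`, the second derivative of `lik` is `lik` times the second derivative of `ℓ`
  -- plus the product of two scores. Its `μ`-integral vanishes, which ties `P ℓ̈` to the second
  -- moment of the score.
  have key : ∀ᵐ x ∂M.μ, fderiv ℝ (fun q => fderiv ℝ (Function.uncurry (M.sub path M.η₀ x)) q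
        (EuclideanSpace.single j 1, 0)) (M.θ₀, M.θ₀) (EuclideanSpace.single i 1, 0)
      = M.lik M.θ₀ M.η₀ x * (M.dl path [i, j] [] M.θ₀ M.θ₀ M.η₀ x
        + M.dl path [j] [] M.θ₀ M.θ₀ M.η₀ x * M.dl path [i] [] M.θ₀ M.θ₀ M.η₀ x) := by
    filter_upwards [h.smooth_logSub, h.sub_eq_exp] with x hx he
    have hd := (hx.differentiableOn two_ne_zero).differentiableAt (hopen.mem_nhds hp)
    rw [(fderiv_fderiv_of_eqOn_exp hopen hx he hp).2, ← h.lik_eq_sub,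
      ← dT_dT_eq_fderiv hopen hx hp, ← dT_eq_fderiv hd, ← dT_eq_fderiv hd]
    rfl
  have hzero := integral_second_derivative_eq_zero hopen hp h.smooth_sub h.integrable_sub
    h.integral_sub hG (v := (EuclideanSpace.single j 1, 0)) (w := (EuclideanSpace.single i 1, 0)) (by
      filter_upwards [hb, h.smooth_sub] with x hx hsm q hq
      have := (hx q.1 hq.1 q.2 hq.2 i j).1
      rw [← dT_dT_eq_fderiv hopen hsm hq]
      exact this)
  have hprod : Integrable (fun x => M.dl path [j] [] M.θ₀ M.θ₀ M.η₀ x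
      * M.dl path [i] [] M.θ₀ M.θ₀ M.η₀ x) M.P :=
    (hass.memLp_dl j).integrable_mul (hass.memLp_dl i)
  rw [integral_congr_ae key, ← integral_P,
    integral_add ((hass.memLp_dl_tt i j).integrable one_le_two) hprod] at hzero
  have hm : ∀ k, ∫ x, M.effScore N hS k x ∂M.P = 0 := fun k => by
    rw [← integral_congr_ae (hass.leastFavorable k)]
    exact hass.integral_dl_eq_zero k
  have hcov : M.effInfo N hS i j = ∫ x, M.dl path [j] [] M.θ₀ M.θ₀ M.η₀ x
      * M.dl path [i] [] M.θ₀ M.θ₀ M.η₀ x ∂M.P := by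
    simp only [effInfo, Matrix.of_apply, covariance, hm, sub_zero]
    refine integral_congr_ae ?_
    filter_upwards [hass.leastFavorable i, hass.leastFavorable j] with x h1 h2
    rw [h1, h2, mul_comm]
  rw [hcov]
  linarith

/-- The difference of the two scores is the projection onto the nuisance space, and the efficient
score is orthogonal to that space. -/
theorem integral_effScore_mul_sub (M : SemiModel d S B) (N : Set (ℝ → B))
    (hS : ∀ i, MemLp (M.score i) 2 M.P) (i j : Fin d) :
    ∫ x, M.effScore N hS i x * (M.score j x - M.effScore N hS j x) ∂M.P = 0 := by
  have hcomp : CompleteSpace (M.nuisanceSpace N) :=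
    (Submodule.isClosed_topologicalClosure _).completeSpace_coe
  set K := M.nuisanceSpace N with hK
  set s := fun i => (hS i).toLp (M.score i) with hs
  have h1 : M.effScore N hS i ∈ Kᗮ := K.sub_starProjection_mem_orthogonal (s i)
  have h2 : K.starProjection (s j) ∈ K := K.starProjection_apply_mem (s j)
  have h3 := (Submodule.mem_orthogonal' K _).mp h1 _ h2
  rw [L2.inner_def] at h3
  rw [← h3]
  refine integral_congr_ae ?_
  have e1 : M.effScore N hS j = s j - K.starProjection (s j) := rfl
  filter_upwards [(hS j).coeFn_toLp, Lp.coeFn_sub (s j) (K.starProjection (s j))] with x hx1 hx2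
  rw [e1, hx2, Pi.sub_apply, hx1]
  simp [mul_comm]

/-- Since `η_θ(θ, η₀) = η₀`, the function `θ ↦ log lik(θ, η₀)` is `ℓ(t, θ, η₀)` restricted to the
diagonal. The chain rule there gives the score as `∂_t ℓ + ∂_θ ℓ`, and `∂_t ℓ` is the efficient
score. Thus `∂_θ ℓ` at the truth is the projection of the score on the nuisance space. -/
theorem Assumptions.score_eq (hass : M.Assumptions X path N hS Q ηhat r) (j : Fin d) :
    ∀ᵐ x ∂M.P, M.score j x = M.effScore N hS j x
      + dTheta j (M.logSub path M.η₀ x) M.θ₀ M.θ₀ := by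
  obtain ⟨δ, h⟩ := hass.exists_locallyRegular
  have hopen : IsOpen (ball M.θ₀ δ ×ˢ ball M.θ₀ δ) := isOpen_ball.prod isOpen_ball
  have hp : (M.θ₀, M.θ₀) ∈ ball M.θ₀ δ ×ˢ ball M.θ₀ δ := ⟨mem_ball_self h.pos, mem_ball_self h.pos⟩
  filter_upwards [hass.leastFavorable j,
    M.P_absolutelyContinuous.ae_le h.smooth_logSub] with x hx hsm
  have hd := (hsm.differentiableOn two_ne_zero).differentiableAt (hopen.mem_nhds hp)
  rw [← hx]
  have e1 : (fun θ => Real.log (M.lik θ M.η₀ x)) =ᶠ[𝓝 M.θ₀]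
      fun θ => Function.uncurry (M.logSub path M.η₀ x) (θ, θ) := by
    filter_upwards [isOpen_ball.mem_nhds (mem_ball_self h.pos)] with θ hθ
    simp [logSub, sub, h.path_self θ (h.ball_subset hθ) _ M.η₀_mem]
  have e2 : HasFDerivAt (fun θ => Function.uncurry (M.logSub path M.η₀ x) (θ, θ))
      ((fderiv ℝ (Function.uncurry (M.logSub path M.η₀ x)) (M.θ₀, M.θ₀)).comp
        ((ContinuousLinearMap.id ℝ W).prod (ContinuousLinearMap.id ℝ W))) M.θ₀ :=
    HasFDerivAt.comp (g := Function.uncurry (M.logSub path M.η₀ x)) (f := fun θ => (θ, θ)) M.θ₀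
      hd.hasFDerivAt ((hasFDerivAt_id M.θ₀).prodMk (hasFDerivAt_id M.θ₀))
  rw [score, e1.fderiv_eq, e2.fderiv]
  change fderiv ℝ (Function.uncurry (M.logSub path M.η₀ x)) (M.θ₀, M.θ₀)
    (EuclideanSpace.single j 1, EuclideanSpace.single j 1)
    = dT j (M.logSub path M.η₀ x) M.θ₀ M.θ₀ + _
  have e3 : ((EuclideanSpace.single j 1, EuclideanSpace.single j 1) : W × W)
      = (EuclideanSpace.single j 1, 0) + (0, EuclideanSpace.single j 1) := by simp
  rw [e3, map_add, ← dT_eq_fderiv hd, ← dTheta_eq_fderiv hd]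

/-- `P ℓ_{t,θ} = 0`: the derivative of the log likelihood in the base point of the submodel is a
projection of the score onto the nuisance space. -/
theorem Assumptions.integral_dl_tθ (hass : M.Assumptions X path N hS Q ηhat r) (i j : Fin d) :
    ∫ x, M.dl path [i] [j] M.θ₀ M.θ₀ M.η₀ x ∂M.P = 0 := by
  obtain ⟨δ, h, G, hG, hb⟩ := hass.exists_dominated
  have := M.isProbabilityMeasure_P
  have hopen : IsOpen (ball M.θ₀ δ ×ˢ ball M.θ₀ δ) := isOpen_ball.prod isOpen_ball
  have hp : (M.θ₀, M.θ₀) ∈ ball M.θ₀ δ ×ˢ ball M.θ₀ δ := ⟨mem_ball_self h.pos, mem_ball_self h.pos⟩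
  have key : ∀ᵐ x ∂M.μ, fderiv ℝ (fun q => fderiv ℝ (Function.uncurry (M.sub path M.η₀ x)) q
        (EuclideanSpace.single i 1, 0)) (M.θ₀, M.θ₀) (0, EuclideanSpace.single j 1)
      = M.lik M.θ₀ M.η₀ x * (M.dl path [i] [j] M.θ₀ M.θ₀ M.η₀ x
        + M.dl path [i] [] M.θ₀ M.θ₀ M.η₀ x * dTheta j (M.logSub path M.η₀ x) M.θ₀ M.θ₀) := by
    filter_upwards [h.smooth_logSub, h.sub_eq_exp] with x hx he
    have hd := (hx.differentiableOn two_ne_zero).differentiableAt (hopen.mem_nhds hp)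
    rw [(fderiv_fderiv_of_eqOn_exp hopen hx he hp).2, ← h.lik_eq_sub,
      ← dTheta_dT_eq_fderiv hopen hx hp, ← dT_eq_fderiv hd, ← dTheta_eq_fderiv hd]
    rfl
  have hzero := integral_second_derivative_eq_zero hopen hp h.smooth_sub h.integrable_sub
    h.integral_sub hG (v := (EuclideanSpace.single i 1, 0)) (w := (0, EuclideanSpace.single j 1)) (by
      filter_upwards [hb, h.smooth_sub] with x hx hsm q hq
      have := (hx q.1 hq.1 q.2 hq.2 i j).2
      rw [← dTheta_dT_eq_fderiv hopen hsm hq]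
      exact this)
  -- The product term in the second derivative of `lik` pairs the efficient score with a projection
  -- onto the nuisance space, so it integrates to zero and only `P ℓ_{t,θ}` survives.
  have hae : (fun x => M.dl path [i] [] M.θ₀ M.θ₀ M.η₀ x
      * dTheta j (M.logSub path M.η₀ x) M.θ₀ M.θ₀) =ᵐ[M.P]
      fun x => M.effScore N hS i x * (M.score j x - M.effScore N hS j x) := by
    filter_upwards [hass.leastFavorable i, hass.score_eq j] with x h1 h2
    rw [h1, h2, add_sub_cancel_left]
  have hprod : Integrable (fun x => M.effScore N hS i x * (M.score j x - M.effScore N hS j x)) M.P :=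
    (Lp.memLp (M.effScore N hS i)).integrable_mul ((hS j).sub (Lp.memLp _))
  rw [integral_congr_ae key, ← integral_P, integral_add ((hass.memLp_dl_tθ i j).integrable one_le_two)
    ((integrable_congr hae).mpr hprod), integral_congr_ae hae, integral_effScore_mul_sub,
    add_zero] at hzero
  exact hzero

end Truth

end SemiModel

/-! ### Quadratic forms -/

section Quadratic

variable {d : ℕ}

/-- The bilinear form `uᵀ A v`. -/
def bil (A : Matrix (Fin d) (Fin d) ℝ) (u v : EuclideanSpace ℝ (Fin d)) : ℝ :=
  ∑ i, u i * ∑ j, A i j * v j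

variable {A : Matrix (Fin d) (Fin d) ℝ}

theorem bil_add_left (A : Matrix (Fin d) (Fin d) ℝ) (u u' v : EuclideanSpace ℝ (Fin d)) :
    bil A (u + u') v = bil A u v + bil A u' v := by
  simp [bil, add_mul, Finset.sum_add_distrib]

theorem bil_smul_left (A : Matrix (Fin d) (Fin d) ℝ) (c : ℝ) (u v : EuclideanSpace ℝ (Fin d)) :
    bil A (c • u) v = c * bil A u v := by
  simp [bil, Finset.mul_sum, mul_assoc]

theorem bil_comm (hA : A.IsHermitian) (u v : EuclideanSpace ℝ (Fin d)) : bil A u v = bil A v u := by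
  have hs : ∀ i j, A i j = A j i := fun i j => by simpa using (hA.apply i j).symm
  simp only [bil, Finset.mul_sum]
  rw [Finset.sum_comm]
  refine Finset.sum_congr rfl fun i _ => Finset.sum_congr rfl fun j _ => ?_
  rw [hs j i]; ring

theorem bil_add_right (A : Matrix (Fin d) (Fin d) ℝ) (u v v' : EuclideanSpace ℝ (Fin d)) :
    bil A u (v + v') = bil A u v + bil A u v' := by
  simp [bil, mul_add, Finset.sum_add_distrib]

theorem bil_smul_right (A : Matrix (Fin d) (Fin d) ℝ) (c : ℝ) (u v : EuclideanSpace ℝ (Fin d)) :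
    bil A u (c • v) = c * bil A u v := by
  simp only [bil, Finset.mul_sum, PiLp.smul_apply, smul_eq_mul]
  exact Finset.sum_congr rfl fun i _ => Finset.sum_congr rfl fun j _ => by ring

theorem continuous_bil (A : Matrix (Fin d) (Fin d) ℝ) :
    Continuous fun v : EuclideanSpace ℝ (Fin d) => bil A v v := by
  unfold bil; fun_prop

theorem bil_self_eq_dotProduct (A : Matrix (Fin d) (Fin d) ℝ) (v : EuclideanSpace ℝ (Fin d)) :
    bil A v v = star v.ofLp ⬝ᵥ (A.mulVec v.ofLp) := by
  simp [bil, dotProduct, Matrix.mulVec]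

/-- The form attains a positive minimum on the compact unit sphere, and homogeneity extends the
bound. For `d = 0` the sphere is empty and any constant works. -/
theorem exists_pos_le_bil (hA : A.PosDef) : ∃ c : ℝ, 0 < c ∧ ∀ v, c * ‖v‖ ^ 2 ≤ bil A v v := by
  have hpos : ∀ v : EuclideanSpace ℝ (Fin d), v ≠ 0 → 0 < bil A v v := fun v hv => by
    rw [bil_self_eq_dotProduct]
    exact hA.dotProduct_mulVec_pos (by simpa using hv)
  have hhom : ∀ c : ℝ, 0 < c → (∀ v : EuclideanSpace ℝ (Fin d), ‖v‖ = 1 → c ≤ bil A v v) →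
      ∀ v, c * ‖v‖ ^ 2 ≤ bil A v v := by
    intro c hc h v
    rcases eq_or_ne v 0 with rfl | hv
    · simp [bil]
    · have hn : ‖v‖ ≠ 0 := norm_ne_zero_iff.mpr hv
      have h1 := h (‖v‖⁻¹ • v) (by rw [norm_smul, norm_inv, norm_norm, inv_mul_cancel₀ hn])
      rw [bil_smul_left, bil_smul_right] at h1
      have h2 := mul_le_mul_of_nonneg_right h1 (sq_nonneg ‖v‖)
      calc c * ‖v‖ ^ 2 ≤ _ := h2
        _ = bil A v v := by field_simp
  rcases (sphere (0 : EuclideanSpace ℝ (Fin d)) 1).eq_empty_or_nonempty with he | hne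
  · refine ⟨1, one_pos, hhom 1 one_pos fun v hv => ?_⟩
    have : v ∈ sphere (0 : EuclideanSpace ℝ (Fin d)) 1 := by simpa using hv
    simp [he] at this
  · obtain ⟨v₀, hv₀, hmin⟩ := (isCompact_sphere (0 : EuclideanSpace ℝ (Fin d)) 1).exists_isMinOn hne
      (continuous_bil A).continuousOn
    have h0 : 0 < bil A v₀ v₀ := hpos v₀ (by
      rintro rfl; simp at hv₀)
    exact ⟨_, h0, hhom _ h0 fun v hv => hmin (by simpa using hv)⟩

end Quadratic

/-! ### Expansions of the empirical score and of the profile likelihood -/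

namespace SemiModel

variable {d : ℕ} {S : Type*} [MeasurableSpace S] {B : Type*} [SeminormedAddCommGroup B]
  {M : SemiModel d S B} {path : EuclideanSpace ℝ (Fin d) → EuclideanSpace ℝ (Fin d) → B → B}

/-- Expansion of the empirical score at `(t, θ, η)`. -/
theorem empMean_score_expansion {n : ℕ} {x : Fin n → S} {δ : ℝ} {η : B}
    (hη : η ∈ M.H) (hηb : η ∈ ball M.η₀ δ)
    (hsm : ∀ k, ContDiffOn ℝ 3 (Function.uncurry (M.logSub path η (x k)))
      (ball M.θ₀ δ ×ˢ ball M.θ₀ δ))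
    {F : S → ℝ} (hF : ∀ k, ∀ p ∈ M.nbhd δ, ∀ i j l,
      |M.dl path [i, j, l] [] p.1 p.2.1 p.2.2 (x k)| ≤ F (x k) ∧
      |M.dl path [i, j] [l] p.1 p.2.1 p.2.2 (x k)| ≤ F (x k) ∧
      |M.dl path [i] [j, l] p.1 p.2.1 p.2.2 (x k)| ≤ F (x k))
    {A : Matrix (Fin d) (Fin d) ℝ} (hA : A.IsHermitian) {K a w : ℝ} (hK : 0 ≤ K) (ha : 0 ≤ a)
    (hFK : empMean n x F ≤ K)
    {t θ : EuclideanSpace ℝ (Fin d)} (ht : t ∈ ball M.θ₀ δ) (hθ : θ ∈ ball M.θ₀ δ) {i : Fin d}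
    (hTT : ∀ j, |empMean n x (M.dl path [j, i] [] M.θ₀ M.θ₀ η) + A j i| ≤ K * (a + ‖θ - M.θ₀‖))
    (hTθ : ∀ j, |empMean n x (M.dl path [i] [j] M.θ₀ M.θ₀ η)| ≤ K * (a + ‖θ - M.θ₀‖))
    (hT : |empMean n x (M.dl path [i] [] M.θ₀ M.θ₀ η) - w| ≤ K * (a + ‖θ - M.θ₀‖) ^ 2) :
    |empMean n x (M.dl path [i] [] t θ η) - (w - ∑ j, A i j * (t - M.θ₀) j)|
      ≤ K * (d + 1) ^ 2 * (a + ‖t - M.θ₀‖ + ‖θ - M.θ₀‖) ^ 2 := by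
  have hδ : 0 < δ := (dist_nonneg).trans_lt ht
  have hopen : IsOpen (ball M.θ₀ δ ×ˢ ball M.θ₀ δ) := isOpen_ball.prod isOpen_ball
  set u := t - M.θ₀ with hu
  set v := θ - M.θ₀ with hv
  have h0 : M.θ₀ ∈ ball M.θ₀ δ := mem_ball_self hδ
  -- Taylor expansion of the `i`-th score at `(θ₀, θ₀)` with `η` held fixed; the third derivatives
  -- are bounded by the envelope, so averaging leaves a remainder proportional to `empMean n x F`.
  have htay : ∀ k, |M.dl path [i] [] t θ η (x k) - M.dl path [i] [] M.θ₀ M.θ₀ η (x k)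
      - ∑ j, u j * M.dl path [j, i] [] M.θ₀ M.θ₀ η (x k)
      - ∑ j, v j * M.dl path [i] [j] M.θ₀ M.θ₀ η (x k)| ≤ (d * (‖u‖ + ‖v‖)) ^ 2 * F (x k) := by
    intro k
    have := abs_taylor_le (f := dT i (M.logSub path η (x k)))
      (contDiffOn_uncurry_dT hopen (hsm k) (by norm_num) i) (K := F (x k))
      (fun j l t ht θ hθ => (hF k (t, θ, η) ⟨ht, hθ, hη, hηb⟩ j l i).1)
      (fun j l t ht θ hθ => (hF k (t, θ, η) ⟨ht, hθ, hη, hηb⟩ l i j).2.1)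
      (fun j l t ht θ hθ => (hF k (t, θ, η) ⟨ht, hθ, hη, hηb⟩ i j l).2.2)
      h0 (a := u) (by simpa [hu] using ht) h0 (b := v) (by simpa [hv] using hθ)
    rw [hu, hv, add_sub_cancel, add_sub_cancel, ← hu, ← hv, mul_comm (F (x k))] at this
    exact this
  have hmean := abs_empMean_le (f := fun y => M.dl path [i] [] t θ η y
      - M.dl path [i] [] M.θ₀ M.θ₀ η y - ∑ j, u j * M.dl path [j, i] [] M.θ₀ M.θ₀ η y
      - ∑ j, v j * M.dl path [i] [j] M.θ₀ M.θ₀ η y) (g := fun y => (d * (‖u‖ + ‖v‖)) ^ 2 * F y) htay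
  rw [empMean_const_mul, empMean_sub, empMean_sub, empMean_sub, empMean_sum, empMean_sum] at hmean
  simp only [empMean_const_mul] at hmean
  set T := empMean n x (M.dl path [i] [] t θ η)
  set T₀ := empMean n x (M.dl path [i] [] M.θ₀ M.θ₀ η)
  set c := a + ‖v‖ with hc
  have hc0 : 0 ≤ c := by positivity
  -- Replacing the averaged second derivatives in `t` by `-A` costs `K c` per coordinate of `u`. The
  -- mixed derivatives average to nearly zero, so moving the base point `θ` produces no linear term.
  have e1 : |∑ j, u j * empMean n x (M.dl path [j, i] [] M.θ₀ M.θ₀ η) + ∑ j, A i j * u j|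
      ≤ d * ‖u‖ * (K * c) := by
    rw [← Finset.sum_add_distrib]
    refine (Finset.abs_sum_le_sum_abs _ _).trans ((Finset.sum_le_sum (fun j _ => ?_)).trans
      ((Finset.sum_mul _ _ _).symm.le.trans
        (mul_le_mul_of_nonneg_right (sum_abs_coord_le u) (by positivity))))
    rw [show A i j = A j i by simpa using (hA.apply i j).symm, mul_comm (A j i), ← mul_add, abs_mul]
    exact mul_le_mul_of_nonneg_left (hTT j) (abs_nonneg _)
  have e2 : |∑ j, v j * empMean n x (M.dl path [i] [j] M.θ₀ M.θ₀ η)| ≤ d * ‖v‖ * (K * c) := by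
    refine (Finset.abs_sum_le_sum_abs _ _).trans ((Finset.sum_le_sum (fun j _ => ?_)).trans
      ((Finset.sum_mul _ _ _).symm.le.trans
        (mul_le_mul_of_nonneg_right (sum_abs_coord_le v) (by positivity))))
    rw [abs_mul]
    exact mul_le_mul_of_nonneg_left (hTθ j) (abs_nonneg _)
  have e3 : (d * (‖u‖ + ‖v‖)) ^ 2 * empMean n x F ≤ (d * (‖u‖ + ‖v‖)) ^ 2 * K := by gcongr
  set R₁ := ∑ j, u j * empMean n x (M.dl path [j, i] [] M.θ₀ M.θ₀ η)
  set R₂ := ∑ j, v j * empMean n x (M.dl path [i] [j] M.θ₀ M.θ₀ η)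
  set R₃ := ∑ j, A i j * u j
  have htri : |T - (w - R₃)| ≤ |T - T₀ - R₁ - R₂| + |T₀ - w| + |R₁ + R₃| + |R₂| := by
    have : T - (w - R₃) = (T - T₀ - R₁ - R₂) + (T₀ - w) + (R₁ + R₃) + R₂ := by ring
    rw [this]
    exact (abs_add_le _ _).trans (add_le_add ((abs_add_le _ _).trans
      (add_le_add (abs_add_le _ _) le_rfl)) le_rfl)
  refine htri.trans ?_
  have hsum : |T - T₀ - R₁ - R₂| + |T₀ - w| + |R₁ + R₃| + |R₂|
      ≤ (d * (‖u‖ + ‖v‖)) ^ 2 * K + K * c ^ 2 + d * ‖u‖ * (K * c) + d * ‖v‖ * (K * c) := by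
    gcongr
    exact hmean.trans e3
  refine hsum.trans ?_
  have hs : ‖u‖ + ‖v‖ ≤ a + ‖u‖ + ‖v‖ := by linarith
  have hs' : c ≤ a + ‖u‖ + ‖v‖ := by rw [hc]; linarith [norm_nonneg u]
  set s := a + ‖u‖ + ‖v‖
  -- The coefficients add up to `d² + d + 1 ≤ (d + 1)²`.
  calc (d * (‖u‖ + ‖v‖)) ^ 2 * K + K * c ^ 2 + d * ‖u‖ * (K * c) + d * ‖v‖ * (K * c)
      = (d * (‖u‖ + ‖v‖)) ^ 2 * K + K * c ^ 2 + d * (‖u‖ + ‖v‖) * (K * c) := by ring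
    _ ≤ (d * s) ^ 2 * K + K * s ^ 2 + d * s * (K * s) := by gcongr
    _ ≤ K * (d + 1) ^ 2 * s ^ 2 := by
        nlinarith [mul_nonneg (mul_nonneg hK (Nat.cast_nonneg (α := ℝ) d)) (sq_nonneg s)]

/-- Integrated form of an expansion of the empirical score. -/
theorem empMean_logSub_expansion {n : ℕ} {x : Fin n → S} {δ : ℝ} {η : B}
    (hsm : ∀ k, ContDiffOn ℝ 3 (Function.uncurry (M.logSub path η (x k)))
      (ball M.θ₀ δ ×ˢ ball M.θ₀ δ))
    {A : Matrix (Fin d) (Fin d) ℝ} (hA : A.IsHermitian) {C a : ℝ} (hC : 0 ≤ C) (ha : 0 ≤ a)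
    {w : EuclideanSpace ℝ (Fin d)} {b t t' : EuclideanSpace ℝ (Fin d)} (hb : b ∈ ball M.θ₀ δ)
    (ht : t ∈ ball M.θ₀ δ) (ht' : t' ∈ ball M.θ₀ δ)
    (hbb : ‖b - M.θ₀‖ ≤ ‖t - M.θ₀‖ + ‖t' - M.θ₀‖)
    (hexp : ∀ s ∈ ball M.θ₀ δ, ∀ i,
      |empMean n x (M.dl path [i] [] s b η) - (w i - ∑ j, A i j * (s - M.θ₀) j)|
        ≤ C * (a + ‖s - M.θ₀‖ + ‖b - M.θ₀‖) ^ 2) :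
    |empMean n x (fun y => M.logSub path η y t b) - empMean n x (fun y => M.logSub path η y t' b)
      - (∑ i, (t - t') i * w i - (bil A (t - M.θ₀) (t - M.θ₀) - bil A (t' - M.θ₀) (t' - M.θ₀)) / 2)|
      ≤ d * C * ‖t - t'‖ * (a + 2 * (‖t - M.θ₀‖ + ‖t' - M.θ₀‖)) ^ 2 := by
  have hopen : IsOpen (ball M.θ₀ δ ×ˢ ball M.θ₀ δ) := isOpen_ball.prod isOpen_ball
  set u := t - t' with hu
  set v := t' - M.θ₀ with hv
  have htu : t' + u = t := by rw [hu]; abel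
  have hline : ∀ τ ∈ Set.Icc (0 : ℝ) 1, t' + τ • u ∈ ball M.θ₀ δ := fun τ hτ =>
    line_mem_ball ht' (by rw [htu]; exact ht) hτ
  set g : ℝ → ℝ := fun τ => empMean n x (fun y => M.logSub path η y (t' + τ • u) b)
  have hg : ∀ τ ∈ Set.Icc (0 : ℝ) 1,
      HasDerivAt g (∑ i, u i * empMean n x (M.dl path [i] [] (t' + τ • u) b η)) τ := by
    intro τ hτ
    have h1 : ∀ k : Fin n, HasDerivAt (fun τ : ℝ => M.logSub path η (x k) (t' + τ • u) b)
        (∑ i, u i * M.dl path [i] [] (t' + τ • u) b η (x k)) τ := fun k => by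
      have := hasDerivAt_line (f := M.logSub path η (x k)) (t := t') (θ := b) (a := u) (b := 0)
        (τ := τ) (((hsm k).differentiableOn three_ne_zero).differentiableAt
          (hopen.mem_nhds ⟨hline τ hτ, by simpa using hb⟩))
      simp only [smul_zero, add_zero, PiLp.zero_apply, zero_mul, Finset.sum_const_zero] at this
      exact this
    have h2 := (HasDerivAt.fun_sum (u := Finset.univ) fun k _ => h1 k).const_mul (n : ℝ)⁻¹
    refine h2.congr_deriv ?_
    simp only [empMean]
    rw [Finset.sum_comm, Finset.mul_sum]
    refine Finset.sum_congr rfl fun i _ => ?_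
    rw [← Finset.mul_sum]; ring
  -- The quadratic whose derivative along the segment is the main term of the score expansion. The
  -- mean value inequality for `g - q` produces the factor `‖t - t'‖` in the remainder.
  set q : ℝ → ℝ := fun τ => τ * (∑ i, u i * w i) - (τ * bil A u v + τ ^ 2 / 2 * bil A u u)
  have hq : ∀ τ : ℝ, HasDerivAt q (∑ i, u i * (w i - ∑ j, A i j * (v + τ • u) j)) τ := by
    intro τ
    have h1 := ((hasDerivAt_id τ).mul_const (∑ i, u i * w i)).sub
      (((hasDerivAt_id τ).mul_const (bil A u v)).add
        ((((hasDerivAt_id τ).pow 2).div_const 2).mul_const (bil A u u)))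
    refine h1.congr_deriv ?_
    simp only [mul_sub, Finset.sum_sub_distrib]
    change _ = _ - bil A u (v + τ • u)
    rw [bil_add_right, bil_smul_right]
    simp
  have key := norm_image_sub_le_of_norm_deriv_le_segment_01' (f := fun τ => g τ - q τ)
    (C := d * C * ‖u‖ * (a + 2 * (‖t - M.θ₀‖ + ‖v‖)) ^ 2)
    (fun τ hτ => ((hg τ hτ).sub (hq τ)).hasDerivWithinAt) (by
      intro τ hτ
      have hτ' := Set.Ico_subset_Icc_self hτ
      rw [← Finset.sum_sub_distrib, Real.norm_eq_abs]
      have hnorm : ‖t' + τ • u - M.θ₀‖ ≤ ‖t - M.θ₀‖ + ‖v‖ := by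
        have : t' + τ • u - M.θ₀ = τ • (t - M.θ₀) + (1 - τ) • v := by
          rw [hu, hv]; module
        rw [this]
        refine (norm_add_le _ _).trans (add_le_add ?_ ?_)
        · rw [norm_smul, Real.norm_eq_abs, abs_of_nonneg hτ'.1]
          exact mul_le_of_le_one_left (norm_nonneg _) hτ'.2
        · rw [norm_smul, Real.norm_eq_abs, abs_of_nonneg (by linarith [hτ'.2])]
          exact mul_le_of_le_one_left (norm_nonneg _) (by linarith [hτ'.1])
      have hvu : v + τ • u = t' + τ • u - M.θ₀ := by rw [hv]; abel
      calc _ ≤ ∑ i, |u i| * (C * (a + 2 * (‖t - M.θ₀‖ + ‖v‖)) ^ 2) := by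
            refine (Finset.abs_sum_le_sum_abs _ _).trans (Finset.sum_le_sum fun i _ => ?_)
            rw [← mul_sub, abs_mul, hvu]
            refine mul_le_mul_of_nonneg_left ((hexp _ (hline τ hτ') i).trans ?_) (abs_nonneg _)
            have hle : a + ‖t' + τ • u - M.θ₀‖ + ‖b - M.θ₀‖ ≤ a + 2 * (‖t - M.θ₀‖ + ‖v‖) := by
              linarith
            gcongr
        _ ≤ (d * ‖u‖) * (C * (a + 2 * (‖t - M.θ₀‖ + ‖v‖)) ^ 2) := by
            rw [← Finset.sum_mul]
            exact mul_le_mul_of_nonneg_right (sum_abs_coord_le u) (by positivity)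
        _ = _ := by ring)
  have hquad : bil A (t - M.θ₀) (t - M.θ₀) = bil A v v + 2 * bil A u v + bil A u u := by
    have : t - M.θ₀ = v + u := by rw [hu, hv]; abel
    rw [this, bil_add_left, bil_add_right, bil_add_right, bil_comm hA v u]; ring
  simp only [g, q, one_smul, zero_smul, add_zero, htu, Real.norm_eq_abs] at key
  rw [hquad]
  convert key using 2
  ring

variable {Ω : Type*} {X : ℕ → Ω → S}

theorem profLik_eq {n : ℕ} {ω : Ω} {θ : EuclideanSpace ℝ (Fin d)} {η : B} (hη : η ∈ M.H)
    (hmax : ∀ η' ∈ M.H, M.likN X n ω θ η' ≤ M.likN X n ω θ η) :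
    M.profLik X n ω θ = M.likN X n ω θ η := by
  have : Nonempty M.H := ⟨⟨η, hη⟩⟩
  exact le_antisymm (ciSup_le fun η' => hmax η' η'.2)
    (le_ciSup (f := fun η' : M.H => M.likN X n ω θ η')
      ⟨M.likN X n ω θ η, by rintro - ⟨η', rfl⟩; exact hmax η' η'.2⟩ ⟨η, hη⟩)

theorem likN_path_eq {n : ℕ} {ω : Ω} {t θ : EuclideanSpace ℝ (Fin d)} {η : B}
    (hpos : ∀ k : Fin n, 0 < M.sub path η (X k ω) t θ) :
    0 < M.likN X n ω t (path t θ η) ∧ (n : ℝ)⁻¹ * Real.log (M.likN X n ω t (path t θ η))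
      = empMean n (fun k => X k ω) (fun y => M.logSub path η y t θ) := by
  refine ⟨Finset.prod_pos fun k _ => hpos k, ?_⟩
  rw [likN, Real.log_prod (f := fun k : Fin n => M.lik t (path t θ η) (X k ω))
    fun k _ => (hpos k).ne']
  rfl

/-- Quadratic expansion of the profile likelihood around the truth. -/
theorem profLik_expansion {n : ℕ} {ω : Ω} {ηh : EuclideanSpace ℝ (Fin d) → B} {δ₀ δ : ℝ}
    (hreg : M.LocallyRegular path δ₀) (hδ : δ ≤ δ₀)
    (hsm : ∀ k, ∀ η ∈ M.H, η ∈ ball M.η₀ δ₀ →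
      ContDiffOn ℝ 3 (Function.uncurry (M.logSub path η (X k ω))) (ball M.θ₀ δ₀ ×ˢ ball M.θ₀ δ₀))
    (hpos : ∀ k, ∀ p ∈ M.nbhd δ₀, 0 < M.sub path p.2.2 (X k ω) p.1 p.2.1)
    (hmem : ∀ θ ∈ M.Θ, ηh θ ∈ M.H)
    (hmax : ∀ θ ∈ M.Θ, ∀ η ∈ M.H, M.likN X n ω θ η ≤ M.likN X n ω θ (ηh θ))
    (hnear : ∀ θ ∈ ball M.θ₀ δ, ηh θ ∈ ball M.η₀ δ₀)
    {A : Matrix (Fin d) (Fin d) ℝ} (hA : A.IsHermitian) {C a : ℝ} (hC : 0 ≤ C) (ha : 0 ≤ a)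
    {w : EuclideanSpace ℝ (Fin d)}
    (hexp : ∀ b ∈ ball M.θ₀ δ, ∀ s ∈ ball M.θ₀ δ, ∀ i,
      |empMean n (fun k => X k ω) (M.dl path [i] [] s b (ηh b)) - (w i - ∑ j, A i j * (s - M.θ₀) j)|
        ≤ C * (a + ‖s - M.θ₀‖ + ‖b - M.θ₀‖) ^ 2)
    {t t' : EuclideanSpace ℝ (Fin d)} (ht : t ∈ ball M.θ₀ δ) (ht' : t' ∈ ball M.θ₀ δ) :
    0 < M.profLik X n ω t ∧
    |(n : ℝ)⁻¹ * Real.log (M.profLik X n ω t) - (n : ℝ)⁻¹ * Real.log (M.profLik X n ω t')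
      - (∑ i, (t - t') i * w i - (bil A (t - M.θ₀) (t - M.θ₀) - bil A (t' - M.θ₀) (t' - M.θ₀)) / 2)|
      ≤ d * C * ‖t - t'‖ * (a + 2 * (‖t - M.θ₀‖ + ‖t' - M.θ₀‖)) ^ 2 := by
  have hΘ : ∀ s ∈ ball M.θ₀ δ, s ∈ M.Θ := fun s hs => hreg.ball_subset (ball_subset_ball hδ hs)
  have hnb : ∀ s ∈ ball M.θ₀ δ, ∀ b ∈ ball M.θ₀ δ, (s, b, ηh b) ∈ M.nbhd δ₀ := fun s hs b hb =>
    ⟨ball_subset_ball hδ hs, ball_subset_ball hδ hb, hmem b (hΘ b hb), hnear b hb⟩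
  have hlik : ∀ s ∈ ball M.θ₀ δ, ∀ b ∈ ball M.θ₀ δ, 0 < M.likN X n ω s (path s b (ηh b)) ∧
      (n : ℝ)⁻¹ * Real.log (M.likN X n ω s (path s b (ηh b)))
        = empMean n (fun k => X k ω) (fun y => M.logSub path (ηh b) y s b) := fun s hs b hb =>
    likN_path_eq fun k => hpos k _ (hnb s hs b hb)
  have hpl : ∀ s ∈ ball M.θ₀ δ, M.profLik X n ω s = M.likN X n ω s (path s s (ηh s)) :=
    fun s hs => by
      rw [hreg.path_self s (hΘ s hs) _ (hmem s (hΘ s hs))]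
      exact profLik_eq (hmem s (hΘ s hs)) (hmax s (hΘ s hs))
  -- The submodel based at `(b, ηh b)` stays in `H`, so its likelihood at `s` competes in the
  -- supremum that defines `pl_n(s)`.
  have hge : ∀ s ∈ ball M.θ₀ δ, ∀ b ∈ ball M.θ₀ δ,
      empMean n (fun k => X k ω) (fun y => M.logSub path (ηh b) y s b)
        ≤ (n : ℝ)⁻¹ * Real.log (M.profLik X n ω s) := fun s hs b hb => by
    rw [← (hlik s hs b hb).2]
    refine mul_le_mul_of_nonneg_left (Real.log_le_log (hlik s hs b hb).1 ?_) (by positivity)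
    rw [profLik_eq (hmem s (hΘ s hs)) (hmax s (hΘ s hs))]
    exact hmax s (hΘ s hs) _ (hreg.path_mem _ (hnb s hs b hb))
  have heq : ∀ s ∈ ball M.θ₀ δ, (n : ℝ)⁻¹ * Real.log (M.profLik X n ω s)
      = empMean n (fun k => X k ω) (fun y => M.logSub path (ηh s) y s s) := fun s hs => by
    rw [hpl s hs, (hlik s hs s hs).2]
  refine ⟨by rw [hpl t ht]; exact (hlik t ht t ht).1, ?_⟩
  have hb : ∀ b ∈ ball M.θ₀ δ, ‖b - M.θ₀‖ ≤ ‖t - M.θ₀‖ + ‖t' - M.θ₀‖ → _ := fun b hb hbb =>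
    empMean_logSub_expansion (x := fun k : Fin n => X k ω) (fun k => (hsm k (ηh b)
      (hmem b (hΘ b hb)) (hnear b hb)).mono (Set.prod_mono (ball_subset_ball hδ)
        (ball_subset_ball hδ))) hA hC ha hb ht ht' hbb (hexp b hb)
  -- The submodel based at `t` attains `pl_n(t)` and stays below `pl_n(t')`, which bounds the log
  -- ratio from above; the one based at `t'` bounds it from below.
  have h1 := hb t ht (by linarith [norm_nonneg (t' - M.θ₀)])
  have h2 := hb t' ht' (by linarith [norm_nonneg (t - M.θ₀)])
  have h3 := hge t' ht' t ht
  have h4 := hge t ht t' ht'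
  have h5 := heq t ht
  have h6 := heq t' ht'
  rw [abs_le] at h1 h2 ⊢
  constructor <;> linarith [h1.1, h1.2, h2.1, h2.2]

end SemiModel

/-! ### Events of probability close to one -/

section Tightness

variable {Ω : Type*} [MeasurableSpace Ω]

/-- The events `A K n` have (outer) probability close to one for `K` and `n` large. -/
def Tight (Q : Measure Ω) (A : ℝ → ℕ → Ω → Prop) : Prop :=
  ∀ ε : ℝ≥0∞, 0 < ε → ∃ K₀ : ℝ, ∀ K ≥ K₀, ∀ᶠ n in atTop, Q {ω | ¬ A K n ω} ≤ ε

variable {Q : Measure Ω} {A A' : ℝ → ℕ → Ω → Prop}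

theorem Tight.and (h : Tight Q A) (h' : Tight Q A') :
    Tight Q (fun K n ω => A K n ω ∧ A' K n ω) := by
  intro ε hε
  obtain ⟨K, hK⟩ := h (ε / 2) (ENNReal.half_pos hε.ne')
  obtain ⟨K', hK'⟩ := h' (ε / 2) (ENNReal.half_pos hε.ne')
  refine ⟨max K K', fun L hL => ?_⟩
  filter_upwards [hK L ((le_max_left _ _).trans hL), hK' L ((le_max_right _ _).trans hL)] with n h1 h2
  calc Q {ω | ¬ (A L n ω ∧ A' L n ω)} ≤ Q ({ω | ¬ A L n ω} ∪ {ω | ¬ A' L n ω}) := by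
        refine measure_mono fun ω hω => ?_
        by_cases hA : A L n ω
        · exact Or.inr fun hA' => hω ⟨hA, hA'⟩
        · exact Or.inl hA
    _ ≤ ε / 2 + ε / 2 := (measure_union_le _ _).trans (add_le_add h1 h2)
    _ = ε := ENNReal.add_halves ε

theorem Tight.of_ae {A : ℕ → Ω → Prop} (h : ∀ n, ∀ᵐ ω ∂Q, A n ω) :
    Tight Q (fun _ n ω => A n ω) := fun ε _ =>
  ⟨0, fun _ _ => Eventually.of_forall fun n => by
    have : Q {ω | ¬ A n ω} = 0 := ae_iff.mp (h n)
    rw [this]; exact zero_le⟩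

theorem Tight.forall {ι : Type*} [Finite ι] {A : ι → ℝ → ℕ → Ω → Prop} (h : ∀ i, Tight Q (A i)) :
    Tight Q (fun K n ω => ∀ i, A i K n ω) := by
  classical
  cases nonempty_fintype ι
  have key : ∀ s : Finset ι, Tight Q (fun K n ω => ∀ i ∈ s, A i K n ω) := by
    intro s
    induction s using Finset.induction_on with
    | empty =>
      have := Tight.of_ae (Q := Q) (A := fun _ _ => True) fun n => ae_of_all _ fun _ => trivial
      simpa using this
    | insert i s _ ih =>
      have := (h i).and ih
      simpa only [Finset.forall_mem_insert] using this
  simpa using key Finset.univ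

theorem Tight.of_exists (hmono : ∀ K K' n ω, 0 < K → K ≤ K' → A K n ω → A K' n ω)
    (h : ∀ ε : ℝ≥0∞, 0 < ε → ∃ K, 0 < K ∧ ∀ᶠ n in atTop, Q {ω | ¬ A K n ω} ≤ ε) : Tight Q A := by
  intro ε hε
  obtain ⟨K, hK0, hK⟩ := h ε hε
  refine ⟨K, fun L hL => ?_⟩
  filter_upwards [hK] with n hn
  exact (measure_mono (Set.ofPred_subset_ofPred.mpr
    fun ω hω hA => hω (hmono K L n ω hK0 hL hA))).trans hn

/-- Transfers a deterministic implication that holds for large `n`, at the price of a new constant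
`φ K`. -/
theorem Tight.map {φ : ℝ → ℝ} (h : Tight Q A)
    (hmono : ∀ K K' n ω, 0 < K → K ≤ K' → A' K n ω → A' K' n ω)
    (himp : ∀ K, 0 < K → 0 < φ K ∧ ∀ᶠ n in atTop, ∀ ω, A K n ω → A' (φ K) n ω) : Tight Q A' := by
  refine Tight.of_exists hmono fun ε hε => ?_
  obtain ⟨K, hK⟩ := h ε hε
  have hpos : 0 < max K 1 := by positivity
  refine ⟨φ (max K 1), (himp _ hpos).1, ?_⟩
  filter_upwards [hK _ (le_max_left _ _), (himp _ hpos).2] with n h1 h2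
  exact (measure_mono (Set.ofPred_subset_ofPred.mpr fun ω hω hA => hω (h2 ω hA))).trans h1

/-- A single parameter `K` plays both the constant of the bound and the inverse radius of the
neighborhood, so that the events grow with `K`. -/
theorem Tight.of_consistent {E : Type*} [PseudoMetricSpace E] {Θ : Set E} {θ₀ : E}
    (hθ₀ : θ₀ ∈ Θ) {T a : ℕ → Ω → E → ℝ} (ha : ∀ n ω θ, 0 ≤ a n ω θ)
    (h : ∀ θt : ℕ → Ω → E, (∀ n ω, θt n ω ∈ Θ) → TendstoInMeasure Q θt atTop (fun _ => θ₀) →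
      IsBigOP Q (fun n ω => T n ω (θt n ω)) (fun n ω => a n ω (θt n ω))) :
    Tight Q (fun K n ω => ∀ θ ∈ Θ, dist θ θ₀ < 1 / K → |T n ω θ| ≤ K * a n ω θ) := by
  refine Tight.of_exists ?_ fun ε hε => ?_
  · intro K K' n ω hK hKK' hA θ hθ hd
    refine (hA θ hθ (hd.trans_le ?_)).trans (mul_le_mul_of_nonneg_right hKK' (ha _ _ _))
    exact one_div_le_one_div_of_le hK hKK'
  · obtain ⟨K, hK, δ, hδ, hev⟩ := exists_uniform_bound_of_consistent hθ₀ ha h hε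
    refine ⟨max K (1 / δ), by positivity, ?_⟩
    filter_upwards [hev] with n hn
    refine (measure_mono ?_).trans hn
    intro ω hω
    simp only [Set.mem_ofPred_eq] at hω ⊢
    push Not at hω
    obtain ⟨θ, hθ, hd, hlt⟩ := hω
    refine ⟨θ, hθ, hd.trans_le ?_, lt_of_le_of_lt ?_ hlt⟩
    · rw [one_div_le (by positivity) hδ]; exact le_max_right _ _
    · exact mul_le_mul_of_nonneg_right (le_max_left _ _) (ha _ _ _)

end Tightness

/-! ### Rates -/

theorem norm_le_sum_abs {d : ℕ} (v : EuclideanSpace ℝ (Fin d)) : ‖v‖ ≤ ∑ i, |v i| := by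
  have hv : v = ∑ i, v i • EuclideanSpace.single i (1 : ℝ) := by
    ext j; simp [Finset.sum_apply, Pi.single_apply]
  conv_lhs => rw [hv]
  refine (norm_sum_le _ _).trans (Finset.sum_le_sum fun i _ => ?_)
  rw [norm_smul]; simp

theorem rpow_neg_half (n : ℕ) : (n : ℝ) ^ (-(1 / 2) : ℝ) = (Real.sqrt n)⁻¹ := by
  rw [Real.rpow_neg n.cast_nonneg, Real.sqrt_eq_rpow]

theorem rateM_eq (r : ℝ) {n : ℕ} (hn : 0 < n) :
    rateM r n = (Real.sqrt n)⁻¹ + ((n : ℝ) ^ (-r)) ^ 2 * Real.sqrt n := by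
  have hn' : (0 : ℝ) < n := by exact_mod_cast hn
  rw [rateM, rpow_neg_half, Real.sqrt_eq_rpow, ← Real.rpow_natCast, ← Real.rpow_mul hn'.le,
    ← Real.rpow_add hn']
  congr 2
  push_cast; ring

theorem rpow_half_sub (r : ℝ) {n : ℕ} (hn : 0 < n) :
    (n : ℝ) ^ (1 / 2 - r) = Real.sqrt n * (n : ℝ) ^ (-r) := by
  have hn' : (0 : ℝ) < n := by exact_mod_cast hn
  rw [Real.sqrt_eq_rpow, ← Real.rpow_add hn', sub_eq_add_neg]

/-- The rate of the linear term in the expansions, `n^{-1/2} + n^{-r}`. -/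
noncomputable def rateA (r : ℝ) (n : ℕ) : ℝ := (Real.sqrt n)⁻¹ + (n : ℝ) ^ (-r)

theorem rateA_nonneg (r : ℝ) (n : ℕ) : 0 ≤ rateA r n := by unfold rateA; positivity

theorem rateM_nonneg (r : ℝ) (n : ℕ) : 0 ≤ rateM r n := by unfold rateM; positivity

theorem tendsto_rpow_neg_nat {r : ℝ} (hr : 0 < r) :
    Tendsto (fun n : ℕ => (n : ℝ) ^ (-r)) atTop (𝓝 0) :=
  (tendsto_rpow_neg_atTop hr).comp tendsto_natCast_atTop_atTop

theorem tendsto_inv_sqrt_nat : Tendsto (fun n : ℕ => (Real.sqrt n)⁻¹) atTop (𝓝 0) := by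
  simpa only [rpow_neg_half] using tendsto_rpow_neg_nat (r := 1 / 2) (by norm_num)

theorem tendsto_rateA {r : ℝ} (hr : 0 < r) : Tendsto (rateA r) atTop (𝓝 0) := by
  simpa only [add_zero] using! tendsto_inv_sqrt_nat.add (tendsto_rpow_neg_nat hr)

theorem tendsto_rateM {r : ℝ} (hr : 1 / 4 < r) : Tendsto (rateM r) atTop (𝓝 0) := by
  have h := (tendsto_rpow_neg_nat (r := 1 / 2) (by norm_num)).add
    (tendsto_rpow_neg_nat (r := 2 * r - 1 / 2) (by linarith))
  rw [add_zero] at h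
  refine h.congr fun n => ?_
  rw [rateM]
  congr 2
  ring

/-- With `x = n^{-1/2}` and `b = n^{-r}`, the product `n^{-1/2} M_n` is exactly `x² + b²`, while the
left side is `(x + b)²`. -/
theorem rateA_sq_le (r : ℝ) {n : ℕ} (hn : 0 < n) :
    rateA r n ^ 2 ≤ 2 * ((Real.sqrt n)⁻¹ * rateM r n) := by
  have hs : 0 < Real.sqrt n := Real.sqrt_pos.mpr (by exact_mod_cast hn)
  rw [rateM_eq r hn, rateA, mul_add, mul_comm (((n : ℝ) ^ (-r)) ^ 2), inv_mul_cancel_left₀ hs.ne']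
  nlinarith [sq_nonneg ((Real.sqrt n)⁻¹ - (n : ℝ) ^ (-r))]

/-- After division by `√n` the assumed modulus of the empirical process fits into a perfect square,
because `max(√n n^{-r}, 1) ≤ √n a` and `n^{-1/2} M_n ≤ a²`. -/
theorem inv_sqrt_mul_modulus_le (r : ℝ) {n : ℕ} (hn : 0 < n) {s : ℝ} (hs0 : 0 ≤ s) :
    (Real.sqrt n)⁻¹ * (rateM r n + max ((n : ℝ) ^ (1 / 2 - r)) 1 * s) ≤ (rateA r n + s) ^ 2 := by
  have hs : 0 < Real.sqrt n := Real.sqrt_pos.mpr (by exact_mod_cast hn)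
  have hb : 0 ≤ (n : ℝ) ^ (-r) := by positivity
  have hmax : max ((n : ℝ) ^ (1 / 2 - r)) 1 ≤ Real.sqrt n * rateA r n := by
    rw [rpow_half_sub r hn, rateA, mul_add, mul_inv_cancel₀ hs.ne']
    exact max_le (by linarith) (by linarith [mul_nonneg hs.le hb])
  have h1 : (Real.sqrt n)⁻¹ * rateM r n ≤ rateA r n ^ 2 := by
    rw [rateM_eq r hn, rateA, mul_add, mul_comm (((n : ℝ) ^ (-r)) ^ 2),
      inv_mul_cancel_left₀ hs.ne']
    nlinarith [mul_nonneg (inv_nonneg.mpr hs.le) hb]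
  have h2 : (Real.sqrt n)⁻¹ * (max ((n : ℝ) ^ (1 / 2 - r)) 1 * s) ≤ rateA r n * s := by
    rw [← mul_assoc]
    refine mul_le_mul_of_nonneg_right ?_ hs0
    rw [inv_mul_le_iff₀ hs]
    exact hmax
  rw [mul_add]
  nlinarith [mul_nonneg (rateA_nonneg r n) hs0, sq_nonneg s]

/-! ### The profile likelihood expansion on events of probability close to one -/

namespace SemiModel

section Expansion

variable {d : ℕ} {S : Type*} [MeasurableSpace S] {B : Type*} [SeminormedAddCommGroup B]
  {M : SemiModel d S B} {Ω : Type*} {X : ℕ → Ω → S} {r : ℝ}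

/-- The asymptotic expansion of the profile likelihood near the truth. -/
def ProfileExpansion (M : SemiModel d S B) (X : ℕ → Ω → S) (A : Matrix (Fin d) (Fin d) ℝ) (r : ℝ)
    (w : ℕ → Ω → EuclideanSpace ℝ (Fin d)) (K : ℝ) (n : ℕ) (ω : Ω) : Prop :=
  ‖w n ω‖ ≤ K * (Real.sqrt n)⁻¹ ∧ ∀ t ∈ ball M.θ₀ (1 / K), ∀ t' ∈ ball M.θ₀ (1 / K),
    0 < M.profLik X n ω t ∧
    |(n : ℝ)⁻¹ * Real.log (M.profLik X n ω t) - (n : ℝ)⁻¹ * Real.log (M.profLik X n ω t')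
      - (∑ i, (t - t') i * w n ω i
        - (bil A (t - M.θ₀) (t - M.θ₀) - bil A (t' - M.θ₀) (t' - M.θ₀)) / 2)|
      ≤ K * ‖t - t'‖ * (rateA r n + 2 * (‖t - M.θ₀‖ + ‖t' - M.θ₀‖)) ^ 2

theorem ProfileExpansion.mono {A : Matrix (Fin d) (Fin d) ℝ}
    {w : ℕ → Ω → EuclideanSpace ℝ (Fin d)} {K K' : ℝ} {n : ℕ} {ω : Ω} (hK : 0 < K) (hKK' : K ≤ K')
    (h : M.ProfileExpansion X A r w K n ω) : M.ProfileExpansion X A r w K' n ω := by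
  have hb : ball M.θ₀ (1 / K') ⊆ ball M.θ₀ (1 / K) :=
    ball_subset_ball (one_div_le_one_div_of_le hK hKK')
  refine ⟨h.1.trans (by gcongr), fun t ht t' ht' => ⟨(h.2 t (hb ht) t' (hb ht')).1,
    (h.2 t (hb ht) t' (hb ht')).2.trans ?_⟩⟩
  gcongr

end Expansion

variable {d : ℕ} {S : Type*} [MeasurableSpace S] {B : Type*} [SeminormedAddCommGroup B]
  {M : SemiModel d S B} {path : EuclideanSpace ℝ (Fin d) → EuclideanSpace ℝ (Fin d) → B → B}
  {N : Set (ℝ → B)} {hS : ∀ i, MemLp (M.score i) 2 M.P}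
  {Ω : Type*} [MeasurableSpace Ω] {X : ℕ → Ω → S} {Q : Measure Ω}
  {θhat : ℕ → Ω → EuclideanSpace ℝ (Fin d)}
  {ηhat : ℕ → Ω → EuclideanSpace ℝ (Fin d) → B} {r : ℝ}

/-- There are finitely many third-order derivatives, so the absolute values of their envelopes can
be summed. Stating the bound for all small `δ` lets this radius be intersected with those of the
other conditions. -/
theorem Assumptions.exists_envelope (hass : M.Assumptions X path N hS Q ηhat r) :
    ∃ F : S → ℝ, Integrable F M.P ∧ ∀ᶠ δ in 𝓝[>] (0 : ℝ), ∀ᵐ x ∂M.P, ∀ p ∈ M.nbhd δ, ∀ i j l,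
      |M.dl path [i, j, l] [] p.1 p.2.1 p.2.2 x| ≤ F x ∧
      |M.dl path [i, j] [l] p.1 p.2.1 p.2.2 x| ≤ F x ∧
      |M.dl path [i] [j, l] p.1 p.2.1 p.2.2 x| ≤ F x := by
  have h1 := fun i j l : Fin d => hass.envelope [i, j, l] [] (by simp)
  have h2 := fun i j l : Fin d => hass.envelope [i, j] [l] (by simp)
  have h3 := fun i j l : Fin d => hass.envelope [i] [j, l] (by simp)
  choose δ₁ hδ₁ F₁ hF₁ hb₁ using h1
  choose δ₂ hδ₂ F₂ hF₂ hb₂ using h2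
  choose δ₃ hδ₃ F₃ hF₃ hb₃ using h3
  refine ⟨fun x => ∑ i, ∑ j, ∑ l, (|F₁ i j l x| + |F₂ i j l x| + |F₃ i j l x|), ?_, ?_⟩
  · exact integrable_finsetSum _ fun i _ => integrable_finsetSum _ fun j _ =>
      integrable_finsetSum _ fun l _ => ((hF₁ i j l).abs.add (hF₂ i j l).abs).add (hF₃ i j l).abs
  have hev : ∀ᶠ δ in 𝓝[>] (0 : ℝ), ∀ i j l, δ ≤ δ₁ i j l ∧ δ ≤ δ₂ i j l ∧ δ ≤ δ₃ i j l := by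
    simp only [eventually_all]
    intro i j l
    have : ∀ c : ℝ, 0 < c → ∀ᶠ δ in 𝓝[>] (0 : ℝ), δ ≤ c := fun c hc =>
      nhdsWithin_le_nhds (Iic_mem_nhds hc)
    filter_upwards [this _ (hδ₁ i j l), this _ (hδ₂ i j l), this _ (hδ₃ i j l)] with δ a b c
      using ⟨a, b, c⟩
  filter_upwards [hev] with δ hδ
  have b1 : ∀ᵐ x ∂M.P, ∀ i j l, ∀ p ∈ M.nbhd (δ₁ i j l),
      |M.dl path [i, j, l] [] p.1 p.2.1 p.2.2 x| ≤ F₁ i j l x := by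
    simp only [ae_all_iff (ι := Fin d)]; exact hb₁
  have b2 : ∀ᵐ x ∂M.P, ∀ i j l, ∀ p ∈ M.nbhd (δ₂ i j l),
      |M.dl path [i, j] [l] p.1 p.2.1 p.2.2 x| ≤ F₂ i j l x := by
    simp only [ae_all_iff (ι := Fin d)]; exact hb₂
  have b3 : ∀ᵐ x ∂M.P, ∀ i j l, ∀ p ∈ M.nbhd (δ₃ i j l),
      |M.dl path [i] [j, l] p.1 p.2.1 p.2.2 x| ≤ F₃ i j l x := by
    simp only [ae_all_iff (ι := Fin d)]; exact hb₃
  filter_upwards [b1, b2, b3] with x h1 h2 h3 p hp i j l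
  have hle : |F₁ i j l x| + |F₂ i j l x| + |F₃ i j l x|
      ≤ ∑ i, ∑ j, ∑ l, (|F₁ i j l x| + |F₂ i j l x| + |F₃ i j l x|) := by
    refine le_trans ?_ (Finset.single_le_sum (f := fun i => ∑ j, ∑ l,
      (|F₁ i j l x| + |F₂ i j l x| + |F₃ i j l x|)) (fun i _ => by positivity) (Finset.mem_univ i))
    refine le_trans ?_ (Finset.single_le_sum (f := fun j => ∑ l,
      (|F₁ i j l x| + |F₂ i j l x| + |F₃ i j l x|)) (fun i _ => by positivity) (Finset.mem_univ j))
    exact Finset.single_le_sum (f := fun l =>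
      (|F₁ i j l x| + |F₂ i j l x| + |F₃ i j l x|)) (fun i _ => by positivity) (Finset.mem_univ l)
  have a1 := abs_nonneg (F₁ i j l x)
  have a2 := abs_nonneg (F₂ i j l x)
  have a3 := abs_nonneg (F₃ i j l x)
  refine ⟨?_, ?_, ?_⟩
  · have := h1 i j l p (M.nbhd_mono (hδ i j l).1 hp)
    linarith [le_abs_self (F₁ i j l x)]
  · have := h2 i j l p (M.nbhd_mono (hδ i j l).2.1 hp)
    linarith [le_abs_self (F₂ i j l x)]
  · have := h3 i j l p (M.nbhd_mono (hδ i j l).2.2 hp)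
    linarith [le_abs_self (F₃ i j l x)]

theorem tight_empProc_dlClass [IsProbabilityMeasure Q] (hX : ∀ i, Measurable (X i))
    (hindep : iIndepFun X Q) (hlaw : ∀ i, Q.map (X i) = M.P) {I J : List (Fin d)} {δ δ' : ℝ}
    (hδ : δ ≤ δ') (hF : IsDonsker M.P (M.dlClass path I J δ')) :
    Tight Q (fun K n ω => ∀ f ∈ M.dlClass path I J δ,
      |empProc M.P n (fun k => X k ω) f| ≤ K) := by
  have := M.isProbabilityMeasure_P
  refine Tight.of_exists (fun K K' n ω _ hKK' h f hf => (h f hf).trans hKK') fun ε hε => ?_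
  obtain ⟨K, hK, hev⟩ := hF.exists_bound hε
  refine ⟨K, hK, ?_⟩
  filter_upwards [hev] with n hn
  refine le_trans (measure_mono fun ω hω => ?_)
    ((measure_preimage_sample_le hX hindep hlaw n _).trans hn)
  simp only [Set.mem_ofPred_eq] at hω ⊢
  push Not at hω
  obtain ⟨f, hf, hlt⟩ := hω
  exact ⟨f, Set.image_mono (M.nbhd_mono hδ) hf, hlt⟩

/-- The smoothness conditions compare integrals at `η` with integrals at `η₀`; the information
identities supply the values at `η₀`, namely `-A`, `0` and `0`. -/
theorem Assumptions.exists_smooth_constant (hass : M.Assumptions X path N hS Q ηhat r) :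
    ∃ C : ℝ, 0 ≤ C ∧ ∀ᶠ δ in 𝓝[>] (0 : ℝ), ∀ η ∈ M.H, η ∈ ball M.η₀ δ →
      (∀ i j, |∫ y, M.dl path [i, j] [] M.θ₀ M.θ₀ η y ∂M.P + M.effInfo N hS i j| ≤ C * ‖η - M.η₀‖) ∧
      (∀ i j, |∫ y, M.dl path [i] [j] M.θ₀ M.θ₀ η y ∂M.P| ≤ C * ‖η - M.η₀‖) ∧
      ∀ i, |∫ y, (M.dl path [i] [] M.θ₀ M.θ₀ η y - M.dl path [i] [] M.θ₀ M.θ₀ M.η₀ y) ∂M.P|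
        ≤ C * ‖η - M.η₀‖ ^ 2 := by
  obtain ⟨δ₂, hδ₂, C₂, hC₂⟩ := hass.smooth_tt
  obtain ⟨δ₃, hδ₃, C₃, hC₃⟩ := hass.smooth_tθ
  obtain ⟨δ₄, hδ₄, C₄, hC₄⟩ := hass.noBias
  have hsmall : ∀ c : ℝ, 0 < c → ∀ᶠ δ in 𝓝[>] (0 : ℝ), δ ≤ c := fun c hc =>
    nhdsWithin_le_nhds (Iic_mem_nhds hc)
  have := M.isProbabilityMeasure_P
  refine ⟨max 0 (max C₂ (max C₃ C₄)), le_max_left _ _, ?_⟩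
  have c2 : C₂ ≤ max 0 (max C₂ (max C₃ C₄)) := (le_max_left _ _).trans (le_max_right _ _)
  have c3 : C₃ ≤ max 0 (max C₂ (max C₃ C₄)) :=
    ((le_max_left _ _).trans (le_max_right _ _)).trans (le_max_right _ _)
  have c4 : C₄ ≤ max 0 (max C₂ (max C₃ C₄)) :=
    ((le_max_right _ _).trans (le_max_right _ _)).trans (le_max_right _ _)
  filter_upwards [hsmall _ hδ₂, hsmall _ hδ₃, hsmall _ hδ₄] with δ h2 h3 h4 η hη hηb
  refine ⟨fun i j => ?_, fun i j => ?_, fun i => ?_⟩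
  · have h := hC₂ η hη (ball_subset_ball h2 hηb) i j
    rw [hass.integral_dl_tt, sub_neg_eq_add] at h
    exact h.trans (mul_le_mul_of_nonneg_right c2 (norm_nonneg _))
  · have h := hC₃ η hη (ball_subset_ball h3 hηb) i j
    rw [hass.integral_dl_tθ, sub_zero] at h
    exact h.trans (mul_le_mul_of_nonneg_right c3 (norm_nonneg _))
  · have hint : ∫ x, (M.dl path [i] [] M.θ₀ M.θ₀ η x - M.dl path [i] [] M.θ₀ M.θ₀ M.η₀ x) ∂M.P
        = ∫ x, M.dl path [i] [] M.θ₀ M.θ₀ η x ∂M.P := by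
      have hi0 := (hass.memLp_dl i).integrable one_le_two
      by_cases hi : Integrable (M.dl path [i] [] M.θ₀ M.θ₀ η) M.P
      · rw [integral_sub hi hi0, hass.integral_dl_eq_zero i, sub_zero]
      -- If the score at `η` is not integrable, neither is its difference with the integrable score
      -- at `η₀`, and both integrals are `0` by convention.
      · rw [integral_undef hi, integral_undef]
        intro hcon
        refine hi ((hcon.add hi0).congr (ae_of_all _ fun x => ?_))
        simp
    rw [hint]
    exact (hC₄ η hη (ball_subset_ball h4 hηb) i).trans
      (mul_le_mul_of_nonneg_right c4 (sq_nonneg _))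

/-- The expansion of the empirical score, from bounds on the empirical processes. -/
theorem empMean_score_expansion_of_empProc {n : ℕ} (hn : 0 < n) {x : Fin n → S} {δ C K : ℝ}
    (hC : 0 ≤ C) (hK : 0 < K) {η : B} (hη : η ∈ M.H) (hηb : η ∈ ball M.η₀ δ)
    {s b : EuclideanSpace ℝ (Fin d)} (hs : s ∈ ball M.θ₀ δ) (hb : b ∈ ball M.θ₀ δ)
    (hηr : ‖η - M.η₀‖ ≤ K * (‖b - M.θ₀‖ + (n : ℝ) ^ (-r)))
    (hsm : ∀ k, ContDiffOn ℝ 3 (Function.uncurry (M.logSub path η (x k)))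
      (ball M.θ₀ δ ×ˢ ball M.θ₀ δ))
    {F : S → ℝ} (hF : ∀ k, ∀ p ∈ M.nbhd δ, ∀ i j l,
      |M.dl path [i, j, l] [] p.1 p.2.1 p.2.2 (x k)| ≤ F (x k) ∧
      |M.dl path [i, j] [l] p.1 p.2.1 p.2.2 (x k)| ≤ F (x k) ∧
      |M.dl path [i] [j, l] p.1 p.2.1 p.2.2 (x k)| ≤ F (x k))
    (hFK : empMean n x F ≤ K) {A : Matrix (Fin d) (Fin d) ℝ} (hA : A.IsHermitian) {w : ℝ} {i : Fin d}
    (hItt : ∀ j, |∫ y, M.dl path [j, i] [] M.θ₀ M.θ₀ η y ∂M.P + A j i| ≤ C * ‖η - M.η₀‖)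
    (hItθ : ∀ j, |∫ y, M.dl path [i] [j] M.θ₀ M.θ₀ η y ∂M.P| ≤ C * ‖η - M.η₀‖)
    (hIt : |∫ y, (M.dl path [i] [] M.θ₀ M.θ₀ η y - M.dl path [i] [] M.θ₀ M.θ₀ M.η₀ y) ∂M.P|
      ≤ C * ‖η - M.η₀‖ ^ 2)
    (hw : empMean n x (M.dl path [i] [] M.θ₀ M.θ₀ M.η₀) = w)
    (hGtt : ∀ j, |empProc M.P n x (M.dl path [j, i] [] M.θ₀ M.θ₀ η)| ≤ K)
    (hGtθ : ∀ j, |empProc M.P n x (M.dl path [i] [j] M.θ₀ M.θ₀ η)| ≤ K)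
    (hGt : |empProc M.P n x (fun y => M.dl path [i] [] M.θ₀ M.θ₀ η y
      - M.dl path [i] [] M.θ₀ M.θ₀ M.η₀ y)|
        ≤ K * (rateM r n + max ((n : ℝ) ^ (1 / 2 - r)) 1 * ‖b - M.θ₀‖)) :
    |empMean n x (M.dl path [i] [] s b η) - (w - ∑ j, A i j * (s - M.θ₀) j)|
      ≤ K * (1 + C) * (1 + K) * (d + 1) ^ 2
        * (rateA r n + ‖s - M.θ₀‖ + ‖b - M.θ₀‖) ^ 2 := by
  have hsq : 0 < Real.sqrt n := Real.sqrt_pos.mpr (by exact_mod_cast hn)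
  have ha := rateA_nonneg r n
  have hb0 : 0 ≤ (n : ℝ) ^ (-r) := by positivity
  have hv := norm_nonneg (b - M.θ₀)
  have he : (Real.sqrt n)⁻¹ ≤ rateA r n := by rw [rateA]; linarith
  have hbA : (n : ℝ) ^ (-r) ≤ rateA r n := by
    rw [rateA]; linarith [inv_nonneg.mpr hsq.le]
  set c := rateA r n + ‖b - M.θ₀‖ with hc
  have hc0 : 0 ≤ c := by positivity
  have hac : rateA r n ≤ c := by linarith
  have hη3 : ‖η - M.η₀‖ ≤ K * c := hηr.trans (mul_le_mul_of_nonneg_left (by linarith) hK.le)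
  -- A bounded empirical process means a deviation of the mean of order `n^{-1/2}`, which `a`
  -- dominates.
  have hproc : ∀ f : S → ℝ, |empProc M.P n x f| ≤ K →
      |empMean n x f - ∫ y, f y ∂M.P| ≤ K * c := by
    intro f hf
    rw [empProc, abs_mul, abs_of_pos hsq, ← le_div_iff₀' hsq, div_eq_mul_inv] at hf
    exact hf.trans (mul_le_mul_of_nonneg_left (he.trans hac) hK.le)
  -- One constant above the three that occur: `K` for the envelope, `K(1 + C)` for the second
  -- derivatives and `K(1 + CK)` for the score at `(θ₀, θ₀, η)`.
  set C₁ := K * (1 + C) * (1 + K) with hC₁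
  have hC₁0 : 0 ≤ C₁ := by positivity
  have hs1 : K * c + C * (K * c) ≤ C₁ * c := by
    have : K * c + C * (K * c) = K * (1 + C) * c := by ring
    rw [this]
    refine mul_le_mul_of_nonneg_right ?_ hc0
    exact le_mul_of_one_le_right (by positivity) (by linarith)
  have hη4 : C * ‖η - M.η₀‖ ≤ C * (K * c) := mul_le_mul_of_nonneg_left hη3 hC
  refine empMean_score_expansion hη hηb hsm hF hA hC₁0 ha (hFK.trans ?_) hs hb (fun j => ?_)
    (fun j => ?_) ?_
  · rw [hC₁, mul_assoc]
    exact le_mul_of_one_le_right hK.le (by nlinarith)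
  · have h1 := hproc _ (hGtt j)
    have h2 := (hItt j).trans hη4
    have h3 := abs_add_le (empMean n x (M.dl path [j, i] [] M.θ₀ M.θ₀ η)
        - ∫ y, M.dl path [j, i] [] M.θ₀ M.θ₀ η y ∂M.P)
      (∫ y, M.dl path [j, i] [] M.θ₀ M.θ₀ η y ∂M.P + A j i)
    rw [← add_assoc, sub_add_cancel] at h3
    linarith
  · have h1 := hproc _ (hGtθ j)
    have h2 := (hItθ j).trans hη4
    have h3 := abs_add_le (empMean n x (M.dl path [i] [j] M.θ₀ M.θ₀ η)
        - ∫ y, M.dl path [i] [j] M.θ₀ M.θ₀ η y ∂M.P) (∫ y, M.dl path [i] [j] M.θ₀ M.θ₀ η y ∂M.P)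
    rw [sub_add_cancel] at h3
    linarith
  · rw [empProc, empMean_sub, hw, abs_mul, abs_of_pos hsq, ← le_div_iff₀' hsq,
      div_eq_inv_mul, mul_left_comm] at hGt
    have h1 := hGt.trans (mul_le_mul_of_nonneg_left (inv_sqrt_mul_modulus_le r hn hv) hK.le)
    set J := ∫ y, (M.dl path [i] [] M.θ₀ M.θ₀ η y - M.dl path [i] [] M.θ₀ M.θ₀ M.η₀ y) ∂M.P
    have h2 : C * ‖η - M.η₀‖ ^ 2 ≤ C * (K * c) ^ 2 :=
      mul_le_mul_of_nonneg_left (pow_le_pow_left₀ (norm_nonneg _) hη3 2) hC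
    have h3 := abs_add_le (empMean n x (M.dl path [i] [] M.θ₀ M.θ₀ η) - w - J) J
    rw [sub_add_cancel] at h3
    have h4 : K * c ^ 2 + C * (K * c) ^ 2 = K * (1 + C * K) * c ^ 2 := by ring
    have h5 : K * (1 + C * K) * c ^ 2 ≤ C₁ * c ^ 2 := by
      refine mul_le_mul_of_nonneg_right ?_ (sq_nonneg _)
      rw [hC₁, mul_assoc]
      exact mul_le_mul_of_nonneg_left (by nlinarith) hK.le
    linarith

/-- All the randomness is put into finitely many tight events; on their intersection the expansion
is deterministic. The vector `w` is the empirical mean of the efficient score. -/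
theorem Assumptions.tight_profileExpansion [IsProbabilityMeasure Q] (hX : ∀ i, Measurable (X i))
    (hindep : iIndepFun X Q) (hlaw : ∀ i, Q.map (X i) = M.P)
    (hmle : M.IsMLE X Q θhat ηhat) (hr : 0 < r) (hrate : M.NuisanceRate Q ηhat r)
    (hass : M.Assumptions X path N hS Q ηhat r) :
    ∃ w : ℕ → Ω → EuclideanSpace ℝ (Fin d),
      Tight Q (M.ProfileExpansion X (M.effInfo N hS) r w) := by
  have := M.isProbabilityMeasure_P
  set A := M.effInfo N hS with hA
  obtain ⟨F, hF, hFev⟩ := hass.exists_envelope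
  obtain ⟨C₀, hC₀0, hCev⟩ := hass.exists_smooth_constant
  obtain ⟨δ₁, hreg₁⟩ := hass.exists_locallyRegular
  obtain ⟨δ₅, hδ₅, hD₅⟩ := hass.donsker_tt
  obtain ⟨δ₆, hδ₆, hD₆⟩ := hass.donsker_tθ
  have hsmall : ∀ c : ℝ, 0 < c → ∀ᶠ δ in 𝓝[>] (0 : ℝ), δ ≤ c := fun c hc =>
    nhdsWithin_le_nhds (Iic_mem_nhds hc)
  obtain ⟨δ₀, hFδ, hCδ, h01, h05, h06, hδ₀⟩ := (hFev.and (hCev.and ((hsmall _ hreg₁.pos).and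
    ((hsmall _ hδ₅).and ((hsmall _ hδ₆).and self_mem_nhdsWithin))))).exists
  have hδ₀' : 0 < δ₀ := hδ₀
  have hreg := hreg₁.mono hδ₀' h01
  have hItt := fun η h h' => (hCδ η h h').1
  have hItθ := fun η h h' => (hCδ η h h').2.1
  have hIt := fun η h h' => (hCδ η h h').2.2
  -- The `Lp` representative is a measurable function, as Chebyshev's inequality requires; it agrees
  -- almost surely with `ℓ̇` at every observation.
  have hgm : ∀ i, Measurable (M.effScore N hS i : S → ℝ) := fun i =>
    (Lp.stronglyMeasurable _).measurable
  have hg0 : ∀ i, ∫ x, M.effScore N hS i x ∂M.P = 0 := fun i => by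
    rw [← integral_congr_ae (hass.leastFavorable i)]; exact hass.integral_dl_eq_zero i
  have t1 := Tight.of_consistent (Q := Q) M.θ₀_mem (T := fun n ω θ => ‖ηhat n ω θ - M.η₀‖)
    (a := fun n ω θ => ‖θ - M.θ₀‖ + (n : ℝ) ^ (-r)) (fun n ω θ => by positivity)
    (fun θt h1 h2 => hrate θt ⟨h1, h2⟩)
  have t2 := Tight.forall fun i => Tight.of_consistent (Q := Q) M.θ₀_mem
    (T := fun n ω θ => empProc M.P n (fun k => X k ω)
        (fun x => M.dl path [i] [] M.θ₀ M.θ₀ (ηhat n ω θ) x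
          - M.dl path [i] [] M.θ₀ M.θ₀ M.η₀ x))
    (a := fun n ω θ => rateM r n + max ((n : ℝ) ^ (1 / 2 - r)) 1 * ‖θ - M.θ₀‖)
    (fun n ω θ => by have := rateM_nonneg r n; positivity)
    (fun θt h1 h2 => hass.modulus θt ⟨h1, h2⟩ i)
  have t3 := Tight.forall fun i => Tight.forall fun j => tight_empProc_dlClass hX hindep hlaw h05 (hD₅ i j)
  have t4 := Tight.forall fun i => Tight.forall fun j => tight_empProc_dlClass hX hindep hlaw h06 (hD₆ i j)
  have t5 : Tight Q (fun K n ω => empMean n (fun k => X k ω) F ≤ K) := by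
    refine Tight.of_exists (fun K K' n ω _ hKK' h => h.trans hKK') fun ε hε => ?_
    obtain ⟨K, hK, hb⟩ := empMean_bounded hX hlaw hF hε
    exact ⟨K, hK, Eventually.of_forall fun n => by simpa only [not_le] using hb n⟩
  have t6 : Tight Q (fun K n ω => ∀ i, |empMean n (fun k => X k ω) (M.effScore N hS i)|
      ≤ K * (Real.sqrt n)⁻¹) := by
    refine Tight.forall fun i => Tight.of_exists
      (fun K K' n ω _ hKK' h => h.trans (by gcongr)) fun ε hε => ?_
    obtain ⟨K, hK, hb⟩ := empMean_centered_bounded hX hindep hlaw (hgm i) (Lp.memLp _) (hg0 i) hε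
    refine ⟨K, hK, ?_⟩
    filter_upwards [eventually_gt_atTop 0] with n hn
    simpa only [not_le] using hb n hn
  have t7 : Tight Q (fun _ n ω => ∀ k,
      (∀ p ∈ M.nbhd δ₀, ∀ i j l,
        |M.dl path [i, j, l] [] p.1 p.2.1 p.2.2 (X k ω)| ≤ F (X k ω) ∧
        |M.dl path [i, j] [l] p.1 p.2.1 p.2.2 (X k ω)| ≤ F (X k ω) ∧
        |M.dl path [i] [j, l] p.1 p.2.1 p.2.2 (X k ω)| ≤ F (X k ω)) ∧
      (∀ p ∈ M.nbhd δ₀, 0 < M.sub path p.2.2 (X k ω) p.1 p.2.1) ∧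
      (∀ η ∈ M.H, η ∈ ball M.η₀ δ₀ → ContDiffOn ℝ 3
        (Function.uncurry (M.logSub path η (X k ω))) (ball M.θ₀ δ₀ ×ˢ ball M.θ₀ δ₀)) ∧
      ∀ i, M.dl path [i] [] M.θ₀ M.θ₀ M.η₀ (X k ω) = M.effScore N hS i (X k ω)) := by
    have hlf : ∀ᵐ x ∂M.P, ∀ i, M.dl path [i] [] M.θ₀ M.θ₀ M.η₀ x = M.effScore N hS i x :=
      ae_all_iff.mpr hass.leastFavorable
    refine Tight.of_ae fun _ => ?_
    filter_upwards [ae_forall_sample hX hlaw hFδ,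
      ae_forall_sample hX hlaw (M.P_absolutelyContinuous.ae_le hreg.sub_pos),
      ae_forall_sample hX hlaw (M.P_absolutelyContinuous.ae_le hreg.smooth),
      ae_forall_sample hX hlaw hlf] with ω a b c d k using ⟨a k, b k, c k, d k⟩
  have t8 : Tight Q (fun _ n ω => (∀ θ ∈ M.Θ, ηhat n ω θ ∈ M.H) ∧
      ∀ θ ∈ M.Θ, ∀ η ∈ M.H, M.likN X n ω θ η ≤ M.likN X n ω θ (ηhat n ω θ)) :=
    Tight.of_ae fun n => (hmle.ηhat_mem n).and (hmle.ηhat_max n)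
  -- The summand `(2K + 2)/δ₀` shrinks the radius `1/φ` until `η̂_θ` is within `δ₀` of `η₀`; the
  -- next summand is the remainder constant after integration of the score, and `d K` bounds `w`
  -- from its coordinates.
  refine ⟨fun n ω => WithLp.toLp 2 fun i => empMean n (fun k => X k ω) (M.effScore N hS i),
    Tight.map (φ := fun K => K + (2 * K + 2) / δ₀ + d * (K * (1 + C₀) * (1 + K) * (d + 1) ^ 2) + d * K)
      (t1.and (t2.and (t3.and (t4.and (t5.and (t6.and (t7.and t8)))))))
      (fun K K' n ω hK hKK' h => h.mono hK hKK') fun K hK => ⟨by positivity, ?_⟩⟩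
  have hd0 : (0 : ℝ) ≤ d := d.cast_nonneg
  have hbnd : ∀ᶠ n : ℕ in atTop, (n : ℝ) ^ (-r) < δ₀ / (2 * K + 2) :=
    (tendsto_rpow_neg_nat hr).eventually_lt_const (by positivity)
  filter_upwards [hbnd, eventually_gt_atTop 0] with n hbn hn ω
  rintro ⟨f1, f2, f3, f4, f5, f6, f7, f8, f9⟩
  have hn' : (0 : ℝ) < n := by exact_mod_cast hn
  have hsq : 0 < Real.sqrt n := Real.sqrt_pos.mpr hn'
  have hb0 : 0 ≤ (n : ℝ) ^ (-r) := by positivity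
  set C₁ := K * (1 + C₀) * (1 + K) with hC₁
  have hC₁0 : 0 ≤ C₁ := by positivity
  set φ := K + (2 * K + 2) / δ₀ + d * (C₁ * (d + 1) ^ 2) + d * K with hφ
  have hφK : K ≤ φ := by
    have : 0 ≤ (2 * K + 2) / δ₀ := by positivity
    have : 0 ≤ d * (C₁ * (d + 1) ^ 2) := by positivity
    have : 0 ≤ d * K := by positivity
    linarith
  have hφδ : 1 / φ ≤ δ₀ / (2 * K + 2) := by
    rw [one_div_le (hK.trans_le hφK) (by positivity), one_div_div]
    have : 0 ≤ d * (C₁ * (d + 1) ^ 2) := by positivity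
    have : 0 ≤ d * K := by positivity
    linarith
  have hφK' : 1 / φ ≤ 1 / K := one_div_le_one_div_of_le hK hφK
  have hδδ : δ₀ / (2 * K + 2) ≤ δ₀ := div_le_self hδ₀'.le (by linarith)
  have hin : ∀ θ ∈ ball M.θ₀ (1 / φ), θ ∈ M.Θ ∧ ‖ηhat n ω θ - M.η₀‖ ≤ K * (‖θ - M.θ₀‖ + (n : ℝ) ^ (-r))
      ∧ ηhat n ω θ ∈ ball M.η₀ δ₀ := by
    intro θ hθ
    have h1 : θ ∈ M.Θ := hreg.ball_subset (ball_subset_ball (hφδ.trans hδδ) hθ)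
    have h2 := f1 θ h1 (lt_of_lt_of_le hθ hφK')
    rw [abs_of_nonneg (norm_nonneg _)] at h2
    refine ⟨h1, h2, ?_⟩
    rw [mem_ball_iff_norm]
    refine h2.trans_lt ?_
    have h3 : ‖θ - M.θ₀‖ < δ₀ / (2 * K + 2) := (mem_ball_iff_norm.mp hθ).trans_le hφδ
    calc K * (‖θ - M.θ₀‖ + (n : ℝ) ^ (-r)) < K * (δ₀ / (2 * K + 2) + δ₀ / (2 * K + 2)) := by gcongr
      _ = δ₀ * (K / (K + 1)) := by field_simp; ring
      _ ≤ δ₀ := mul_le_of_le_one_right hδ₀'.le (by rw [div_le_one (by positivity)]; linarith)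
  have hexp : ∀ b ∈ ball M.θ₀ (1 / φ), ∀ s ∈ ball M.θ₀ (1 / φ), ∀ i,
      |empMean n (fun k => X k ω) (M.dl path [i] [] s b (ηhat n ω b))
        - (empMean n (fun k => X k ω) (M.effScore N hS i) - ∑ j, A i j * (s - M.θ₀) j)|
        ≤ C₁ * (d + 1) ^ 2 * (rateA r n + ‖s - M.θ₀‖ + ‖b - M.θ₀‖) ^ 2 := by
    intro b hb s hs i
    obtain ⟨hbΘ, hη1, hη2⟩ := hin b hb
    have hφ0 := hφδ.trans hδδ
    exact empMean_score_expansion_of_empProc (x := fun k : Fin n => X k ω) hn hC₀0 hK (f8 b hbΘ) hη2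
      (ball_subset_ball hφ0 hs) (ball_subset_ball hφ0 hb) hη1
      (fun k => (f7 k).2.2.1 _ (f8 b hbΘ) hη2) (fun k => (f7 k).1) f5 hass.posDef.isHermitian
      (fun j => hItt _ (f8 b hbΘ) hη2 j i) (fun j => hItθ _ (f8 b hbΘ) hη2 i j)
      (hIt _ (f8 b hbΘ) hη2 i) (empMean_congr fun k => (f7 k).2.2.2 i)
      (fun j => f3 j i _ ⟨(M.θ₀, M.θ₀, ηhat n ω b), ⟨mem_ball_self hδ₀', mem_ball_self hδ₀',
        f8 b hbΘ, hη2⟩, rfl⟩)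
      (fun j => f4 i j _ ⟨(M.θ₀, M.θ₀, ηhat n ω b), ⟨mem_ball_self hδ₀', mem_ball_self hδ₀',
        f8 b hbΘ, hη2⟩, rfl⟩)
      (f2 i b hbΘ (lt_of_lt_of_le hb hφK'))
  refine ⟨?_, fun t ht t' ht' => ?_⟩
  · refine (norm_le_sum_abs _).trans ((Finset.sum_le_sum fun i _ => f6 i).trans ?_)
    simp only [Finset.sum_const, Finset.card_univ, Fintype.card_fin, nsmul_eq_mul]
    rw [← mul_assoc]
    refine mul_le_mul_of_nonneg_right ?_ (by positivity)
    have : 0 ≤ (2 * K + 2) / δ₀ := by positivity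
    have : 0 ≤ d * (C₁ * (d + 1) ^ 2) := by positivity
    linarith
  · obtain ⟨h1, h2⟩ := profLik_expansion (X := X) hreg (hφδ.trans hδδ) (fun k => (f7 k).2.2.1)
      (fun k => (f7 k).2.1) f8 f9 (fun θ hθ => (hin θ hθ).2.2) hass.posDef.isHermitian
      (by positivity : 0 ≤ C₁ * (d + 1) ^ 2) (rateA_nonneg r n)
      (w := WithLp.toLp 2 fun i => empMean n (fun k => X k ω) (M.effScore N hS i)) hexp ht ht'
    refine ⟨h1, h2.trans ?_⟩
    have : d * (C₁ * (d + 1) ^ 2) ≤ φ := by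
      have : 0 ≤ (2 * K + 2) / δ₀ := by positivity
      have : 0 ≤ d * K := by positivity
      linarith
    gcongr

end SemiModel

/-! ### Consistency -/

namespace SemiModel

variable {d : ℕ} {S : Type*} [MeasurableSpace S] {B : Type*} [SeminormedAddCommGroup B]
  {M : SemiModel d S B} {path : EuclideanSpace ℝ (Fin d) → EuclideanSpace ℝ (Fin d) → B → B}
  {N : Set (ℝ → B)} {hS : ∀ i, MemLp (M.score i) 2 M.P}
  {Ω : Type*} [MeasurableSpace Ω] {X : ℕ → Ω → S} {Q : Measure Ω}
  {θhat : ℕ → Ω → EuclideanSpace ℝ (Fin d)}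
  {ηhat : ℕ → Ω → EuclideanSpace ℝ (Fin d) → B} {r : ℝ}

/-- The true density is positive at almost every observation, so the maximum is at least `lik_n(θ₀,
η₀) > 0`. -/
theorem Assumptions.ae_profLik_pos (hass : M.Assumptions X path N hS Q ηhat r)
    (hX : ∀ i, Measurable (X i)) (hlaw : ∀ i, Q.map (X i) = M.P) (hmle : M.IsMLE X Q θhat ηhat)
    (n : ℕ) : ∀ᵐ ω ∂Q, θhat n ω ∈ M.Θ ∧ 0 < M.profLik X n ω (θhat n ω) ∧
      ∀ θ ∈ M.Θ, M.profLik X n ω θ ≤ M.profLik X n ω (θhat n ω) := by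
  obtain ⟨δ, hreg⟩ := hass.exists_locallyRegular
  have hpos : ∀ᵐ x ∂M.P, 0 < M.lik M.θ₀ M.η₀ x := by
    filter_upwards [M.P_absolutelyContinuous.ae_le hreg.sub_pos] with x hx
    rw [hreg.lik_eq_sub]
    exact hx _ (M.mem_nbhd_truth hreg.pos)
  filter_upwards [ae_forall_sample hX hlaw hpos, hmle.ηhat_mem n, hmle.ηhat_max n, hmle.θhat_mem n,
    hmle.θhat_max n] with ω h1 h2 h3 h4 h5
  refine ⟨h4, lt_of_lt_of_le ?_ (h5 _ M.θ₀_mem), h5⟩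
  rw [profLik_eq (h2 _ M.θ₀_mem) (h3 _ M.θ₀_mem)]
  have h6 : 0 < M.likN X n ω M.θ₀ M.η₀ := Finset.prod_pos fun k _ => h1 k
  exact h6.trans_le (h3 _ M.θ₀_mem _ M.η₀_mem)

/-- Uniform separation: outside a neighborhood of the truth the profile likelihood is exponentially
smaller than its maximum. -/
theorem Assumptions.tight_separation (hass : M.Assumptions X path N hS Q ηhat r)
    (hX : ∀ i, Measurable (X i)) (hlaw : ∀ i, Q.map (X i) = M.P) (hmle : M.IsMLE X Q θhat ηhat)
    (hsep : ∀ θt : ℕ → Ω → EuclideanSpace ℝ (Fin d), (∀ n ω, θt n ω ∈ M.Θ) →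
      Tendsto (fun n => Q {ω | ¬ 0 < M.profLik X n ω (θt n ω)}) atTop (𝓝 0) →
      TendstoInMeasure Q (fun n ω => M.Delta X θhat n ω (θt n ω)) atTop (fun _ => 0) →
      TendstoInMeasure Q θt atTop (fun _ => M.θ₀)) {δ : ℝ} (hδ : 0 < δ) :
    Tight Q (fun K n ω => ∀ θ ∈ M.Θ, δ ≤ dist θ M.θ₀ → 0 < M.profLik X n ω θ →
      M.Delta X θhat n ω θ < -(1 / K)) := by
  classical
  refine Tight.of_exists (fun K K' n ω hK hKK' h θ h1 h2 h3 => (h θ h1 h2 h3).trans_le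
    (neg_le_neg (one_div_le_one_div_of_le hK hKK'))) fun ε hε => ?_
  have hae := hass.ae_profLik_pos hX hlaw hmle
  -- A bad point of level `k` is far from `θ₀` although `Δ_n` is at least `-1/(k+1)` there.
  -- Positivity is part of badness because `Real.log 0 = 0` would make `Δ_n` meaningless. The
  -- default `θ̂_n`, where `Δ_n = 0`, keeps `Δ_n → 0` along the whole sequence, and the value `θ₀`
  -- on a null set keeps the sequence in `Θ` everywhere.
  obtain ⟨k, hk⟩ := exists_eventually_measure_le_of_seq (Q := Q) (ε := ε)
    (bad := fun n k ω θ => θ ∈ M.Θ ∧ δ ≤ dist θ M.θ₀ ∧ 0 < M.profLik X n ω θ ∧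
      -(1 / ((k : ℝ) + 1)) ≤ M.Delta X θhat n ω θ)
    (fun n ω => if θhat n ω ∈ M.Θ then θhat n ω else M.θ₀) (by
    intro φ hφ θt hθt
    have hmem : ∀ n ω, θt n ω ∈ M.Θ := fun n ω => by
      rcases hθt n ω with h1 | ⟨k, -, h1, -⟩
      · rw [h1]
        split_ifs with h
        exacts [h, M.θ₀_mem]
      · exact h1
    have hcons := hsep θt hmem ?_ ?_
    · rw [tendstoInMeasure_iff_dist] at hcons
      obtain ⟨N₀, hN₀⟩ := eventually_atTop.mp ((hcons δ hδ).eventually_le_const hε)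
      refine ⟨N₀, (measure_mono ?_).trans (hN₀ (φ N₀) hφ.le_apply)⟩
      rintro ω ⟨-, h, -⟩
      exact h
    · refine tendsto_const_nhds.congr fun n => ?_
      symm
      refine ae_iff.mp ?_
      filter_upwards [hae n] with ω hω
      rcases hθt n ω with h1 | ⟨k, -, -, -, h1, -⟩
      · rw [h1, if_pos hω.1]; exact hω.2.1
      · exact h1
    · rw [tendstoInMeasure_iff_dist]
      intro η hη
      obtain ⟨k₀, hk₀⟩ := exists_nat_one_div_lt hη
      refine tendsto_const_nhds.congr' ?_
      filter_upwards [eventually_ge_atTop (φ k₀)] with n hn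
      symm
      have : ∀ᵐ ω ∂Q, ¬ η ≤ dist (M.Delta X θhat n ω (θt n ω)) 0 := by
        filter_upwards [hae n] with ω hω
        rw [not_le, Real.dist_eq, sub_zero]
        rcases hθt n ω with h1 | ⟨k, hnk, h1, -, h2, h3⟩
        · rw [h1, if_pos hω.1, Delta, sub_self, mul_zero, abs_zero]; exact hη
        · have hkk : k₀ ≤ k := hφ.le_iff_le.mp (hnk ▸ hn)
          have h4 : 1 / ((k : ℝ) + 1) ≤ 1 / ((k₀ : ℝ) + 1) := by gcongr
          -- Maximality of `θ̂_n` gives the upper bound; badness gives the lower one, so `Δ_n` is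
          -- squeezed to zero.
          have h5 : M.Delta X θhat n ω (θt n ω) ≤ 0 := by
            refine mul_nonpos_of_nonneg_of_nonpos (by positivity) ?_
            exact sub_nonpos.mpr (Real.log_le_log h2 (hω.2.2 _ h1))
          rw [abs_of_nonpos h5]
          linarith
      simpa using ae_iff.mp this)
  refine ⟨(k : ℝ) + 1, by positivity, ?_⟩
  filter_upwards [hk] with n hn
  refine (measure_mono ?_).trans hn
  intro ω hω
  simp only [Set.mem_ofPred_eq] at hω ⊢
  push Not at hω
  exact hω

end SemiModel

/-! ### Gaussian integrals -/

section Gaussian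

variable {d : ℕ}

local notation "E" => EuclideanSpace ℝ (Fin d)

theorem integrable_exp_neg_sq_norm {c : ℝ} (hc : 0 < c) :
    Integrable (fun u : E => Real.exp (-c * ‖u‖ ^ 2)) := by
  have h := (GaussianFourier.integrable_cexp_neg_mul_sq_norm_add (V := E) (b := (c : ℂ))
    (by simpa using hc) 0 0).norm
  refine h.congr (ae_of_all _ fun u => ?_)
  simp only [Complex.norm_exp]
  congr 1
  have : (-(c : ℂ) * (‖u‖ : ℂ) ^ 2 + 0 * ((inner ℝ (0 : E) u : ℝ) : ℂ))
      = ((-c * ‖u‖ ^ 2 : ℝ) : ℂ) := by push_cast; ring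
  rw [this, Complex.ofReal_re]

/-- The dominating functions `(1 + ‖u‖)^k exp(-c‖u‖² + C‖u‖)` are integrable. -/
theorem integrable_pow_mul_exp (k : ℕ) {c : ℝ} (hc : 0 < c) (C : ℝ) :
    Integrable (fun u : E => (1 + ‖u‖) ^ k * Real.exp (-c * ‖u‖ ^ 2 + C * ‖u‖)) := by
  refine ((integrable_exp_neg_sq_norm (d := d) (half_pos hc)).const_mul
    ((k.factorial : ℝ) * Real.exp (1 + (C + 1) ^ 2 / (2 * c)))).mono' (by fun_prop)
    (ae_of_all _ fun u => ?_)
  have h0 : 0 ≤ 1 + ‖u‖ := by positivity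
  rw [Real.norm_of_nonneg (by positivity)]
  have h1 : (1 + ‖u‖) ^ k ≤ (k.factorial : ℝ) * Real.exp (1 + ‖u‖) := by
    have := Real.pow_div_factorial_le_exp _ h0 k
    rwa [div_le_iff₀' (by positivity)] at this
  calc (1 + ‖u‖) ^ k * Real.exp (-c * ‖u‖ ^ 2 + C * ‖u‖)
      ≤ (k.factorial : ℝ) * Real.exp (1 + ‖u‖) * Real.exp (-c * ‖u‖ ^ 2 + C * ‖u‖) := by gcongr
    _ = (k.factorial : ℝ) * Real.exp (1 + ‖u‖ + (-c * ‖u‖ ^ 2 + C * ‖u‖)) := by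
        rw [mul_assoc, ← Real.exp_add]
    _ ≤ (k.factorial : ℝ) * Real.exp (1 + (C + 1) ^ 2 / (2 * c) + -(c / 2) * ‖u‖ ^ 2) := by
        -- Half of the quadratic exponent absorbs the linear term `(C + 1)‖u‖`, where the `+ 1`
        -- comes from bounding the polynomial by an exponential.
        have h2 : 0 ≤ (c * ‖u‖ - (C + 1)) ^ 2 / (2 * c) := by positivity
        have h3 : (c * ‖u‖ - (C + 1)) ^ 2 / (2 * c)
            = c / 2 * ‖u‖ ^ 2 - (C + 1) * ‖u‖ + (C + 1) ^ 2 / (2 * c) := by field_simp; ring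
        refine mul_le_mul_of_nonneg_left (Real.exp_le_exp.mpr ?_) (by positivity)
        linarith
    _ = _ := by rw [Real.exp_add]; ring

/-- The unnormalized Gaussian density with precision matrix `A`. -/
noncomputable def gauss (A : Matrix (Fin d) (Fin d) ℝ) (u : E) : ℝ := Real.exp (-(bil A u u) / 2)

variable {A : Matrix (Fin d) (Fin d) ℝ}

theorem continuous_gauss (A : Matrix (Fin d) (Fin d) ℝ) : Continuous (gauss A) :=
  Real.continuous_exp.comp ((continuous_bil A).neg.div_const 2)

theorem gauss_pos (A : Matrix (Fin d) (Fin d) ℝ) (u : E) : 0 < gauss A u := Real.exp_pos _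

theorem integrable_mul_gauss (hA : A.PosDef) {f : E → ℝ} (hf : Continuous f) (k : ℕ)
    (hfb : ∀ u, |f u| ≤ (1 + ‖u‖) ^ k) : Integrable (fun u => f u * gauss A u) := by
  obtain ⟨c, hc, hcA⟩ := exists_pos_le_bil hA
  refine (integrable_pow_mul_exp (d := d) k (half_pos hc) 0).mono'
    (hf.mul (continuous_gauss A)).aestronglyMeasurable (ae_of_all _ fun u => ?_)
  rw [norm_mul, Real.norm_eq_abs, Real.norm_of_nonneg (gauss_pos A u).le]
  refine mul_le_mul (hfb u) (Real.exp_le_exp.mpr ?_) (gauss_pos A u).le (by positivity)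
  linarith [hcA u]

theorem integrable_gauss (hA : A.PosDef) : Integrable (gauss A) := by
  simpa using integrable_mul_gauss hA (f := fun _ => 1) continuous_const 0 (by simp)

theorem abs_coord_le (u : E) (i : Fin d) : |u i| ≤ ‖u‖ := by
  simpa using PiLp.norm_apply_le u i

theorem integral_gauss_pos (hA : A.PosDef) : 0 < ∫ u, gauss A u := by
  rw [integral_pos_iff_support_of_nonneg (fun u => (gauss_pos A u).le) (integrable_gauss hA)]
  have : Function.support (gauss A) = Set.univ := by
    ext u; simp [(gauss_pos A u).ne']
  rw [this]
  exact NeZero.pos _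

/-- The integrand is odd. -/
theorem integral_coord_mul_gauss (A : Matrix (Fin d) (Fin d) ℝ) (i : Fin d) :
    ∫ u : E, u i * gauss A u = 0 := by
  have h := integral_neg_eq_self (fun u : E => u i * gauss A u) volume
  have hb : ∀ u : E, bil A (-u) (-u) = bil A u u := fun u => by
    rw [← neg_one_smul ℝ u, bil_smul_left, bil_smul_right]; ring
  simp only [gauss, hb, PiLp.neg_apply, neg_mul, integral_neg] at h ⊢
  linarith

theorem hasFDerivAt_gauss (hA : A.PosDef) (u : E) (i : Fin d) :
    fderiv ℝ (gauss A) u (EuclideanSpace.single i 1) = -(∑ j, A i j * u j) * gauss A u ∧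
      DifferentiableAt ℝ (gauss A) u := by
  have hd : Differentiable ℝ (gauss A) := by
    unfold gauss bil; fun_prop
  refine ⟨?_, hd u⟩
  have h1 : HasDerivAt (fun τ : ℝ => gauss A (u + τ • EuclideanSpace.single i 1))
      (fderiv ℝ (gauss A) u (EuclideanSpace.single i 1)) 0 := by
    have hl : HasDerivAt (fun τ : ℝ => u + τ • (EuclideanSpace.single i (1 : ℝ) : E))
        (EuclideanSpace.single i 1) 0 := by
      simpa using ((hasDerivAt_id (0 : ℝ)).smul_const _).const_add u
    have h0 : HasFDerivAt (gauss A) (fderiv ℝ (gauss A) u)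
        (u + (0 : ℝ) • (EuclideanSpace.single i (1 : ℝ) : E)) := by
      simpa using (hd u).hasFDerivAt
    exact h0.comp_hasDerivAt (0 : ℝ) hl
  have hbe : bil A (EuclideanSpace.single i 1) u = ∑ j, A i j * u j := by
    simp [bil]
  have h2 : HasDerivAt (fun τ : ℝ => gauss A (u + τ • EuclideanSpace.single i 1))
      (-(∑ j, A i j * u j) * gauss A u) 0 := by
    have hq : ∀ τ : ℝ, bil A (u + τ • EuclideanSpace.single i 1) (u + τ • EuclideanSpace.single i 1)
        = bil A u u + τ * (2 * ∑ j, A i j * u j)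
          + τ ^ 2 * bil A (EuclideanSpace.single i 1) (EuclideanSpace.single i 1) := by
      intro τ
      rw [bil_add_left, bil_add_right, bil_add_right, bil_smul_left, bil_smul_left, bil_smul_right,
        bil_smul_right, bil_comm hA.isHermitian u (EuclideanSpace.single i 1), hbe]
      ring
    simp only [gauss, hq]
    have := ((((hasDerivAt_id (0 : ℝ)).mul_const (2 * ∑ j, A i j * u j)).const_add
      (bil A u u)).add (((hasDerivAt_id (0 : ℝ)).pow 2).mul_const
        (bil A (EuclideanSpace.single i 1) (EuclideanSpace.single i 1)))).neg.div_const 2 |>.exp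
    refine this.congr_deriv ?_
    simp
    ring
  exact h1.unique h2

/-- Integration by parts. Since `∂_k gauss = -(A u)_k gauss`, integrating `u_l ∂_k gauss` shows that
`A` times the matrix of second moments is the total mass times the identity, so neither
diagonalization nor the value of the mass is needed. -/
theorem integral_coord_mul_coord_mul_gauss (hA : A.PosDef) (i j : Fin d) :
    ∫ u : E, u i * u j * gauss A u = (∫ u, gauss A u) * A⁻¹ i j := by
  have hcoord : ∀ k : Fin d, Continuous (fun u : E => u k) := fun k => by fun_prop
  have hi1 : ∀ k, Integrable (fun u : E => u k * gauss A u) := fun k =>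
    integrable_mul_gauss hA (hcoord k) 1 fun u => by
      rw [pow_one]; linarith [abs_coord_le u k]
  have hi2 : ∀ k l, Integrable (fun u : E => u k * u l * gauss A u) := fun k l =>
    integrable_mul_gauss hA ((hcoord k).mul (hcoord l)) 2 fun u => by
      rw [abs_mul, pow_two]
      have := abs_coord_le u k
      have := abs_coord_le u l
      gcongr <;> linarith
  set Sm : Matrix (Fin d) (Fin d) ℝ := Matrix.of fun i j => ∫ u : E, u i * u j * gauss A u with hSm
  set Z := ∫ u, gauss A u with hZ
  have hZ0 : Z ≠ 0 := (integral_gauss_pos hA).ne'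
  have key : A * Sm = Z • (1 : Matrix (Fin d) (Fin d) ℝ) := by
    ext k l
    have hder : ∀ u : E, fderiv ℝ (fun u : E => u l) u (EuclideanSpace.single k 1)
        = if k = l then 1 else 0 := fun u => by
      have : HasFDerivAt (fun u : E => u l) (EuclideanSpace.proj l : E →L[ℝ] ℝ) u :=
        (EuclideanSpace.proj l : E →L[ℝ] ℝ).hasFDerivAt
      rw [this.fderiv]
      simp [eq_comm]
    have hsum : ∀ u : E, u l * fderiv ℝ (gauss A) u (EuclideanSpace.single k 1)
        = -∑ m, A k m * (u m * u l * gauss A u) := fun u => by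
      rw [(hasFDerivAt_gauss hA u k).1, neg_mul, mul_neg, Finset.sum_mul, Finset.mul_sum]
      congr 1
      exact Finset.sum_congr rfl fun m _ => by ring
    have hibp := integral_mul_fderiv_eq_neg_fderiv_mul_of_integrable (μ := (volume : Measure E))
      (f := fun u : E => u l) (g := gauss A) (v := EuclideanSpace.single k 1)
      (by simp only [hder]; exact (integrable_gauss hA).const_mul _)
      (by
        simp only [hsum]
        exact (integrable_finsetSum _ fun m _ => (hi2 m l).const_mul _).neg)
      (hi1 l) (fun u _ => by fun_prop) (fun u _ => (hasFDerivAt_gauss hA u k).2)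
    simp only [hsum, hder] at hibp
    rw [integral_neg, integral_finsetSum _ fun m _ => (hi2 m l).const_mul _, integral_const_mul,
      neg_inj] at hibp
    simp only [integral_const_mul] at hibp
    rw [Matrix.mul_apply, Matrix.smul_apply, Matrix.one_apply, smul_eq_mul, mul_comm Z]
    exact hibp
  have hinv : A * (Z⁻¹ • Sm) = 1 := by
    rw [Matrix.mul_smul, key, smul_smul, inv_mul_cancel₀ hZ0, one_smul]
  rw [Matrix.inv_eq_right_inv hinv, Matrix.smul_apply, smul_eq_mul, mul_inv_cancel_left₀ hZ0]
  rfl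

end Gaussian

/-! ### The Laplace approximation of the posterior profile distribution -/

section Laplace

variable {d : ℕ}

local notation "E" => EuclideanSpace ℝ (Fin d)

theorem abs_exp_sub_exp_le {x y z : ℝ} (hx : x ≤ z) (hy : y ≤ z) :
    |Real.exp x - Real.exp y| ≤ |x - y| * Real.exp z := by
  have key : ∀ x y : ℝ, y ≤ x → x ≤ z → |Real.exp x - Real.exp y| ≤ |x - y| * Real.exp z := by
    intro x y hyx hxz
    rw [abs_of_nonneg (sub_nonneg.mpr (Real.exp_le_exp.mpr hyx)), abs_of_nonneg (sub_nonneg.mpr hyx)]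
    have h1 := Real.add_one_le_exp (y - x)
    have h2 : Real.exp y = Real.exp x * Real.exp (y - x) := by rw [← Real.exp_add]; ring_nf
    have h3 := Real.exp_le_exp.mpr hxz
    have h4 := Real.exp_pos x
    calc Real.exp x - Real.exp y = Real.exp x * (1 - Real.exp (y - x)) := by rw [h2]; ring
      _ ≤ Real.exp x * (x - y) := mul_le_mul_of_nonneg_left (by linarith) h4.le
      _ ≤ Real.exp z * (x - y) := mul_le_mul_of_nonneg_right h3 (by linarith)
      _ = _ := mul_comm _ _
  rcases le_total y x with h | h
  · exact key x y h hx
  · rw [abs_sub_comm, abs_sub_comm x y]; exact key y x h hy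

theorem integral_comp_affine {c : ℝ} (hc : 0 < c) (θs : E) (F : E → ℝ) :
    c ^ d * ∫ θ, F (c • (θ - θs)) = ∫ u, F u := by
  rw [integral_sub_right_eq_self (fun θ => F (c • θ)) θs, Measure.integral_comp_smul_of_nonneg
    volume F c (hR := hc.le)]
  simp only [finrank_euclideanSpace, Fintype.card_fin, smul_eq_mul]
  exact mul_inv_cancel_left₀ (pow_pos hc d).ne' _

theorem integrable_comp_affine {c : ℝ} (hc : 0 < c) (θs : E) {F : E → ℝ} (hF : Integrable F) :
    Integrable (fun θ => F (c • (θ - θs))) :=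
  ((integrable_comp_smul_iff volume F hc.ne').mpr hF).comp_sub_right θs

/-- The local shape of a prior density `ρ` times a likelihood ratio `q`. -/
structure PosteriorShape (A : Matrix (Fin d) (Fin d) ℝ) (Θ : Set E) (θ₀ : E) (ρ : E → ℝ)
    (c₀ K δ R c D r : ℝ) (n : ℕ) (q : E → ℝ) (θs : E) : Prop where
  n_pos : 0 < n
  le_bil : ∀ v, c₀ * ‖v‖ ^ 2 ≤ bil A v v
  K_pos : 0 < K
  δ_pos : 0 < δ
  δ_small : 4 * K * δ ≤ c₀ / 4
  rate_le : rateM r n ≤ 1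
  ball_subset : ball θ₀ δ ⊆ Θ
  meas : MeasurableSet Θ
  center : ‖θs - θ₀‖ ≤ K * (Real.sqrt n)⁻¹
  center_le : ‖θs - θ₀‖ ≤ δ
  prior_nonneg : ∀ θ ∈ Θ, 0 ≤ ρ θ
  prior_le : ∀ θ ∈ ball θ₀ δ, ρ θ ≤ R
  prior_lip : ∀ θ ∈ ball θ₀ δ, |ρ θ - ρ θ₀| ≤ R * ‖θ - θ₀‖
  prior_int : IntegrableOn ρ Θ
  prior_one : ∫ θ in Θ, ρ θ = 1
  ratio_meas : AEStronglyMeasurable (Θ.indicator fun θ => ρ θ * q θ)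
  ratio_near : ∀ θ ∈ ball θ₀ δ, 0 < q θ ∧ |Real.log (q θ) + n * (bil A (θ - θs) (θ - θs) / 2)|
    ≤ n * (K * ‖θ - θs‖ * (rateA r n + ‖θ - θs‖) ^ 2)
  ratio_far : ∀ θ ∈ Θ, δ ≤ dist θ θ₀ → 0 ≤ q θ ∧ q θ ≤ Real.exp (-c * n)
  diam : ∀ θ ∈ Θ, ‖θ - θs‖ ≤ D
  far_small : Real.sqrt n ^ d * (Real.exp (-c * n) * (1 + Real.sqrt n * D) ^ 2) ≤ rateM r n

namespace PosteriorShape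

variable {A : Matrix (Fin d) (Fin d) ℝ} {Θ : Set (EuclideanSpace ℝ (Fin d))}
  {θ₀ : EuclideanSpace ℝ (Fin d)} {ρ : EuclideanSpace ℝ (Fin d) → ℝ} {c₀ K δ R c D r : ℝ} {n : ℕ}
  {q : EuclideanSpace ℝ (Fin d) → ℝ} {θs : EuclideanSpace ℝ (Fin d)}

theorem inv_sqrt_le_rateM (r : ℝ) {n : ℕ} (hn : 0 < n) : (Real.sqrt n)⁻¹ ≤ rateM r n := by
  rw [rateM_eq r hn]
  exact le_add_of_nonneg_right (by positivity)

/-- In the neighborhood of the truth the likelihood ratio is close to a Gaussian density. -/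
theorem near (h : PosteriorShape A Θ θ₀ ρ c₀ K δ R c D r n q θs) {θ : E} (hθ : θ ∈ ball θ₀ δ)
    {u : E} (hu : u = Real.sqrt n • (θ - θs)) :
    |q θ - gauss A u| ≤ 4 * K * rateM r n * (1 + ‖u‖) ^ 3
      * Real.exp (-(c₀ / 4) * ‖u‖ ^ 2 + 4 * K * ‖u‖) := by
  obtain ⟨hq, hlog⟩ := h.ratio_near θ hθ
  have hn : (0 : ℝ) < n := by exact_mod_cast h.n_pos
  have hs : 0 < Real.sqrt n := Real.sqrt_pos.mpr hn
  have hss : Real.sqrt n * Real.sqrt n = n := Real.mul_self_sqrt hn.le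
  have hni : (n : ℝ) * (Real.sqrt n)⁻¹ = Real.sqrt n := by
    rw [← div_eq_mul_inv, div_eq_iff hs.ne', hss]
  have hm0 := rateM_nonneg r n
  have hK := h.K_pos
  set m := rateM r n with hm
  set η := ‖θ - θs‖ with hη
  have hη0 : 0 ≤ η := norm_nonneg _
  have hun : ‖u‖ = Real.sqrt n * η := by
    rw [hu, norm_smul, Real.norm_of_nonneg hs.le]
  have hηδ : η ≤ 2 * δ := by
    have h1 : θ - θs = (θ - θ₀) - (θs - θ₀) := by abel
    have h2 := mem_ball_iff_norm.mp hθ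
    have h3 := norm_sub_le (θ - θ₀) (θs - θ₀)
    rw [← h1] at h3
    linarith [h.center_le]
  have hbil : n * (bil A (θ - θs) (θ - θs) / 2) = bil A u u / 2 := by
    rw [hu, bil_smul_left, bil_smul_right, ← mul_assoc, hss]; ring
  rw [hbil] at hlog
  have ha2 : n * rateA r n ^ 2 ≤ 2 * (Real.sqrt n * m) := by
    have := mul_le_mul_of_nonneg_left (rateA_sq_le r h.n_pos) hn.le
    refine this.trans (le_of_eq ?_)
    rw [mul_left_comm, ← mul_assoc (n : ℝ), hni]
  -- In the coordinate `u` the part of the remainder with `a²` becomes linear with coefficient of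
  -- order `M_n`, since `n a² ≤ 2 √n M_n`; the part with `η²` is quadratic with the small factor
  -- `η`.
  have hD : n * (K * η * (rateA r n + η) ^ 2) ≤ 4 * K * m * ‖u‖ + 2 * K * η * ‖u‖ ^ 2 := by
    have h1 : (rateA r n + η) ^ 2 ≤ 2 * rateA r n ^ 2 + 2 * η ^ 2 := by
      nlinarith [sq_nonneg (rateA r n - η)]
    have h2 : n * (K * η * (rateA r n + η) ^ 2)
        ≤ n * (K * η * (2 * rateA r n ^ 2 + 2 * η ^ 2)) := by gcongr
    have h3 : n * (K * η * (2 * rateA r n ^ 2 + 2 * η ^ 2))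
        = 2 * K * η * (n * rateA r n ^ 2) + 2 * K * η * (n * η ^ 2) := by ring
    have h4 : (n : ℝ) * η ^ 2 = ‖u‖ ^ 2 := by
      rw [hun, mul_pow, pow_two (Real.sqrt n), hss]
    have h5 : 2 * K * η * (n * rateA r n ^ 2) ≤ 2 * K * η * (2 * (Real.sqrt n * m)) := by gcongr
    rw [h4] at h3
    rw [hun] at h3 ⊢
    nlinarith
  have hη3 : 2 * K * η * ‖u‖ ^ 2 ≤ 2 * K * m * ‖u‖ ^ 3 := by
    have h1 : η = (Real.sqrt n)⁻¹ * ‖u‖ := by rw [hun, inv_mul_cancel_left₀ hs.ne']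
    have h2 := inv_sqrt_le_rateM r h.n_pos
    calc 2 * K * η * ‖u‖ ^ 2 = 2 * K * (Real.sqrt n)⁻¹ * ‖u‖ ^ 3 := by rw [h1]; ring
      _ ≤ 2 * K * m * ‖u‖ ^ 3 := by gcongr
  -- Here the factor `η ≤ 2δ` is used: by the choice of `δ` the quadratic part of the remainder
  -- takes at most `c₀/4` from the `c₀/2` of the Gaussian exponent. In `hη3` the same term was
  -- bounded by `M_n ‖u‖³` instead; both forms are needed, one for domination and one for smallness.
  have hx : Real.log (q θ) ≤ -(c₀ / 4) * ‖u‖ ^ 2 + 4 * K * ‖u‖ := by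
    have h1 := (abs_le.mp (hlog.trans hD)).2
    have h2 := h.le_bil u
    have h3 : 2 * K * η * ‖u‖ ^ 2 ≤ 4 * K * δ * ‖u‖ ^ 2 := by
      have : 2 * K * η ≤ 4 * K * δ := by nlinarith
      gcongr
    have h4 : 4 * K * δ * ‖u‖ ^ 2 ≤ c₀ / 4 * ‖u‖ ^ 2 := by
      have := h.δ_small
      gcongr
    have h5 : 4 * K * m * ‖u‖ ≤ 4 * K * ‖u‖ := by
      have : 4 * K * m ≤ 4 * K := mul_le_of_le_one_right (by positivity) h.rate_le
      gcongr
    linarith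
  have hc0 : 0 ≤ c₀ := by
    have := h.δ_small
    have : 0 < 4 * K * δ := by have := h.δ_pos; positivity
    linarith
  have hy : -(bil A u u) / 2 ≤ -(c₀ / 4) * ‖u‖ ^ 2 + 4 * K * ‖u‖ := by
    have h2 := h.le_bil u
    have : 0 ≤ 4 * K * ‖u‖ := by positivity
    have : 0 ≤ c₀ * ‖u‖ ^ 2 := by positivity
    linarith
  have hfin := abs_exp_sub_exp_le hx hy
  rw [Real.exp_log hq] at hfin
  refine hfin.trans (mul_le_mul_of_nonneg_right ?_ (Real.exp_pos _).le)
  have h6 : Real.log (q θ) - -(bil A u u) / 2 = Real.log (q θ) + bil A u u / 2 := by ring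
  rw [h6]
  refine (hlog.trans hD).trans ((add_le_add le_rfl hη3).trans ?_)
  have hKm : 0 ≤ K * m := by positivity
  have hp : 4 * ‖u‖ + 2 * ‖u‖ ^ 3 ≤ 4 * (1 + ‖u‖) ^ 3 := by
    nlinarith [norm_nonneg u, pow_nonneg (norm_nonneg u) 2, pow_nonneg (norm_nonneg u) 3]
  calc 4 * K * m * ‖u‖ + 2 * K * m * ‖u‖ ^ 3 = K * m * (4 * ‖u‖ + 2 * ‖u‖ ^ 3) := by ring
    _ ≤ K * m * (4 * (1 + ‖u‖) ^ 3) := by gcongr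
    _ = _ := by ring

/-- The dominating function of the approximation error. -/
noncomputable def envelope (c₀ K : ℝ) (u : E) : ℝ :=
  (1 + ‖u‖) ^ 3 * Real.exp (-(c₀ / 4) * ‖u‖ ^ 2 + 4 * K * ‖u‖)

/-- Near `θ₀` the error is that of the likelihood ratio, with constant `4K`, plus the variation of
the prior, with constant `1 + K`. Away from `θ₀` the posterior density is exponentially small, and
the Gaussian is also of order `M_n`: there `1 ≤ ‖θ - θ₀‖/δ`, and `‖θ - θ₀‖` is at most `M_n` times a
polynomial in `‖u‖`. -/
theorem density_bound (h : PosteriorShape A Θ θ₀ ρ c₀ K δ R c D r n q θs) (θ : E)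
    {u : E} (hu : u = Real.sqrt n • (θ - θs)) :
    |Θ.indicator (fun θ => ρ θ * q θ) θ - ρ θ₀ * gauss A u|
      ≤ R * (4 * K + (1 + K) + (1 + K) / δ) * rateM r n * envelope c₀ K u
        + Real.exp (-c * n) * Θ.indicator ρ θ := by
  have hn : (0 : ℝ) < n := by exact_mod_cast h.n_pos
  have hs : 0 < Real.sqrt n := Real.sqrt_pos.mpr hn
  have hK := h.K_pos
  have hδ := h.δ_pos
  have hm0 := rateM_nonneg r n
  have hθ₀b : θ₀ ∈ ball θ₀ δ := mem_ball_self h.δ_pos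
  have hρ₀ := h.prior_nonneg θ₀ (h.ball_subset hθ₀b)
  have hρR := h.prior_le θ₀ hθ₀b
  have hR : 0 ≤ R := hρ₀.trans hρR
  have hc0 : 0 < c₀ := by
    have := h.δ_small
    have : 0 < 4 * K * δ := by positivity
    linarith
  set m := rateM r n with hm
  set Ex := Real.exp (-(c₀ / 4) * ‖u‖ ^ 2 + 4 * K * ‖u‖) with hEx
  have hEx0 : 0 < Ex := Real.exp_pos _
  have hg : gauss A u ≤ Ex := by
    refine Real.exp_le_exp.mpr ?_
    have h2 := h.le_bil u
    have : 0 ≤ 4 * K * ‖u‖ := by positivity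
    have : 0 ≤ c₀ * ‖u‖ ^ 2 := by positivity
    linarith
  have hg0 := (gauss_pos A u).le
  have hdist : ‖θ - θ₀‖ ≤ m * ((1 + K) * (1 + ‖u‖) ^ 3) := by
    have h1 : θ - θ₀ = (Real.sqrt n)⁻¹ • u + (θs - θ₀) := by
      rw [hu, smul_smul, inv_mul_cancel₀ hs.ne', one_smul]; abel
    have h2 := inv_sqrt_le_rateM r h.n_pos
    calc ‖θ - θ₀‖ ≤ ‖(Real.sqrt n)⁻¹ • u‖ + ‖θs - θ₀‖ := by rw [h1]; exact norm_add_le _ _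
      _ ≤ (Real.sqrt n)⁻¹ * ‖u‖ + K * (Real.sqrt n)⁻¹ := by
          rw [norm_smul, Real.norm_of_nonneg (by positivity)]
          exact add_le_add le_rfl h.center
      _ = (Real.sqrt n)⁻¹ * (‖u‖ + K) := by ring
      _ ≤ m * (‖u‖ + K) := by gcongr
      _ ≤ m * ((1 + K) * (1 + ‖u‖) ^ 3) := by
          refine mul_le_mul_of_nonneg_left ?_ hm0
          have hu0 := norm_nonneg u
          have h3 : 1 + ‖u‖ ≤ (1 + ‖u‖) ^ 3 := by
            nlinarith [pow_nonneg hu0 2, pow_nonneg hu0 3]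
          nlinarith
  have hun := norm_nonneg u
  have henv : envelope c₀ K u = (1 + ‖u‖) ^ 3 * Ex := rfl
  by_cases hb : θ ∈ ball θ₀ δ
  · have hΘ := h.ball_subset hb
    have hρ := h.prior_nonneg θ hΘ
    rw [Set.indicator_of_mem hΘ, Set.indicator_of_mem hΘ, henv]
    have e1 : |ρ θ * q θ - ρ θ₀ * gauss A u|
        ≤ ρ θ * |q θ - gauss A u| + |ρ θ - ρ θ₀| * gauss A u := by
      have : ρ θ * q θ - ρ θ₀ * gauss A u
          = ρ θ * (q θ - gauss A u) + (ρ θ - ρ θ₀) * gauss A u := by ring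
      rw [this]
      refine (abs_add_le _ _).trans (le_of_eq ?_)
      rw [abs_mul, abs_mul, abs_of_nonneg hρ, abs_of_nonneg hg0]
    have e2 : ρ θ * |q θ - gauss A u| ≤ R * (4 * K * m * (1 + ‖u‖) ^ 3 * Ex) :=
      mul_le_mul (h.prior_le θ hb) (h.near hb hu) (abs_nonneg _) hR
    have e3 : |ρ θ - ρ θ₀| * gauss A u ≤ R * (m * ((1 + K) * (1 + ‖u‖) ^ 3)) * Ex :=
      mul_le_mul ((h.prior_lip θ hb).trans (by gcongr)) hg hg0 (by positivity)
    have e4 : 0 ≤ R * ((1 + K) / δ) * m * ((1 + ‖u‖) ^ 3 * Ex) := by positivity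
    have e5 : 0 ≤ Real.exp (-c * n) * ρ θ := by positivity
    nlinarith
  · have hd : δ ≤ dist θ θ₀ := not_lt.mp hb
    have e1 : |Θ.indicator (fun θ => ρ θ * q θ) θ| ≤ Real.exp (-c * n) * Θ.indicator ρ θ := by
      by_cases hΘ : θ ∈ Θ
      · rw [Set.indicator_of_mem hΘ, Set.indicator_of_mem hΘ]
        obtain ⟨h1, h2⟩ := h.ratio_far θ hΘ hd
        have hρ := h.prior_nonneg θ hΘ
        rw [abs_of_nonneg (by positivity), mul_comm]
        gcongr
      · simp [hΘ]
    have e2 : ρ θ₀ * gauss A u ≤ R * ((1 + K) / δ * m * (1 + ‖u‖) ^ 3) * Ex := by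
      have h1 : 1 ≤ (1 + K) / δ * m * (1 + ‖u‖) ^ 3 := by
        rw [dist_eq_norm] at hd
        have := hd.trans hdist
        rw [div_mul_eq_mul_div, div_mul_eq_mul_div, le_div_iff₀ hδ]
        linarith
      calc ρ θ₀ * gauss A u ≤ R * Ex := mul_le_mul hρR hg hg0 hR
        _ = R * 1 * Ex := by ring
        _ ≤ _ := by gcongr
    have e3 : |Θ.indicator (fun θ => ρ θ * q θ) θ - ρ θ₀ * gauss A u|
        ≤ |Θ.indicator (fun θ => ρ θ * q θ) θ| + ρ θ₀ * gauss A u := by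
      refine (abs_sub _ _).trans (le_of_eq ?_)
      rw [abs_of_nonneg (a := ρ θ₀ * gauss A u) (by positivity)]
    have e4 : 0 ≤ R * (4 * K + (1 + K)) * m * ((1 + ‖u‖) ^ 3 * Ex) := by positivity
    rw [henv]
    nlinarith

theorem integrable_envelope (hc₀ : 0 < c₀) (K : ℝ) :
    Integrable (fun u : E => (1 + ‖u‖) ^ 2 * envelope c₀ K u) := by
  have := integrable_pow_mul_exp (d := d) 5 (c := c₀ / 4) (by positivity) (4 * K)
  refine this.congr (ae_of_all _ fun u => ?_)
  simp only [envelope]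
  ring

theorem c₀_pos (h : PosteriorShape A Θ θ₀ ρ c₀ K δ R c D r n q θs) : 0 < c₀ := by
  have h1 := h.δ_small
  have h2 := h.K_pos
  have h3 := h.δ_pos
  have : 0 < 4 * K * δ := by positivity
  linarith

/-- The approximation of the (unnormalized) posterior moments. -/
theorem integral_bound (h : PosteriorShape A Θ θ₀ ρ c₀ K δ R c D r n q θs) (hA : A.PosDef)
    {f : E → ℝ} (hf : Continuous f) (hfb : ∀ u, |f u| ≤ (1 + ‖u‖) ^ 2) :
    Integrable (fun θ => f (Real.sqrt n • (θ - θs)) * Θ.indicator (fun θ => ρ θ * q θ) θ) ∧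
    |Real.sqrt n ^ d * (∫ θ, f (Real.sqrt n • (θ - θs)) * Θ.indicator (fun θ => ρ θ * q θ) θ)
      - ρ θ₀ * ∫ u, f u * gauss A u|
      ≤ (R * (4 * K + (1 + K) + (1 + K) / δ) * ∫ u : E, (1 + ‖u‖) ^ 2 * envelope c₀ K u) * rateM r n
        + rateM r n := by
  have hn : (0 : ℝ) < n := by exact_mod_cast h.n_pos
  have hs : 0 < Real.sqrt n := Real.sqrt_pos.mpr hn
  set sn := Real.sqrt n with hsn
  set m := rateM r n with hm
  set C := R * (4 * K + (1 + K) + (1 + K) / δ) with hC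
  set dens := Θ.indicator (fun θ => ρ θ * q θ) with hdens
  set err : E → ℝ := fun θ => f (sn • (θ - θs)) * (dens θ - ρ θ₀ * gauss A (sn • (θ - θs))) with herr
  -- After the substitution `u = √n(θ - θs)` the first part integrates to a constant times `M_n`.
  -- The second is controlled by the diameter of `Θ`, the unit mass of the prior and the field
  -- `far_small`.
  set bd : E → ℝ := fun θ => C * m * ((1 + ‖sn • (θ - θs)‖) ^ 2 * envelope c₀ K (sn • (θ - θs)))
    + Real.exp (-c * n) * (1 + sn * D) ^ 2 * Θ.indicator ρ θ with hbd
  have i1 := integrable_envelope (d := d) h.c₀_pos K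
  have i2 := integrable_comp_affine hs θs i1
  have i3 : Integrable (Θ.indicator ρ) := (integrable_indicator_iff h.meas).mpr h.prior_int
  have ibd : Integrable bd := (i2.const_mul _).add (i3.const_mul _)
  have hcont : Continuous (fun θ : E => sn • (θ - θs)) := by fun_prop
  have hle : ∀ θ, |err θ| ≤ bd θ := by
    intro θ
    have h1 := h.density_bound θ (u := sn • (θ - θs)) rfl
    have h2 := hfb (sn • (θ - θs))
    rw [herr, abs_mul]
    refine (mul_le_mul h2 h1 (abs_nonneg _) (by positivity)).trans ?_
    rw [mul_add, hbd]
    refine add_le_add (le_of_eq (by ring)) ?_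
    by_cases hΘ : θ ∈ Θ
    · simp only [Set.indicator_of_mem hΘ]
      have h3 := h.diam θ hΘ
      have h4 := h.prior_nonneg θ hΘ
      rw [norm_smul, Real.norm_of_nonneg hs.le]
      calc (1 + sn * ‖θ - θs‖) ^ 2 * (Real.exp (-c * n) * ρ θ)
          = Real.exp (-c * n) * (1 + sn * ‖θ - θs‖) ^ 2 * ρ θ := by ring
        _ ≤ _ := by gcongr
    · simp [Set.indicator_of_notMem hΘ]
  have ierr : Integrable err := by
    refine ibd.mono' ?_ (ae_of_all _ fun θ => hle θ)
    exact (hf.comp hcont).aestronglyMeasurable.mul (h.ratio_meas.sub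
      (((continuous_gauss A).comp hcont).const_mul _).aestronglyMeasurable)
  have i4 := integrable_mul_gauss hA hf 2 hfb
  have i5 : Integrable (fun θ => ρ θ₀ * (f (sn • (θ - θs)) * gauss A (sn • (θ - θs)))) :=
    (integrable_comp_affine hs θs i4).const_mul _
  have heq : (fun θ => f (sn • (θ - θs)) * dens θ)
      = fun θ => err θ + ρ θ₀ * (f (sn • (θ - θs)) * gauss A (sn • (θ - θs))) := by
    funext θ; simp only [herr]; ring
  refine ⟨by rw [heq]; exact ierr.add i5, ?_⟩
  rw [heq, integral_add ierr i5, integral_const_mul, mul_add, mul_left_comm (sn ^ d) (ρ θ₀),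
    integral_comp_affine hs θs (fun u => f u * gauss A u), add_sub_cancel_right, abs_mul,
    abs_of_nonneg (by positivity : 0 ≤ sn ^ d)]
  have h5 : |∫ θ, err θ| ≤ ∫ θ, bd θ := by
    refine (abs_integral_le_integral_abs).trans (integral_mono ierr.abs ibd hle)
  have h6 : sn ^ d * ∫ θ, bd θ = C * m * (∫ u : E, (1 + ‖u‖) ^ 2 * envelope c₀ K u)
      + sn ^ d * (Real.exp (-c * n) * (1 + sn * D) ^ 2) := by
    simp only [hbd]
    rw [integral_add (i2.const_mul _) (i3.const_mul _), integral_const_mul, integral_const_mul,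
      integral_indicator h.meas, h.prior_one, mul_one, mul_add, mul_left_comm (sn ^ d) (C * m),
      integral_comp_affine hs θs (fun u => (1 + ‖u‖) ^ 2 * envelope c₀ K u)]
  calc sn ^ d * |∫ θ, err θ| ≤ sn ^ d * ∫ θ, bd θ := by gcongr
    _ ≤ _ := by rw [h6]; exact add_le_add (le_of_eq (by ring)) h.far_small

end PosteriorShape

end Laplace

/-! ### Moments of the posterior -/

section NormalizedDensity

variable {α : Type*} [MeasurableSpace α] {μ : Measure α} {D : α → ℝ}

theorem withDensity_ofReal_univ (hD : ∀ x, 0 ≤ D x) (hDi : Integrable D μ) :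
    μ.withDensity (fun x => ENNReal.ofReal (D x)) Set.univ = ENNReal.ofReal (∫ x, D x ∂μ) := by
  rw [withDensity_apply _ MeasurableSet.univ, Measure.restrict_univ,
    ofReal_integral_eq_lintegral_ofReal hDi (ae_of_all _ hD)]

theorem isProbabilityMeasure_normalized (hD : ∀ x, 0 ≤ D x) (hDi : Integrable D μ)
    (hpos : 0 < ∫ x, D x ∂μ) :
    IsProbabilityMeasure ((μ.withDensity (fun x => ENNReal.ofReal (D x)) Set.univ)⁻¹ •
      μ.withDensity (fun x => ENNReal.ofReal (D x))) := by
  refine ⟨?_⟩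
  rw [Measure.smul_apply, withDensity_ofReal_univ hD hDi, smul_eq_mul]
  exact ENNReal.inv_mul_cancel (ENNReal.ofReal_pos.mpr hpos).ne' ENNReal.ofReal_ne_top

theorem integral_normalized (hD : ∀ x, 0 ≤ D x) (hDi : Integrable D μ) (hpos : 0 < ∫ x, D x ∂μ)
    {f : α → ℝ} (hf : Integrable (fun x => f x * D x) μ) :
    Integrable f ((μ.withDensity (fun x => ENNReal.ofReal (D x)) Set.univ)⁻¹ •
      μ.withDensity (fun x => ENNReal.ofReal (D x))) ∧
    ∫ x, f x ∂((μ.withDensity (fun x => ENNReal.ofReal (D x)) Set.univ)⁻¹ •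
      μ.withDensity (fun x => ENNReal.ofReal (D x))) = (∫ x, f x * D x ∂μ) / ∫ x, D x ∂μ := by
  have hm : AEMeasurable (fun x => ENNReal.ofReal (D x)) μ := hDi.aemeasurable.ennreal_ofReal
  have ht : ∀ᵐ x ∂μ, ENNReal.ofReal (D x) < ∞ := ae_of_all _ fun x => ENNReal.ofReal_lt_top
  have heq : (fun x => (ENNReal.ofReal (D x)).toReal • f x) = fun x => f x * D x := by
    funext x
    rw [ENNReal.toReal_ofReal (hD x), smul_eq_mul, mul_comm]
  rw [withDensity_ofReal_univ hD hDi]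
  constructor
  · refine Integrable.smul_measure ?_ (ENNReal.inv_ne_top.mpr (ENNReal.ofReal_pos.mpr hpos).ne')
    rw [integrable_withDensity_iff_integrable_smul₀' hm ht, heq]
    exact hf
  · rw [integral_smul_measure, integral_withDensity_eq_integral_toReal_smul₀ hm ht, heq,
      ENNReal.toReal_inv, ENNReal.toReal_ofReal hpos.le, smul_eq_mul, div_eq_inv_mul]

end NormalizedDensity

/-! ### Normalized moments in the local coordinate, and inversion of the covariance -/

section Moments

variable {d : ℕ}

local notation "E" => EuclideanSpace ℝ (Fin d)

/-- The constant in the Laplace approximation of the posterior moments. -/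
noncomputable def errConst (d : ℕ) (c₀ K δ R : ℝ) : ℝ :=
  R * (4 * K + (1 + K) + (1 + K) / δ)
    * (∫ u : EuclideanSpace ℝ (Fin d), (1 + ‖u‖) ^ 2 * PosteriorShape.envelope c₀ K u) + 1

namespace PosteriorShape

variable {A : Matrix (Fin d) (Fin d) ℝ} {Θ : Set (EuclideanSpace ℝ (Fin d))}
  {θ₀ : EuclideanSpace ℝ (Fin d)} {ρ : EuclideanSpace ℝ (Fin d) → ℝ} {c₀ K δ R c D r : ℝ} {n : ℕ}
  {q : EuclideanSpace ℝ (Fin d) → ℝ} {θs : EuclideanSpace ℝ (Fin d)}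

theorem sqrt_pos (h : PosteriorShape A Θ θ₀ ρ c₀ K δ R c D r n q θs) : 0 < Real.sqrt n :=
  Real.sqrt_pos.mpr (by exact_mod_cast h.n_pos)

theorem integrable_density (h : PosteriorShape A Θ θ₀ ρ c₀ K δ R c D r n q θs) (hA : A.PosDef) :
    Integrable (Θ.indicator fun θ => ρ θ * q θ) := by
  simpa using (h.integral_bound hA (f := fun _ => 1) continuous_const
    fun u => by simp only [abs_one]; nlinarith [norm_nonneg u]).1

/-- Once the approximation error is below half of the limiting mass, the rescaled mass keeps the
other half; this bounds the denominators of the posterior moments. -/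
theorem half_mass_le (h : PosteriorShape A Θ θ₀ ρ c₀ K δ R c D r n q θs) (hA : A.PosDef)
    (hsmall : errConst d c₀ K δ R * rateM r n ≤ ρ θ₀ * (∫ u, gauss A u) / 2) :
    ρ θ₀ * (∫ u, gauss A u) / 2
      ≤ Real.sqrt n ^ d * ∫ θ, Θ.indicator (fun θ => ρ θ * q θ) θ := by
  have h1 := (h.integral_bound hA (f := fun _ => 1) continuous_const
    fun u => by simp only [abs_one]; nlinarith [norm_nonneg u]).2
  simp only [one_mul] at h1
  have h2 := (abs_le.mp h1).1
  rw [errConst, add_mul, one_mul] at hsmall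
  linarith

theorem mass_pos (h : PosteriorShape A Θ θ₀ ρ c₀ K δ R c D r n q θs) (hA : A.PosDef)
    (hρ : 0 < ρ θ₀)
    (hsmall : errConst d c₀ K δ R * rateM r n ≤ ρ θ₀ * (∫ u, gauss A u) / 2) :
    0 < ∫ θ, Θ.indicator (fun θ => ρ θ * q θ) θ := by
  have h1 := h.half_mass_le hA hsmall
  have h2 := mul_pos hρ (integral_gauss_pos hA)
  have h3 := pow_pos h.sqrt_pos d
  exact pos_of_mul_pos_right (by linarith : (0 : ℝ) < _) h3.le

/-- Numerator and denominator are each within `errConst * M_n` of their limits, and the limits have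
ratio `g`. Hence `J F - g J I` is small while `J I` stays at least half its limit. -/
theorem moment_bound (h : PosteriorShape A Θ θ₀ ρ c₀ K δ R c D r n q θs) (hA : A.PosDef)
    (hρ : 0 < ρ θ₀)
    (hsmall : errConst d c₀ K δ R * rateM r n ≤ ρ θ₀ * (∫ u, gauss A u) / 2)
    {f : E → ℝ} (hf : Continuous f) (hfb : ∀ u, |f u| ≤ (1 + ‖u‖) ^ 2) {g : ℝ}
    (hg : ∫ u, f u * gauss A u = (∫ u, gauss A u) * g) :
    |(∫ θ, f (Real.sqrt n • (θ - θs)) * Θ.indicator (fun θ => ρ θ * q θ) θ)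
        / (∫ θ, Θ.indicator (fun θ => ρ θ * q θ) θ) - g|
      ≤ 2 * errConst d c₀ K δ R / (ρ θ₀ * ∫ u, gauss A u) * (1 + |g|) * rateM r n := by
  have h1 := (h.integral_bound hA (f := fun _ => 1) continuous_const
    fun u => by simp only [abs_one]; nlinarith [norm_nonneg u]).2
  have h2 := (h.integral_bound hA hf hfb).2
  have h3 := h.half_mass_le hA hsmall
  have h4 := mul_pos hρ (integral_gauss_pos hA)
  have h5 := h.mass_pos hA hρ hsmall
  have h6 := pow_pos h.sqrt_pos d
  simp only [one_mul] at h1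
  rw [hg] at h2
  have he : ∀ m : ℝ, (R * (4 * K + (1 + K) + (1 + K) / δ)
      * (∫ u : E, (1 + ‖u‖) ^ 2 * envelope c₀ K u)) * m + m = errConst d c₀ K δ R * m := by
    intro m; rw [errConst]; ring
  rw [he] at h1 h2
  set J := Real.sqrt n ^ d with hJ
  set Z := ∫ u, gauss A u
  set I := ∫ θ, Θ.indicator (fun θ => ρ θ * q θ) θ
  set F := ∫ θ, f (Real.sqrt n • (θ - θs)) * Θ.indicator (fun θ => ρ θ * q θ) θ
  set C := errConst d c₀ K δ R
  set m := rateM r n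
  have hJI : 0 < J * I := mul_pos h6 h5
  have h7 : F / I - g = (J * F - g * (J * I)) / (J * I) := by field_simp
  have h8 : J * F - g * (J * I) = (J * F - ρ θ₀ * (Z * g)) - g * (J * I - ρ θ₀ * Z) := by ring
  have h9 : |J * F - g * (J * I)| ≤ C * m * (1 + |g|) := by
    rw [h8]
    refine (abs_sub _ _).trans ?_
    rw [abs_mul g]
    nlinarith [mul_le_mul_of_nonneg_left h1 (abs_nonneg g)]
  have h10 : 0 ≤ C * m * (1 + |g|) := (abs_nonneg _).trans h9
  rw [h7, abs_div, abs_of_pos hJI]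
  calc |J * F - g * (J * I)| / (J * I) ≤ C * m * (1 + |g|) / (ρ θ₀ * Z / 2) :=
        div_le_div₀ h10 h9 (by linarith) h3
    _ = _ := by field_simp

/-- The constant in the approximation of the posterior mean and covariance matrix. -/
noncomputable def momentConst (A : Matrix (Fin d) (Fin d) ℝ) (p c₀ K δ R : ℝ) : ℝ :=
  |2 * errConst d c₀ K δ R / (p * ∫ u, gauss A u)| * (1 + ∑ i, ∑ j, |A⁻¹ i j|)

theorem momentConst_nonneg (A : Matrix (Fin d) (Fin d) ℝ) (p c₀ K δ R : ℝ) :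
    0 ≤ momentConst A p c₀ K δ R := by
  unfold momentConst; positivity

/-- Apply the moment bound to the coordinates of `u = √n(θ - θs)` and their products, whose Gaussian
moments are `0` and the entries of `A⁻¹`, then undo the scaling. -/
theorem posterior_moments (h : PosteriorShape A Θ θ₀ ρ c₀ K δ R c D r n q θs) (hA : A.PosDef)
    (hρ : 0 < ρ θ₀)
    (hsmall : errConst d c₀ K δ R * rateM r n ≤ ρ θ₀ * (∫ u, gauss A u) / 2)
    {π : Measure E} [IsProbabilityMeasure π]
    (hπ : ∀ f : E → ℝ, Integrable (fun θ => f θ * Θ.indicator (fun θ => ρ θ * q θ) θ) →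
      Integrable f π ∧ ∫ θ, f θ ∂π = (∫ θ, f θ * Θ.indicator (fun θ => ρ θ * q θ) θ)
        / ∫ θ, Θ.indicator (fun θ => ρ θ * q θ) θ) :
    Integrable (fun θ => ‖θ‖ ^ 2) π ∧
    ‖θs - ∫ θ, θ ∂π‖ ≤ d * momentConst A (ρ θ₀) c₀ K δ R * ((Real.sqrt n)⁻¹ * rateM r n) ∧
    ∀ i j, |n * cov[fun θ : E => θ i, fun θ => θ j; π] - A⁻¹ i j|
      ≤ (momentConst A (ρ θ₀) c₀ K δ R + momentConst A (ρ θ₀) c₀ K δ R ^ 2) * rateM r n := by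
  have hs := h.sqrt_pos
  have hm0 := rateM_nonneg r n
  have hm1 := h.rate_le
  have hn : (0 : ℝ) < n := by exact_mod_cast h.n_pos
  have hss : Real.sqrt n * Real.sqrt n = n := Real.mul_self_sqrt hn.le
  set C := momentConst A (ρ θ₀) c₀ K δ R with hC
  have hC0 : 0 ≤ C := momentConst_nonneg _ _ _ _ _ _
  set m := rateM r n with hm
  set sn := Real.sqrt n with hsn
  have key : ∀ f : E → ℝ, Continuous f → (∀ u, |f u| ≤ (1 + ‖u‖) ^ 2) → ∀ g : ℝ,
      |g| ≤ ∑ i, ∑ j, |A⁻¹ i j| → ∫ u, f u * gauss A u = (∫ u, gauss A u) * g →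
      Integrable (fun θ => f (sn • (θ - θs))) π ∧ |∫ θ, f (sn • (θ - θs)) ∂π - g| ≤ C * m := by
    intro f hf hfb g hgb hg
    obtain ⟨h1, h2⟩ := hπ _ (h.integral_bound hA hf hfb).1
    refine ⟨h1, ?_⟩
    rw [h2]
    refine (h.moment_bound hA hρ hsmall hf hfb hg).trans ?_
    refine mul_le_mul_of_nonneg_right ?_ hm0
    rw [hC, momentConst]
    exact mul_le_mul (le_abs_self _) (by linarith) (by positivity) (abs_nonneg _)
  have hcont : ∀ k : Fin d, Continuous (fun u : E => u k) := fun k => by fun_prop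
  have hsum : ∀ i j, |A⁻¹ i j| ≤ ∑ i, ∑ j, |A⁻¹ i j| := fun i j =>
    (Finset.single_le_sum (f := fun j => |A⁻¹ i j|) (fun _ _ => abs_nonneg _)
      (Finset.mem_univ j)).trans (Finset.single_le_sum (f := fun i => ∑ j, |A⁻¹ i j|)
      (fun _ _ => Finset.sum_nonneg fun _ _ => abs_nonneg _) (Finset.mem_univ i))
  have k1 : ∀ i, Integrable (fun θ : E => (sn • (θ - θs)) i) π ∧
      |∫ θ : E, (sn • (θ - θs)) i ∂π - 0| ≤ C * m := fun i =>
    key (fun u => u i) (hcont i) (fun u => by nlinarith [abs_coord_le u i, norm_nonneg u]) 0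
      (by simp only [abs_zero]; positivity) (by rw [integral_coord_mul_gauss, mul_zero])
  have k2 : ∀ i j, Integrable (fun θ : E => (sn • (θ - θs)) i * (sn • (θ - θs)) j) π ∧
      |∫ θ : E, (sn • (θ - θs)) i * (sn • (θ - θs)) j ∂π - A⁻¹ i j| ≤ C * m := fun i j =>
    key (fun u => u i * u j) ((hcont i).mul (hcont j)) (fun u => by
      rw [abs_mul]
      nlinarith [mul_le_mul (abs_coord_le u i) (abs_coord_le u j) (abs_nonneg _) (norm_nonneg u),
        norm_nonneg u]) _ (hsum i j) (integral_coord_mul_coord_mul_gauss hA i j)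
  have hcoord : ∀ (i : Fin d) (θ : E), θ i = θs i + sn⁻¹ * (sn • (θ - θs)) i := fun i θ => by
    simp only [PiLp.smul_apply, PiLp.sub_apply, smul_eq_mul]
    rw [inv_mul_cancel_left₀ hs.ne']; ring
  have hLp : ∀ i, MemLp (fun θ : E => (sn • (θ - θs)) i) 2 π := fun i => by
    rw [memLp_two_iff_integrable_sq (k1 i).1.aestronglyMeasurable]
    simpa only [pow_two] using (k2 i i).1
  have hLp' : ∀ i, MemLp (fun θ : E => θ i) 2 π := fun i => by
    have h1 := (memLp_const (μ := π) (p := 2) (θs i)).add ((hLp i).const_mul sn⁻¹)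
    refine h1.ae_eq (ae_of_all _ fun θ => ?_)
    exact (hcoord i θ).symm
  have hid : MemLp (fun θ : E => θ) 2 π := by
    have h1 := memLp_finsetSum (p := 2) (μ := π) Finset.univ
      (f := fun (i : Fin d) (θ : E) => |θ i|) fun i _ => (hLp' i).abs
    refine h1.mono continuous_id.aestronglyMeasurable (ae_of_all _ fun θ => ?_)
    exact (norm_le_sum_abs θ).trans (le_abs_self _)
  have hint : Integrable (fun θ : E => θ) π := hid.integrable one_le_two
  have hmean : ∀ i, (∫ θ, θ ∂π) i = θs i + sn⁻¹ * ∫ θ : E, (sn • (θ - θs)) i ∂π := fun i => by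
    have h1 := (EuclideanSpace.proj (𝕜 := ℝ) i : E →L[ℝ] ℝ).integral_comp_comm hint
    simp only [PiLp.proj_apply] at h1
    rw [← h1]
    rw [show (fun θ : E => θ i) = fun θ => θs i + sn⁻¹ * (sn • (θ - θs)) i from funext (hcoord i)]
    rw [integral_add (integrable_const _) ((k1 i).1.const_mul _), integral_const_mul,
      integral_const, probReal_univ, one_smul]
  refine ⟨hid.integrable_norm_pow two_ne_zero, ?_, fun i j => ?_⟩
  · refine (norm_le_sum_abs _).trans ?_
    have h1 : ∀ i ∈ Finset.univ, |(θs - ∫ θ, θ ∂π) i| ≤ C * (sn⁻¹ * m) := fun i _ => by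
      have h2 := (k1 i).2
      rw [sub_zero] at h2
      rw [PiLp.sub_apply, hmean, sub_add_cancel_left, abs_neg, abs_mul, abs_of_pos (inv_pos.mpr hs)]
      calc sn⁻¹ * _ ≤ sn⁻¹ * (C * m) := by gcongr
        _ = _ := by ring
    refine (Finset.sum_le_sum h1).trans (le_of_eq ?_)
    simp [mul_assoc]
  -- Covariances ignore the shift by `θs`, so `n` times the covariance of `θ` is that of `u`. The
  -- product of the two means of `u` is of order `M_n²`, hence of order `M_n` because `M_n ≤ 1`.
  · have h1 : cov[fun θ : E => θ i, fun θ => θ j; π]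
        = sn⁻¹ * (sn⁻¹ * cov[fun θ : E => (sn • (θ - θs)) i, fun θ => (sn • (θ - θs)) j; π]) := by
      have e : ∀ k, (fun θ : E => θ k) = fun θ => θs k + sn⁻¹ * (sn • (θ - θs)) k :=
        fun k => funext (hcoord k)
      rw [e i, e j, covariance_const_add_left ((k1 i).1.const_mul _),
        covariance_const_add_right ((k1 j).1.const_mul _), covariance_const_mul_left,
        covariance_const_mul_right]
    rw [h1, covariance_eq_sub (hLp i) (hLp j), ← mul_assoc, ← mul_assoc, mul_assoc (n : ℝ),
      ← mul_inv, hss, mul_inv_cancel₀ hn.ne', one_mul]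
    have h2 := (k2 i j).2
    have h3 := (k1 i).2
    have h4 := (k1 j).2
    rw [sub_zero] at h3 h4
    simp only [Pi.mul_apply]
    set a := ∫ θ : E, (sn • (θ - θs)) i ∂π
    set b := ∫ θ : E, (sn • (θ - θs)) j ∂π
    set e := ∫ θ : E, (sn • (θ - θs)) i * (sn • (θ - θs)) j ∂π
    calc |e - a * b - A⁻¹ i j| = |(e - A⁻¹ i j) - a * b| := by ring_nf
      _ ≤ C * m + (C * m) * (C * m) := by
          refine (abs_sub _ _).trans (add_le_add h2 ?_)
          rw [abs_mul]
          exact mul_le_mul h3 h4 (abs_nonneg _) (by positivity)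
      _ = C * m + C ^ 2 * (m * m) := by ring
      _ ≤ C * m + C ^ 2 * m := by
          have : m * m ≤ m := mul_le_of_le_one_left hm0 hm1
          gcongr
      _ = _ := by ring

end PosteriorShape

/-- Matrix inversion is Lipschitz near an invertible matrix. -/
theorem exists_inv_sub_le {A : Matrix (Fin d) (Fin d) ℝ} (hA : A.PosDef) :
    ∃ η > 0, ∃ L, 0 ≤ L ∧ ∀ (V : Matrix (Fin d) (Fin d) ℝ) (x : ℝ), x ≤ η → 0 ≤ x →
      (∀ i j, |V i j - A⁻¹ i j| ≤ x) → IsUnit V.det ∧ ∀ i j, |A i j - V⁻¹ i j| ≤ L * x := by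
  let := Matrix.linftyOpNormedRing (n := Fin d) (α := ℝ)
  let := Matrix.linftyOpNormedAlgebra (n := Fin d) (R := ℝ) (α := ℝ)
  have : CompleteSpace (Matrix (Fin d) (Fin d) ℝ) := FiniteDimensional.complete ℝ _
  have hdet : IsUnit A⁻¹.det := by
    rw [Matrix.isUnit_nonsing_inv_det_iff]
    exact (hA.det_pos.ne').isUnit
  have hU : IsUnit A⁻¹ := (Matrix.isUnit_iff_isUnit_det _).mpr hdet
  obtain ⟨U, hUA⟩ := hU
  have hUinv : ((U⁻¹ : (Matrix (Fin d) (Fin d) ℝ)ˣ) : Matrix (Fin d) (Fin d) ℝ) = A := by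
    rw [Matrix.coe_units_inv, hUA, Matrix.nonsing_inv_nonsing_inv _ (hA.det_pos.ne').isUnit]
  -- In the Banach algebra of matrices the inverse at `A⁻¹ + t` differs from `A` by `O(‖t‖)`. The
  -- operator norm lies between the largest entry and `d` times it, which translates this into
  -- entrywise bounds.
  have h1 := NormedRing.inverse_add_norm_diff_first_order U
  obtain ⟨L, hL, hLb⟩ := h1.exists_nonneg
  have h2 : ∀ᶠ t : Matrix (Fin d) (Fin d) ℝ in 𝓝 0, IsUnit ((U : Matrix (Fin d) (Fin d) ℝ) + t) := by
    have : ContinuousAt (fun t : Matrix (Fin d) (Fin d) ℝ => (U : Matrix (Fin d) (Fin d) ℝ) + t) 0 := by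
      fun_prop
    refine this.eventually ?_
    simp only [add_zero]
    exact Units.isOpen.mem_nhds U.isUnit
  obtain ⟨s, hs, hball⟩ := Metric.eventually_nhds_iff.mp (hLb.bound.and h2)
  have hentry : ∀ (V : Matrix (Fin d) (Fin d) ℝ) i j, |V i j| ≤ ‖V‖ := by
    intro V i j
    rw [Matrix.linfty_opNorm_def]
    have h1 : ‖V i j‖₊ ≤ ∑ j, ‖V i j‖₊ :=
      Finset.single_le_sum (f := fun j => ‖V i j‖₊) (fun _ _ => zero_le) (Finset.mem_univ j)
    exact NNReal.coe_le_coe.mpr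
      (h1.trans (Finset.le_sup (f := fun i => ∑ j, ‖V i j‖₊) (Finset.mem_univ i)))
  have hnorm : ∀ (V : Matrix (Fin d) (Fin d) ℝ) (x : ℝ), 0 ≤ x → (∀ i j, |V i j| ≤ x) →
      ‖V‖ ≤ d * x := by
    intro V x hx hV
    have h0 : 0 ≤ (d : ℝ) * x := by positivity
    rw [Matrix.linfty_opNorm_def, ← Real.coe_toNNReal _ h0, NNReal.coe_le_coe, Finset.sup_le_iff]
    intro i _
    rw [← NNReal.coe_le_coe, Real.coe_toNNReal _ h0, NNReal.coe_sum]
    refine (Finset.sum_le_sum fun j _ => hV i j).trans (le_of_eq ?_)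
    simp
  -- The denominator ensures `d * x < s`, also for `d = 0`.
  refine ⟨s / (2 * (d + 1)), by positivity, L * d, by positivity, fun V x hx hx0 hV => ?_⟩
  have h3 : ‖V - A⁻¹‖ ≤ d * x := hnorm _ x hx0 hV
  have h4 : ‖V - A⁻¹‖ < s := by
    refine h3.trans_lt ?_
    have h5 : (d : ℝ) * x ≤ d * (s / (2 * (d + 1))) := by gcongr
    have h6 : (d : ℝ) * (s / (2 * (d + 1))) < s := by
      rw [mul_div_assoc', div_lt_iff₀ (by positivity)]
      nlinarith [(Nat.cast_nonneg d : (0 : ℝ) ≤ d)]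
    linarith
  obtain ⟨h5, h6⟩ := hball (y := V - A⁻¹) (by rwa [dist_zero_right])
  rw [hUA, add_sub_cancel] at h6
  refine ⟨(Matrix.isUnit_iff_isUnit_det _).mp h6, fun i j => ?_⟩
  rw [hUinv, hUA, add_sub_cancel, ← Matrix.nonsing_inv_eq_ringInverse, norm_norm] at h5
  rw [abs_sub_comm]
  have h7 := hentry (V⁻¹ - A) i j
  rw [Matrix.sub_apply] at h7
  rw [mul_assoc]
  exact h7.trans (h5.trans (by gcongr))

end Moments

/-! ### The shape of the profile likelihood around its one-step center -/

section Center

variable {d : ℕ} {A : Matrix (Fin d) (Fin d) ℝ}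

/-- The vector `A⁻¹ w`. -/
noncomputable def solve (A : Matrix (Fin d) (Fin d) ℝ) (w : EuclideanSpace ℝ (Fin d)) :
    EuclideanSpace ℝ (Fin d) :=
  WithLp.toLp 2 (A⁻¹.mulVec w.ofLp)

theorem bil_solve (hA : A.PosDef) (v w : EuclideanSpace ℝ (Fin d)) :
    bil A v (solve A w) = ∑ i, v i * w i := by
  have h1 : A.mulVec (A⁻¹.mulVec w.ofLp) = w.ofLp := by
    rw [Matrix.mulVec_mulVec, Matrix.mul_nonsing_inv _ hA.det_pos.ne'.isUnit, Matrix.one_mulVec]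
  unfold bil solve
  refine Finset.sum_congr rfl fun i _ => ?_
  congr 1
  exact congrFun h1 i

/-- For `v = A⁻¹ w` coercivity gives `c₀‖v‖² ≤ vᵀA v = vᵀw ≤ d ‖v‖ ‖w‖`; divide by `‖v‖`. -/
theorem norm_solve_le (hA : A.PosDef) {c₀ : ℝ} (hc₀ : 0 < c₀)
    (hbil : ∀ v, c₀ * ‖v‖ ^ 2 ≤ bil A v v) (w : EuclideanSpace ℝ (Fin d)) :
    ‖solve A w‖ ≤ d / c₀ * ‖w‖ := by
  set v := solve A w
  have h1 := hbil v
  rw [bil_solve hA v w] at h1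
  have h2 : ∑ i, v i * w i ≤ d * (‖v‖ * ‖w‖) := by
    refine (Finset.sum_le_sum fun i _ => (le_abs_self (v i * w i)).trans ?_).trans
      (le_of_eq (by simp : ∑ _i : Fin d, ‖v‖ * ‖w‖ = _))
    rw [abs_mul]
    exact mul_le_mul (abs_coord_le v i) (abs_coord_le w i) (abs_nonneg _) (norm_nonneg _)
  rcases (norm_nonneg v).eq_or_lt with h3 | h3
  · rw [← h3]; positivity
  · rw [div_mul_eq_mul_div, le_div_iff₀ hc₀]
    refine le_of_mul_le_mul_left ?_ h3
    nlinarith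

/-- Completing the square. -/
theorem quadratic_recenter (hA : A.PosDef) (x w : EuclideanSpace ℝ (Fin d)) :
    ∑ i, (x - solve A w) i * w i - (bil A x x - bil A (solve A w) (solve A w)) / 2
      = -(bil A (x - solve A w) (x - solve A w) / 2) := by
  set h := solve A w with hh
  rw [← bil_solve hA, ← hh]
  have h1 : bil A x x = bil A ((x - h) + h) ((x - h) + h) := by rw [sub_add_cancel]
  rw [h1, bil_add_left, bil_add_right, bil_add_right, bil_comm hA.isHermitian h (x - h)]
  ring

end Center

/-! ### Deterministic consequences of the expansion for the maximizer and the posterior -/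

namespace SemiModel

section Deterministic

variable {d : ℕ} {S : Type*} [MeasurableSpace S] {B : Type*} [SeminormedAddCommGroup B]
  {M : SemiModel d S B} {Ω : Type*} {X : ℕ → Ω → S}
  {θhat : ℕ → Ω → EuclideanSpace ℝ (Fin d)} {r : ℝ}
  {A : Matrix (Fin d) (Fin d) ℝ} {w : ℕ → Ω → EuclideanSpace ℝ (Fin d)} {K : ℝ} {n : ℕ} {ω : Ω}

theorem profLik_nonneg {θ : EuclideanSpace ℝ (Fin d)} (hθ : θ ∈ M.Θ) (n : ℕ) (ω : Ω) :
    0 ≤ M.profLik X n ω θ :=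
  Real.iSup_nonneg fun η => Finset.prod_nonneg fun _ _ => M.lik_nonneg θ hθ η η.2 _

/-- The constant in the expansion of the profile likelihood around `θ₀ + A⁻¹ w`. -/
noncomputable def centerConst (d : ℕ) (c₀ K : ℝ) : ℝ :=
  K * (2 + 4 * (d / c₀ * K)) ^ 2 + d / c₀ * K

theorem ProfileExpansion.norm_center_le (h : M.ProfileExpansion X A r w K n ω) (hA : A.PosDef)
    (hK : 0 < K) {c₀ : ℝ} (hc₀ : 0 < c₀) (hbil : ∀ v, c₀ * ‖v‖ ^ 2 ≤ bil A v v) :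
    ‖solve A (w n ω)‖ ≤ centerConst d c₀ K * (Real.sqrt n)⁻¹ := by
  have h1 : ‖solve A (w n ω)‖ ≤ d / c₀ * (K * (Real.sqrt n)⁻¹) :=
    (norm_solve_le hA hc₀ hbil _).trans (by have := h.1; gcongr)
  have h2 : 0 ≤ K * (2 + 4 * (d / c₀ * K)) ^ 2 * (Real.sqrt n)⁻¹ := by positivity
  rw [centerConst, add_mul]
  linarith

/-- Take `t' = θs` in the expansion: completing the square removes the linear term. The distance
from `θs` to `θ₀` is a multiple of `n^{-1/2} ≤ a`, so the remainder can be written with `a` and `‖t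
- θs‖` alone. -/
theorem ProfileExpansion.recenter (h : M.ProfileExpansion X A r w K n ω) (hA : A.PosDef)
    (hK : 0 < K) {c₀ : ℝ} (hc₀ : 0 < c₀) (hbil : ∀ v, c₀ * ‖v‖ ^ 2 ≤ bil A v v)
    {θs : EuclideanSpace ℝ (Fin d)} (hs : θs = M.θ₀ + solve A (w n ω))
    (hsb : θs ∈ ball M.θ₀ (1 / K)) {t : EuclideanSpace ℝ (Fin d)} (ht : t ∈ ball M.θ₀ (1 / K)) :
    |(n : ℝ)⁻¹ * Real.log (M.profLik X n ω t) - (n : ℝ)⁻¹ * Real.log (M.profLik X n ω θs)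
      + bil A (t - θs) (t - θs) / 2| ≤ centerConst d c₀ K * ‖t - θs‖ * (rateA r n + ‖t - θs‖) ^ 2 := by
  have h1 := (h.2 t ht θs hsb).2
  have e1 : θs - M.θ₀ = solve A (w n ω) := by rw [hs, add_sub_cancel_left]
  have e2 : t - θs = (t - M.θ₀) - solve A (w n ω) := by rw [hs]; abel
  have h2 := quadratic_recenter hA (t - M.θ₀) (w n ω)
  rw [← e2] at h2
  rw [e1, h2, sub_neg_eq_add] at h1
  refine h1.trans ?_
  have ha := rateA_nonneg r n
  have h3 : ‖solve A (w n ω)‖ ≤ d / c₀ * K * rateA r n := by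
    refine (norm_solve_le hA hc₀ hbil _).trans ?_
    rw [mul_assoc]
    refine mul_le_mul_of_nonneg_left (h.1.trans (mul_le_mul_of_nonneg_left ?_ hK.le))
      (by positivity)
    exact le_add_of_nonneg_right (by positivity)
  have h4 : ‖t - M.θ₀‖ ≤ ‖t - θs‖ + ‖solve A (w n ω)‖ := by
    have : t - M.θ₀ = (t - θs) + solve A (w n ω) := by rw [e2]; abel
    rw [this]; exact norm_add_le _ _
  have h5 : rateA r n + 2 * (‖t - M.θ₀‖ + ‖solve A (w n ω)‖)
      ≤ (2 + 4 * (d / c₀ * K)) * (rateA r n + ‖t - θs‖) := by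
    have : 0 ≤ d / c₀ * K * ‖t - θs‖ := by positivity
    linarith [norm_nonneg (t - θs)]
  have h6 : K * (2 + 4 * (d / c₀ * K)) ^ 2 ≤ centerConst d c₀ K :=
    le_add_of_nonneg_right (by positivity)
  calc K * ‖t - θs‖ * (rateA r n + 2 * (‖t - M.θ₀‖ + ‖solve A (w n ω)‖)) ^ 2
      ≤ K * ‖t - θs‖ * ((2 + 4 * (d / c₀ * K)) * (rateA r n + ‖t - θs‖)) ^ 2 := by gcongr
    _ = K * (2 + 4 * (d / c₀ * K)) ^ 2 * ‖t - θs‖ * (rateA r n + ‖t - θs‖) ^ 2 := by ring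
    _ ≤ _ := by gcongr

/-- The maximizer of the profile likelihood is close to the center of its expansion. -/
theorem ProfileExpansion.norm_maximizer_sub_le (h : M.ProfileExpansion X A r w K n ω)
    (hA : A.PosDef) (hK : 0 < K) {c₀ : ℝ} (hc₀ : 0 < c₀) (hbil : ∀ v, c₀ * ‖v‖ ^ 2 ≤ bil A v v)
    {θs : EuclideanSpace ℝ (Fin d)} (hs : θs = M.θ₀ + solve A (w n ω)) {δ : ℝ} (hn : 0 < n)
    (hδK : δ ≤ 1 / K) (hδ : 4 * centerConst d c₀ K * δ ≤ c₀ / 4) (hsb : θs ∈ ball M.θ₀ δ)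
    {t : EuclideanSpace ℝ (Fin d)} (ht : t ∈ ball M.θ₀ δ)
    (hmax : M.profLik X n ω θs ≤ M.profLik X n ω t) :
    ‖t - θs‖ ≤ 16 * centerConst d c₀ K / c₀ * ((Real.sqrt n)⁻¹ * rateM r n) := by
  have hsub := ball_subset_ball (x := M.θ₀) hδK
  have h1 := h.recenter hA hK hc₀ hbil hs (hsub hsb) (hsub ht)
  have hlog := Real.log_le_log (h.2 θs (hsub hsb) θs (hsub hsb)).1 hmax
  have hlog' := mul_le_mul_of_nonneg_left hlog (by positivity : 0 ≤ (n : ℝ)⁻¹)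
  have h2 := (abs_le.mp h1).2
  have h3 := hbil (t - θs)
  have hC : 0 ≤ centerConst d c₀ K := by unfold centerConst; positivity
  set C := centerConst d c₀ K
  set η := ‖t - θs‖ with hη
  have hη0 : 0 ≤ η := norm_nonneg _
  have hηδ : η ≤ 2 * δ := by
    have h4 := dist_triangle_right t θs M.θ₀
    rw [dist_eq_norm] at h4
    linarith [mem_ball.mp ht, mem_ball.mp hsb]
  -- The maximizer does at least as well as `θs`, so the quadratic loss cannot exceed the remainder.
  -- Cancelling one factor `η` and absorbing the `η²` term by the smallness of `δ` leaves `η`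
  -- bounded by a multiple of `a²`.
  have h5 : c₀ / 2 * η ^ 2 ≤ C * η * (rateA r n + η) ^ 2 := by linarith
  rcases hη0.eq_or_lt with h6 | h6
  · rw [← h6]
    have := rateM_nonneg r n
    positivity
  have h7 : c₀ / 2 * η ≤ C * (rateA r n + η) ^ 2 := by
    refine le_of_mul_le_mul_left ?_ h6
    linarith
  have h8 : (rateA r n + η) ^ 2 ≤ 2 * rateA r n ^ 2 + 2 * η ^ 2 := by
    nlinarith [sq_nonneg (rateA r n - η)]
  have h9 := mul_le_mul_of_nonneg_left h8 hC
  have h10 : C * (2 * η ^ 2) ≤ c₀ / 4 * η := by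
    calc C * (2 * η ^ 2) = 2 * C * η * η := by ring
      _ ≤ 2 * C * (2 * δ) * η := by gcongr
      _ = 4 * C * δ * η := by ring
      _ ≤ _ := by gcongr
  have h11 := mul_le_mul_of_nonneg_left (rateA_sq_le r hn) hC
  rw [div_mul_eq_mul_div, le_div_iff₀ hc₀]
  linarith

/-- Separation compares with the maximum at `θ̂_n`, whereas the posterior is normalized by the value
at `θs`. The normalized log profile likelihoods at these points differ by at most `1/(2K₂)`, by
`hrem`, so half of the separation exponent survives. -/
theorem ProfileExpansion.posteriorShape (h : M.ProfileExpansion X A r w K n ω)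
    (hA : A.PosDef) (hK : 0 < K) {c₀ : ℝ} (hc₀ : 0 < c₀) (hbil : ∀ v, c₀ * ‖v‖ ^ 2 ≤ bil A v v)
    {θs : EuclideanSpace ℝ (Fin d)} (hs : θs = M.θ₀ + solve A (w n ω)) {δ K₂ R D : ℝ} (hn : 0 < n)
    (hδ0 : 0 < δ) (hK₂ : 0 < K₂)
    (hδK : δ ≤ 1 / K) (hδ : 4 * centerConst d c₀ K * δ ≤ c₀ / 4) (hm : rateM r n ≤ 1)
    (hcenter : centerConst d c₀ K * (Real.sqrt n)⁻¹ < δ)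
    (hrem : centerConst d c₀ K * (16 * centerConst d c₀ K / c₀ * ((Real.sqrt n)⁻¹ * rateM r n))
      * (rateA r n + 16 * centerConst d c₀ K / c₀ * ((Real.sqrt n)⁻¹ * rateM r n)) ^ 2
      ≤ 1 / (2 * K₂))
    (hfar : Real.sqrt n ^ d * (Real.exp (-(1 / (2 * K₂)) * n) * (1 + Real.sqrt n * D) ^ 2)
      ≤ rateM r n)
    (hmax : θhat n ω ∈ M.Θ ∧ 0 < M.profLik X n ω (θhat n ω) ∧
      ∀ θ ∈ M.Θ, M.profLik X n ω θ ≤ M.profLik X n ω (θhat n ω))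
    (hsep : ∀ θ ∈ M.Θ, δ ≤ dist θ M.θ₀ → 0 < M.profLik X n ω θ →
      M.Delta X θhat n ω θ < -(1 / K₂))
    (hΘ : ball M.θ₀ δ ⊆ M.Θ) (hΘm : MeasurableSet M.Θ)
    (hD : ∀ θ ∈ M.Θ, ∀ θ' ∈ M.Θ, ‖θ - θ'‖ ≤ D)
    (hpl : AEMeasurable (M.profLik X n ω) (volume.restrict M.Θ))
    {ρ : EuclideanSpace ℝ (Fin d) → ℝ} (hρ_meas : Measurable ρ) (hρ_nonneg : ∀ θ ∈ M.Θ, 0 ≤ ρ θ)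
    (hρ_le : ∀ θ ∈ ball M.θ₀ δ, ρ θ ≤ R)
    (hρ_lip : ∀ θ ∈ ball M.θ₀ δ, |ρ θ - ρ M.θ₀| ≤ R * ‖θ - M.θ₀‖)
    (hρ_int : IntegrableOn ρ M.Θ) (hρ_one : ∫ θ in M.Θ, ρ θ = 1) :
    ‖θhat n ω - θs‖ ≤ 16 * centerConst d c₀ K / c₀ * ((Real.sqrt n)⁻¹ * rateM r n) ∧
    PosteriorShape A M.Θ M.θ₀ ρ c₀ (centerConst d c₀ K) δ R (1 / (2 * K₂)) D r n
      (fun θ => M.profLik X n ω θ / M.profLik X n ω θs) θs := by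
  have hn' : (0 : ℝ) < n := by exact_mod_cast hn
  have hC : 0 < centerConst d c₀ K := by unfold centerConst; positivity
  have hcen : ‖θs - M.θ₀‖ ≤ centerConst d c₀ K * (Real.sqrt n)⁻¹ := by
    rw [hs, add_sub_cancel_left]
    exact h.norm_center_le hA hK hc₀ hbil
  have hsb : θs ∈ ball M.θ₀ δ := mem_ball_iff_norm.mpr (hcen.trans_lt hcenter)
  -- `Δ_n` vanishes at `θ̂_n`, so separation cannot apply there.
  have hhat : θhat n ω ∈ ball M.θ₀ δ := by
    by_contra hb
    have h1 := hsep _ hmax.1 (not_lt.mp hb) hmax.2.1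
    rw [Delta, sub_self, mul_zero] at h1
    have : 0 < 1 / K₂ := by positivity
    linarith
  have hsub := ball_subset_ball (x := M.θ₀) hδK
  have hmle := h.norm_maximizer_sub_le hA hK hc₀ hbil hs hn hδK hδ hsb hhat
    (hmax.2.2 _ (hΘ hsb))
  have hpls := (h.2 θs (hsub hsb) θs (hsub hsb)).1
  have hrate0 := rateM_nonneg r n
  have hrateA0 := rateA_nonneg r n
  refine ⟨hmle, ⟨hn, hbil, hC, hδ0, hδ, hm, hΘ, hΘm, hcen, hcen.trans hcenter.le, hρ_nonneg, hρ_le,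
    hρ_lip, hρ_int, hρ_one, ?_, fun θ hθ => ?_, fun θ hθ hfarθ => ?_, fun θ hθ => hD θ hθ θs (hΘ hsb),
    hfar⟩⟩
  · rw [aestronglyMeasurable_indicator_iff hΘm]
    exact (hρ_meas.aemeasurable.mul (hpl.div_const _)).aestronglyMeasurable
  · have h1 := (h.2 θ (hsub hθ) θs (hsub hsb)).1
    refine ⟨div_pos h1 hpls, ?_⟩
    rw [Real.log_div h1.ne' hpls.ne']
    have h2 := mul_le_mul_of_nonneg_left (h.recenter hA hK hc₀ hbil hs (hsub hsb) (hsub hθ)) hn'.le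
    rw [← abs_of_pos hn', ← abs_mul, abs_of_pos hn'] at h2
    refine (le_of_eq ?_).trans h2
    congr 1
    field_simp
  · have h0 := profLik_nonneg (X := X) hθ n ω
    refine ⟨div_nonneg h0 hpls.le, ?_⟩
    rcases h0.eq_or_lt with h1 | h1
    · rw [← h1, zero_div]; positivity
    rw [← Real.log_le_iff_le_exp (div_pos h1 hpls), Real.log_div h1.ne' hpls.ne']
    have h2 := hsep θ hθ hfarθ h1
    have h3 := (abs_le.mp (h.recenter hA hK hc₀ hbil hs (hsub hsb) (hsub hhat))).2
    have h4 : 0 ≤ bil A (θhat n ω - θs) (θhat n ω - θs) :=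
      le_trans (by positivity) (hbil (θhat n ω - θs))
    have h5 : centerConst d c₀ K * ‖θhat n ω - θs‖ * (rateA r n + ‖θhat n ω - θs‖) ^ 2
        ≤ 1 / (2 * K₂) := by
      refine le_trans ?_ hrem
      gcongr
    rw [Delta] at h2
    have h6 : (1 : ℝ) / K₂ = 2 * (1 / (2 * K₂)) := by field_simp
    -- Of the gap `1/K₂` below the maximum, `1/(2K₂)` is spent on replacing `θ̂_n` by `θs`.
    have h7 : (n : ℝ)⁻¹ * (Real.log (M.profLik X n ω θ) - Real.log (M.profLik X n ω θs))
        ≤ -(1 / (2 * K₂)) := by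
      rw [mul_sub] at h2 ⊢
      linarith
    have h8 := mul_le_mul_of_nonneg_left h7 hn'.le
    rw [mul_inv_cancel_left₀ hn'.ne'] at h8
    linarith

/-- The posterior profile distribution in terms of likelihood ratios. -/
theorem posteriorU_eq {ρ : EuclideanSpace ℝ (Fin d) → ℝ} (hΘm : MeasurableSet M.Θ)
    (hpl : AEMeasurable (M.profLik X n ω) (volume.restrict M.Θ)) (hρ_meas : Measurable ρ)
    (hρ_nonneg : ∀ θ ∈ M.Θ, 0 ≤ ρ θ) {L : ℝ} (hL : 0 < L) :
    M.posteriorU X ρ n ω = volume.withDensity (fun θ => ENNReal.ofReal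
      (L * M.Θ.indicator (fun θ => ρ θ * (M.profLik X n ω θ / L)) θ)) := by
  rw [posteriorU, prior, ← withDensity_mul₀ hρ_meas.ennreal_ofReal.aemeasurable
    hpl.ennreal_ofReal, ← withDensity_indicator hΘm]
  congr 1
  funext θ
  by_cases hθ : θ ∈ M.Θ
  · rw [Set.indicator_of_mem hθ, Set.indicator_of_mem hθ, Pi.mul_apply,
      ← ENNReal.ofReal_mul (hρ_nonneg θ hθ)]
    congr 1
    field_simp
  · rw [Set.indicator_of_notMem hθ, Set.indicator_of_notMem hθ, mul_zero, ENNReal.ofReal_zero]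

/-- Normalization cancels the factor `L`, so the profile likelihood may be divided by its value at
`θs`. -/
theorem integral_posterior {ρ : EuclideanSpace ℝ (Fin d) → ℝ} (hΘm : MeasurableSet M.Θ)
    (hpl : AEMeasurable (M.profLik X n ω) (volume.restrict M.Θ)) (hρ_meas : Measurable ρ)
    (hρ_nonneg : ∀ θ ∈ M.Θ, 0 ≤ ρ θ) {L : ℝ} (hL : 0 < L)
    (hint : Integrable (M.Θ.indicator fun θ => ρ θ * (M.profLik X n ω θ / L)))
    (hpos : 0 < ∫ θ, M.Θ.indicator (fun θ => ρ θ * (M.profLik X n ω θ / L)) θ) :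
    IsProbabilityMeasure (M.posterior X ρ n ω) ∧ ∀ f : EuclideanSpace ℝ (Fin d) → ℝ,
      Integrable (fun θ => f θ * M.Θ.indicator (fun θ => ρ θ * (M.profLik X n ω θ / L)) θ) →
      Integrable f (M.posterior X ρ n ω) ∧ ∫ θ, f θ ∂(M.posterior X ρ n ω)
        = (∫ θ, f θ * M.Θ.indicator (fun θ => ρ θ * (M.profLik X n ω θ / L)) θ)
          / ∫ θ, M.Θ.indicator (fun θ => ρ θ * (M.profLik X n ω θ / L)) θ := by
  have h0 : ∀ θ, 0 ≤ L * M.Θ.indicator (fun θ => ρ θ * (M.profLik X n ω θ / L)) θ := fun θ =>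
    mul_nonneg hL.le (Set.indicator_nonneg (fun θ hθ => mul_nonneg (hρ_nonneg θ hθ)
      (div_nonneg (profLik_nonneg hθ n ω) hL.le)) θ)
  have h1 : 0 < ∫ θ, L * M.Θ.indicator (fun θ => ρ θ * (M.profLik X n ω θ / L)) θ := by
    rw [integral_const_mul]; positivity
  have h2 := hint.const_mul L
  rw [posterior, posteriorU_eq hΘm hpl hρ_meas hρ_nonneg hL]
  refine ⟨isProbabilityMeasure_normalized h0 h2 h1, fun f hf => ?_⟩
  have h3 : ∀ θ, f θ * (L * M.Θ.indicator (fun θ => ρ θ * (M.profLik X n ω θ / L)) θ)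
      = L * (f θ * M.Θ.indicator (fun θ => ρ θ * (M.profLik X n ω θ / L)) θ) := fun θ => by ring
  obtain ⟨h4, h5⟩ := integral_normalized h0 h2 h1 (f := f) (by
    simp_rw [h3]; exact hf.const_mul L)
  refine ⟨h4, h5.trans ?_⟩
  simp_rw [h3]
  rw [integral_const_mul, integral_const_mul, mul_div_mul_left _ _ hL.ne']

end Deterministic

end SemiModel

/-! ### The prior -/

theorem exists_lipschitz_bound {d : ℕ} {ρ : EuclideanSpace ℝ (Fin d) → ℝ}
    {θ₀ : EuclideanSpace ℝ (Fin d)} (hρ : ContDiffAt ℝ 1 ρ θ₀) :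
    ∃ δ > 0, ∃ R, ∀ θ ∈ ball θ₀ δ, ρ θ ≤ R ∧ |ρ θ - ρ θ₀| ≤ R * ‖θ - θ₀‖ := by
  obtain ⟨L, s, hs, hL⟩ := hρ.exists_lipschitzOnWith
  obtain ⟨δ, hδ, hball⟩ := Metric.mem_nhds_iff.mp hs
  refine ⟨min δ 1, by positivity, L + |ρ θ₀|, fun θ hθ => ?_⟩
  have h1 := mem_ball.mp hθ
  have h2 := hL.dist_le_mul θ (hball (h1.trans_le (min_le_left _ _))) θ₀ (mem_of_mem_nhds hs)
  rw [Real.dist_eq, dist_eq_norm] at h2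
  rw [dist_eq_norm] at h1
  have h3 : ‖θ - θ₀‖ ≤ 1 := h1.le.trans (min_le_right _ _)
  have h4 : (L : ℝ) * ‖θ - θ₀‖ ≤ L := mul_le_of_le_one_right L.2 h3
  constructor
  · linarith [(abs_le.mp h2).2, le_abs_self (ρ θ₀)]
  · refine h2.trans ?_
    gcongr
    exact le_add_of_nonneg_right (abs_nonneg _)

theorem integral_density_eq_one {α : Type*} [MeasurableSpace α] {μ : Measure α} {ρ : α → ℝ}
    (hρ : AEStronglyMeasurable ρ μ) (hρ0 : ∀ᵐ x ∂μ, 0 ≤ ρ x)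
    (h : IsProbabilityMeasure (μ.withDensity fun x => ENNReal.ofReal (ρ x))) :
    Integrable ρ μ ∧ ∫ x, ρ x ∂μ = 1 := by
  have h1 := h.measure_univ
  rw [withDensity_apply _ MeasurableSet.univ, Measure.restrict_univ] at h1
  refine ⟨⟨hρ, ?_⟩, ?_⟩
  · rw [hasFiniteIntegral_iff_ofReal hρ0, h1]
    exact ENNReal.one_lt_top
  · rw [integral_eq_lintegral_of_nonneg_ae hρ0 hρ, h1, ENNReal.toReal_one]

theorem tendsto_sqrt_pow_mul_exp (d : ℕ) {c : ℝ} (hc : 0 < c) (D : ℝ) (r : ℝ) :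
    ∀ᶠ n : ℕ in atTop,
      Real.sqrt n ^ d * (Real.exp (-c * n) * (1 + Real.sqrt n * D) ^ 2) ≤ rateM r n := by
  -- Using `√n ≤ n`, the power of `n` is `d` from the Jacobian, `2` from the square and `1` from
  -- comparing with `n^{-1/2} ≤ M_n`.
  have h1 : Tendsto (fun n : ℕ => (1 + |D|) ^ 2 / c ^ (d + 3) *
      ((c * n) ^ (d + 3) * Real.exp (-(c * n)))) atTop (𝓝 0) := by
    have h2 := (Real.tendsto_pow_mul_exp_neg_atTop_nhds_zero (d + 3)).comp
      (tendsto_natCast_atTop_atTop.const_mul_atTop hc)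
    simpa using h2.const_mul ((1 + |D|) ^ 2 / c ^ (d + 3))
  filter_upwards [h1.eventually (Iic_mem_nhds zero_lt_one), eventually_ge_atTop 1] with n h2 hn
  have hn1 : (1 : ℝ) ≤ n := by exact_mod_cast hn
  have hs1 : 1 ≤ Real.sqrt n := Real.one_le_sqrt.mpr hn1
  have hs : 0 < Real.sqrt n := by linarith
  have hss : Real.sqrt n ≤ n := by nlinarith [Real.mul_self_sqrt (by linarith : (0 : ℝ) ≤ n)]
  refine le_trans ?_ (PosteriorShape.inv_sqrt_le_rateM r hn)
  rw [← one_div, le_div_iff₀ hs]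
  refine le_trans ?_ (Set.mem_Iic.mp h2)
  have h3 : (1 + Real.sqrt n * D) ^ 2 ≤ (n * (1 + |D|)) ^ 2 := by
    refine sq_le_sq.mpr ?_
    rw [abs_of_nonneg (by positivity : 0 ≤ (n : ℝ) * (1 + |D|))]
    refine (abs_add_le _ _).trans ?_
    rw [abs_one, abs_mul, abs_of_pos hs, mul_add, mul_one]
    gcongr
  calc Real.sqrt n ^ d * (Real.exp (-c * n) * (1 + Real.sqrt n * D) ^ 2) * Real.sqrt n
      ≤ (n : ℝ) ^ d * (Real.exp (-c * n) * (n * (1 + |D|)) ^ 2) * n := by gcongr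
    _ = _ := by
        rw [neg_mul, mul_pow c]
        field_simp
        ring

/-! ### The posterior profile distribution -/

namespace SemiModel

variable {d : ℕ} {S : Type*} [MeasurableSpace S] {B : Type*} [SeminormedAddCommGroup B]
  {M : SemiModel d S B} {path : EuclideanSpace ℝ (Fin d) → EuclideanSpace ℝ (Fin d) → B → B}
  {N : Set (ℝ → B)} {hS : ∀ i, MemLp (M.score i) 2 M.P}
  {Ω : Type*} [MeasurableSpace Ω] {X : ℕ → Ω → S} {Q : Measure Ω}
  {θhat : ℕ → Ω → EuclideanSpace ℝ (Fin d)}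
  {ηhat : ℕ → Ω → EuclideanSpace ℝ (Fin d) → B} {r : ℝ}

/-- The posterior profile distribution is well defined, its mean approximates the maximum likelihood
estimator and its inverse covariance matrix approximates the efficient information matrix. -/
structure PosteriorApprox (M : SemiModel d S B) (X : ℕ → Ω → S) (ρ : EuclideanSpace ℝ (Fin d) → ℝ)
    (θhat : ℕ → Ω → EuclideanSpace ℝ (Fin d)) (A : Matrix (Fin d) (Fin d) ℝ) (r C : ℝ)
    (n : ℕ) (ω : Ω) : Prop where
  isProbabilityMeasure : IsProbabilityMeasure (M.posterior X ρ n ω)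
  integrable : Integrable (fun θ => ‖θ‖ ^ 2) (M.posterior X ρ n ω)
  isUnit : IsUnit (M.postCov X ρ n ω).det
  mean : ‖θhat n ω - M.postMean X ρ n ω‖ ≤ C * ((Real.sqrt n)⁻¹ * rateM r n)
  cov : ∀ i j, |A i j - ((n : ℝ)⁻¹ • (M.postCov X ρ n ω)⁻¹) i j| ≤ C * rateM r n

/-- Half of `ε` is spent on the expansion, which fixes `K`; then `δ` is chosen, and the other half
is spent on separation at distance `δ`, which fixes `K₂`. Every other requirement is deterministic
and holds for large `n`. -/
theorem Assumptions.eventually_posteriorApprox [IsProbabilityMeasure Q]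
    (hass : M.Assumptions X path N hS Q ηhat r) (hX : ∀ i, Measurable (X i))
    (hindep : iIndepFun X Q) (hlaw : ∀ i, Q.map (X i) = M.P) (hmle : M.IsMLE X Q θhat ηhat)
    (hpl : ∀ n, ∀ᵐ ω ∂Q, AEMeasurable (M.profLik X n ω) (volume.restrict M.Θ))
    (hr : 1 / 4 < r) (hrate : M.NuisanceRate Q ηhat r)
    (hsep : ∀ θt : ℕ → Ω → EuclideanSpace ℝ (Fin d), (∀ n ω, θt n ω ∈ M.Θ) →
      Tendsto (fun n => Q {ω | ¬ 0 < M.profLik X n ω (θt n ω)}) atTop (𝓝 0) →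
      TendstoInMeasure Q (fun n ω => M.Delta X θhat n ω (θt n ω)) atTop (fun _ => 0) →
      TendstoInMeasure Q θt atTop (fun _ => M.θ₀))
    {ρ : EuclideanSpace ℝ (Fin d) → ℝ} (hρ_meas : Measurable ρ) (hρ_nonneg : ∀ θ ∈ M.Θ, 0 ≤ ρ θ)
    (hρ_proper : IsProbabilityMeasure (M.prior ρ)) (hρ_pos : 0 < ρ M.θ₀)
    (hρ_smooth : ContDiffAt ℝ 1 ρ M.θ₀) {ε : ℝ≥0∞} (hε : 0 < ε) :
    ∃ C : ℝ, ∀ᶠ n in atTop,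
      Q {ω | ¬ M.PosteriorApprox X ρ θhat (M.effInfo N hS) r C n ω} ≤ ε := by
  have hA := hass.posDef
  obtain ⟨w, hw⟩ := hass.tight_profileExpansion hX hindep hlaw hmle (by linarith) hrate
  set A := M.effInfo N hS with hAdef
  obtain ⟨c₀, hc₀, hbil⟩ := exists_pos_le_bil hA
  obtain ⟨K', hK'⟩ := hw (ε / 2) (ENNReal.half_pos hε.ne')
  set K := max K' 1
  have hK : 0 < K := lt_max_of_lt_right one_pos
  have hev1 := hK' K (le_max_left _ _)
  set C₁ := centerConst d c₀ K with hC₁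
  have hC₁0 : 0 < C₁ := by rw [hC₁, centerConst]; positivity
  obtain ⟨δ₁, hδ₁, hΘ⟩ := Metric.mem_nhds_iff.mp (mem_interior_iff_mem_nhds.mp hass.interior)
  obtain ⟨δ₂, hδ₂, R, hR⟩ := exists_lipschitz_bound hρ_smooth
  -- The four radii keep the ball inside `Θ`, control the prior, stay in the domain of the
  -- expansion, and let the quadratic term absorb the cubic part of the remainder.
  set δ := min (min δ₁ δ₂) (min (1 / K) (c₀ / (16 * C₁)))
  have hδ : 0 < δ := by positivity
  have hδ_le1 : δ ≤ δ₁ := (min_le_left _ _).trans (min_le_left _ _)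
  have hδ_le2 : δ ≤ δ₂ := (min_le_left _ _).trans (min_le_right _ _)
  have hδK : δ ≤ 1 / K := (min_le_right _ _).trans (min_le_left _ _)
  have hδC : 4 * C₁ * δ ≤ c₀ / 4 := by
    have h1 : δ ≤ c₀ / (16 * C₁) := (min_le_right _ _).trans (min_le_right _ _)
    rw [le_div_iff₀ (by positivity)] at h1
    linarith
  obtain ⟨K₂', hK₂'⟩ := hass.tight_separation hX hlaw hmle hsep hδ (ε / 2) (ENNReal.half_pos hε.ne')
  set K₂ := max K₂' 1
  have hK₂ : 0 < K₂ := lt_max_of_lt_right one_pos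
  have hev2 := hK₂' K₂ (le_max_left _ _)
  have hΘm : MeasurableSet M.Θ := hass.compact.isClosed.measurableSet
  have hD : ∀ θ ∈ M.Θ, ∀ θ' ∈ M.Θ, ‖θ - θ'‖ ≤ Metric.diam M.Θ := fun θ hθ θ' hθ' => by
    rw [← dist_eq_norm]
    exact Metric.dist_le_diam_of_mem hass.compact.isBounded hθ hθ'
  obtain ⟨hρ_int, hρ_one⟩ := integral_density_eq_one (μ := volume.restrict M.Θ)
    hρ_meas.aestronglyMeasurable ((ae_restrict_iff' hΘm).mpr (ae_of_all _ hρ_nonneg)) hρ_proper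
  obtain ⟨η, hη, L, hL, hinv⟩ := exists_inv_sub_le hA
  set C₂ := 16 * C₁ / c₀ with hC₂
  set C₃ := PosteriorShape.momentConst A (ρ M.θ₀) c₀ C₁ δ R with hC₃
  have hC₃0 : 0 ≤ C₃ := PosteriorShape.momentConst_nonneg _ _ _ _ _ _
  have tm := tendsto_rateM hr
  have ts := tendsto_inv_sqrt_nat
  have ta := tendsto_rateA (r := r) (by linarith)
  have hsmall : ∀ (u : ℕ → ℝ), Tendsto u atTop (𝓝 0) → ∀ x : ℝ, 0 < x → ∀ᶠ n in atTop, u n < x :=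
    fun u hu x hx => hu.eventually (Iio_mem_nhds hx)
  have e1 := hsmall _ tm 1 one_pos
  have e2 := hsmall (fun n => C₁ * (Real.sqrt n)⁻¹) (by simpa using ts.const_mul C₁) δ hδ
  have e3 := hsmall (fun n => C₁ * (C₂ * ((Real.sqrt n)⁻¹ * rateM r n))
      * (rateA r n + C₂ * ((Real.sqrt n)⁻¹ * rateM r n)) ^ 2) (by
    have h1 := (ts.mul tm).const_mul C₂
    simpa using (h1.const_mul C₁).mul ((ta.add h1).pow 2)) (1 / (2 * K₂)) (by positivity)
  have e4 := tendsto_sqrt_pow_mul_exp d (c := 1 / (2 * K₂)) (by positivity) (Metric.diam M.Θ) r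
  have e5 := hsmall (fun n => errConst d c₀ C₁ δ R * rateM r n)
    (by simpa using tm.const_mul (errConst d c₀ C₁ δ R)) (ρ M.θ₀ * (∫ u, gauss A u) / 2)
    (by have := integral_gauss_pos hA; positivity)
  have e6 := hsmall (fun n => (C₃ + C₃ ^ 2) * rateM r n)
    (by simpa using tm.const_mul (C₃ + C₃ ^ 2)) η hη
  refine ⟨max (C₂ + d * C₃) (L * (C₃ + C₃ ^ 2)), ?_⟩
  filter_upwards [hev1, hev2, e1, e2, e3, e4, e5, e6, eventually_gt_atTop 0]
    with n hQ1 hQ2 n1 n2 n3 n4 n5 n6 hn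
  have hgood : ∀ᵐ ω ∂Q, M.ProfileExpansion X A r w K n ω → (∀ θ ∈ M.Θ, δ ≤ dist θ M.θ₀ →
      0 < M.profLik X n ω θ → M.Delta X θhat n ω θ < -(1 / K₂)) → M.PosteriorApprox X ρ θhat A r
        (max (C₂ + d * C₃) (L * (C₃ + C₃ ^ 2))) n ω := by
    filter_upwards [hass.ae_profLik_pos hX hlaw hmle n, hpl n] with ω hmax hplω hexp hsepω
    have hn' : (0 : ℝ) < n := by exact_mod_cast hn
    have hm0 := rateM_nonneg r n
    set θs := M.θ₀ + solve A (w n ω) with hθs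
    obtain ⟨hclose, hshape⟩ := hexp.posteriorShape hA hK hc₀ hbil hθs hn hδ hK₂ hδK hδC n1.le n2
      n3.le n4 hmax hsepω ((ball_subset_ball hδ_le1).trans hΘ) hΘm hD hplω hρ_meas hρ_nonneg
      (fun θ hθ => (hR θ (ball_subset_ball hδ_le2 hθ)).1)
      (fun θ hθ => (hR θ (ball_subset_ball hδ_le2 hθ)).2) hρ_int hρ_one
    have hsb : θs ∈ ball M.θ₀ (1 / K) := by
      rw [mem_ball_iff_norm, hθs, add_sub_cancel_left]
      exact ((hexp.norm_center_le hA hK hc₀ hbil).trans_lt n2).trans_le hδK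
    have hLpos := (hexp.2 θs hsb θs hsb).1
    obtain ⟨hprob, hπ⟩ := integral_posterior hΘm hplω hρ_meas hρ_nonneg hLpos
      (hshape.integrable_density hA) (hshape.mass_pos hA hρ_pos n5.le)
    obtain ⟨p1, p2, p3⟩ := hshape.posterior_moments hA hρ_pos n5.le hπ
    -- The matrix near `A⁻¹` is `n` times the posterior covariance; its invertibility and inverse
    -- are passed on to the covariance itself.
    obtain ⟨q1, q2⟩ := hinv ((n : ℝ) • M.postCov X ρ n ω) ((C₃ + C₃ ^ 2) * rateM r n) n6.le
      (by positivity) p3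
    have q3 : IsUnit (M.postCov X ρ n ω).det := by
      rw [Matrix.det_smul] at q1
      exact isUnit_of_mul_isUnit_right q1
    have q4 : ((n : ℝ) • M.postCov X ρ n ω)⁻¹ = (n : ℝ)⁻¹ • (M.postCov X ρ n ω)⁻¹ := by
      refine Matrix.inv_eq_right_inv ?_
      rw [Matrix.smul_mul, Matrix.mul_smul, smul_smul, mul_inv_cancel₀ hn'.ne', one_smul,
        Matrix.mul_nonsing_inv _ q3]
    rw [q4] at q2
    refine ⟨hprob, p1, q3, ?_, fun i j => (q2 i j).trans ?_⟩
    · calc ‖θhat n ω - M.postMean X ρ n ω‖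
          ≤ ‖θhat n ω - θs‖ + ‖θs - M.postMean X ρ n ω‖ := norm_sub_le_norm_sub_add_norm_sub _ _ _
        _ ≤ C₂ * ((Real.sqrt n)⁻¹ * rateM r n) + d * C₃ * ((Real.sqrt n)⁻¹ * rateM r n) :=
            add_le_add hclose p2
        _ = (C₂ + d * C₃) * ((Real.sqrt n)⁻¹ * rateM r n) := by ring
        _ ≤ _ := by gcongr; exact le_max_left _ _
    · rw [← mul_assoc]
      gcongr
      exact le_max_right _ _
  calc Q {ω | ¬ M.PosteriorApprox X ρ θhat A r (max (C₂ + d * C₃) (L * (C₃ + C₃ ^ 2))) n ω}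
      ≤ Q ({ω | ¬ M.ProfileExpansion X A r w K n ω} ∪ {ω | ¬ ∀ θ ∈ M.Θ, δ ≤ dist θ M.θ₀ →
        0 < M.profLik X n ω θ → M.Delta X θhat n ω θ < -(1 / K₂)}) := by
        refine measure_mono_ae ?_
        filter_upwards [hgood] with ω hω hbad
        by_contra hno
        exact hbad (hω (not_not.mp fun h => hno (Or.inl h)) (not_not.mp fun h => hno (Or.inr h)))
    _ ≤ ε / 2 + ε / 2 := (measure_union_le _ _).trans (add_le_add hQ1 hQ2)
    _ = ε := ENNReal.add_halves ε

end SemiModel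

end ProfileSampler

/-! ### The main theorem -/

theorem corollary2 {d : ℕ} {S : Type*} [MeasurableSpace S] {B : Type*} [SeminormedAddCommGroup B]
    {Ω : Type*} [MeasurableSpace Ω] (Q : Measure Ω) [IsProbabilityMeasure Q]
    -- the model, the nuisance submodels that define the nuisance scores, the map `η_t(θ, η)`
    (M : SemiModel d S B) (N : Set (ℝ → B))
    (path : EuclideanSpace ℝ (Fin d) → EuclideanSpace ℝ (Fin d) → B → B)
    -- i.i.d. data from the true distribution
    (X : ℕ → Ω → S) (hX : ∀ i, Measurable (X i)) (hindep : iIndepFun X Q)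
    (hlaw : ∀ i, Q.map (X i) = M.P)
    -- the maximizers of the likelihood
    (θhat : ℕ → Ω → EuclideanSpace ℝ (Fin d)) (ηhat : ℕ → Ω → EuclideanSpace ℝ (Fin d) → B)
    (hmle : M.IsMLE X Q θhat ηhat)
    (hpl : ∀ n, ∀ᵐ ω ∂Q, AEMeasurable (M.profLik X n ω) (volume.restrict M.Θ))
    -- the standing assumptions and the convergence rate of the nuisance parameter
    (r : ℝ) (hr : 1 / 4 < r) (hrate : M.NuisanceRate Q ηhat r)
    (hS : ∀ i, MemLp (M.score i) 2 M.P)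
    (hass : M.Assumptions X path N hS Q ηhat r)
    -- `Δ_n(θ̃_n) = o_P(1)` implies `θ̃_n → θ₀` in probability (with `log 0 = -∞`)
    (hsep : ∀ θt : ℕ → Ω → EuclideanSpace ℝ (Fin d), (∀ n ω, θt n ω ∈ M.Θ) →
      Tendsto (fun n => Q {ω | ¬ 0 < M.profLik X n ω (θt n ω)}) atTop (𝓝 0) →
      TendstoInMeasure Q (fun n ω => M.Delta X θhat n ω (θt n ω)) atTop (fun _ => 0) →
      TendstoInMeasure Q θt atTop (fun _ => M.θ₀))
    -- the proper prior density `ρ` on `Θ`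
    (ρ : EuclideanSpace ℝ (Fin d) → ℝ) (hρ_meas : Measurable ρ) (hρ_nonneg : ∀ θ ∈ M.Θ, 0 ≤ ρ θ)
    (hρ_proper : IsProbabilityMeasure (M.prior ρ)) (hρ_pos : 0 < ρ M.θ₀)
    (hρ_smooth : ContDiffAt ℝ 1 ρ M.θ₀)
    (hρ_moment : Integrable (fun θ => ‖θ‖ ^ 2) (M.prior ρ)) :
    -- with probability tending to one, the posterior profile distribution, its mean and the inverse
    -- of its covariance matrix are well defined
    Tendsto (fun n => Q {ω | ¬ (IsProbabilityMeasure (M.posterior X ρ n ω) ∧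
        Integrable (fun θ => ‖θ‖ ^ 2) (M.posterior X ρ n ω) ∧
        IsUnit (M.postCov X ρ n ω).det)}) atTop (𝓝 0) ∧
    IsBigOP Q (fun n ω => ‖θhat n ω - M.postMean X ρ n ω‖)
      (fun n _ => (n : ℝ) ^ (-(1 / 2) : ℝ) * rateM r n) ∧
    ∀ i j, IsBigOP Q
      (fun n ω => M.effInfo N hS i j - ((n : ℝ)⁻¹ • (M.postCov X ρ n ω)⁻¹) i j)
      (fun n _ => rateM r n) := by
  -- For each `ε` one event and one constant `C` serve all three conclusions; the dependence of `C`
  -- on `ε` is what stochastic boundedness permits.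
  have key := fun (ε : ℝ≥0∞) (hε : 0 < ε) => hass.eventually_posteriorApprox hX hindep hlaw hmle hpl
    hr hrate hsep hρ_meas hρ_nonneg hρ_proper hρ_pos hρ_smooth hε
  refine ⟨ENNReal.tendsto_nhds_zero.mpr fun ε hε => ?_, fun ε hε => ?_, fun i j ε hε => ?_⟩ <;>
    obtain ⟨C, hC⟩ := key ε hε
  · filter_upwards [hC] with n hn
    exact (measure_mono (Set.ofPred_subset_ofPred.mpr fun ω hω h =>
      hω ⟨h.isProbabilityMeasure, h.integrable, h.isUnit⟩)).trans hn
  · refine ⟨C, ?_⟩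
    filter_upwards [hC] with n hn
    refine le_trans (measure_mono (Set.ofPred_subset_ofPred.mpr fun ω hω h => ?_)) hn
    refine not_le.mpr hω ?_
    rw [abs_of_nonneg (norm_nonneg _), rpow_neg_half]
    exact h.mean
  · refine ⟨C, ?_⟩
    filter_upwards [hC] with n hn
    refine le_trans (measure_mono (Set.ofPred_subset_ofPred.mpr fun ω hω h => ?_)) hn
    exact not_le.mpr hω (h.cov i j)
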